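/- Let $k\ge 1$, $m,\ell\ge 0$, $n=k+m+\ell$, and let $Z=(\tilde z\,|\,z)$ be a real $(k+m)\times n$ matrix, all of whose ordered maximal minors are positive, with $\tilde z$ its first $k+m$ columns. For a $k\times n$ matrix $C$ with rows $C_\alpha$ let $p_I(C)$ be its maximal minors, $$\mu_{\mathrm{Gr}(k,n)}(C)=\bigwedge_{\alpha=1}^k\ \sum_{|I|=k}\epsilon_{I\bar I}\,p_I(C)\bigwedge_{i\in\bar I}dC_{\alpha i},\qquad \mathbf\Omega(\mathrm{Gr}_+(k,n))=\frac{\mu_{\mathrm{Gr}(k,n)}(C)}{\prod_{i=1}^n p_{I_i}(C)},$$ where $\bar I=[n]\setminus I$, $\epsilon_{I\bar I}$ is the sign of the permutation listing $I$ and then $\bar I$ increasingly, and $I_i=\{i,\dots,i+k-1\}$ modulo $n$. Let $\pi:\mathrm{Gr}(k,n)\dashrightarrow\mathrm{Gr}(k,k+m)$, $\pi(V)=Z(V)$, be defined where $V\cap\ker Z=0$; that is, $C\mapsto CZ^T$ on matrices. The amplituhedron $\mathcal A_{n,k,m}$ is $\pi(\mathrm{Gr}_+(k,n))$. Let $Y$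 be a $k\times(k+m)$ matrix of rank $k$ representing a point of $\mathcal A_{n,k,m}$. The *fiber volume form* $\omega_{n,k,m}$ is the restriction to the fiber $\pi^{-1}(Y)$, lifted to $\{C: CZ^T=Y\}$, of a basic covariant $k\ell$-form $\omega$ of degree $-(k+m)$ (on the open set of matrices where $\pi$ is defined and no $p_{I_i}$ vanishes) with $\mathbf\Omega(\mathrm{Gr}_+(k,n))=\omega\wedge\pi^*\mu_{\mathrm{Gr}(k,k+m)}$. A *frame* is a matrix $A$ whose $\ell+k$ rows form a basis of $Z^{-1}(Y)\subset\mathbb R^n$, the first $\ell$ of them lying in $\ker Z$ and the last $k$ being mapped by $Z$ to the rows of $Y$. Put $$A_0=\begin{pmatrix}-(\tilde z^{-1}z)^T&\mathbb I_\ell\\ Y(\tilde z^{T})^{-1}&0\end{pmatrix}.$$ Call $Y$ *generic* if the subspace $Y$ meets no span of $m$ columns of $Z$ nontrivially. (1) *Cyclic polytopes.* Let $k=1$, so $\ell=n-m-1\ge0$. A rational $\omega$ as above, without poles on that open set, exists. $A=A_0$ is a frame, and $\lambda_1,\dots,\lambda_\ell$ are affine coordinates on $\pi^{-1}(Y)$: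 with $\lambda=(\lambda_1,\dots,\lambda_\ell,1)$, the map $(\lambda_1,\dots,\lambda_\ell)\mapsto\mathrm{span}(\lambda A)$ is a bijection $\mathbb R^\ell\to\pi^{-1}(Y)$. With $A^i$ the $i$-th column of $A$, whichever $\omega$ is used, $$\omega_{n,1,m}=c\;\frac{d\lambda_1\wedge\cdots\wedge d\lambda_\ell}{\prod_{i=1}^n(\lambda\cdot A^i)},\qquad c=\frac{(-1)^{\ell m}}{\det\tilde z},$$ at all points where no factor of the denominator vanishes. If $\ell\ge2$, or if $\ell=1$ and $Y$ is generic, then the equations $\lambda\cdot A^i=0$, $i\in[n]$, define $n$ pairwise distinct affine hyperplanes of $\mathbb R^\ell$, and $\omega_{n,1,m}$ is regular off them, with a pole of order one at every point lying on exactly one of them. If $\ell\ge1$, there is also a frame $A$ for which all this holds with $c=1$. (2) *Conjugates to polytopes.* Let $\ell=n-m-1\ge1$ and take the number of rows $k=\ell$ (so that $\ker Z$ is a line, and a frame has $1+\ell$ rows). A rational $\omega$ as above, without poles on that open set, exists. Let $A=A_0$, which is a frame. Let $(A^{I_i})^\perp\in\mathbb R^{\ell+1}$ be the vector with $v\cdot(A^{I_i})^\perp=\det(v\,|\,A^{I_i})$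 for all $v$, where $A^{I_i}$ is the submatrix of the columns in $I_i$ in increasing order; it is nonzero and orthogonal to these columns. With $\bar\lambda=(1,\bar\lambda_1,\dots,\bar\lambda_\ell)$ and $\lambda=\bar\lambda^\perp$ represented by the matrix $(-(\bar\lambda_1,\dots,\bar\lambda_\ell)^T\,|\,\mathbb I_\ell)$, the map $(\bar\lambda_1,\dots,\bar\lambda_\ell)\mapsto\mathrm{rowspan}(\lambda A)$ is a bijection $\mathbb R^\ell\to\pi^{-1}(Y)$, and, whichever $\omega$ is used, $$\omega_{n,\ell,m}=c\;\frac{d\bar\lambda_1\wedge\cdots\wedge d\bar\lambda_\ell}{\prod_{i=1}^n\bar\lambda\cdot(A^{I_i})^\perp},\qquad c=\frac{(-1)^{\ell+m\ell(\ell+1)/2}}{(\det\tilde z)^\ell},$$ at all points where no factor of the denominator vanishes. If $m$ is even and $\ell\ge2$, or if $Y$ is generic, then the equations $\bar\lambda\cdot(A^{I_i})^\perp=0$, $i\in[n]$, define $n$ pairwise distinct affine hyperplanes of $\mathbb R^\ell$, and $\omega_{n,\ell,m}$ is regular off them, with a pole of order one at every point lying on exactly one of them. If $m$ is even, there is also a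 frame $A$ for which all this holds with $c=1$. -/

import Mathlib

open Matrix Topology
open scoped BigOperators

noncomputable section

namespace Amplituhedron

/-! ### Grassmannians, positivity, the amplituhedron and its fibers -/

/-- The Plücker coordinate `p_I(C)`: the maximal minor of `C` on the columns in `I`, taken in
increasing order. -/
def plucker {k n : ℕ} (C : Matrix (Fin k) (Fin n) ℝ) (I : Finset (Fin n)) : ℝ :=
  if h : I.card = k then (C.submatrix id (I.orderEmbOfFin h)).det else 0

/-- All ordered maximal minors are positive. -/
def TotallyPositive {k n : ℕ} (C : Matrix (Fin k) (Fin n) ℝ) : Prop :=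
  ∀ I : Finset (Fin n), I.card = k → 0 < plucker C I

/-- The span of the rows of a matrix. -/
def rowSpan {k n : ℕ} (C : Matrix (Fin k) (Fin n) ℝ) : Submodule ℝ (Fin n → ℝ) :=
  Submodule.span ℝ (Set.range C.row)

/-- The positive Grassmannian `Gr₊(k,n)`, as a set of subspaces of `ℝⁿ`. -/
def posGrassmannian (k n : ℕ) : Set (Submodule ℝ (Fin n → ℝ)) :=
  {V | ∃ C : Matrix (Fin k) (Fin n) ℝ, TotallyPositive C ∧ rowSpan C = V}

/-- The amplituhedron `A_{n,k,m}(Z)`: the image of `Gr₊(k,n)` under the linear map `v ↦ Z v`. -/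
def amplituhedron (k m : ℕ) {n : ℕ} (Z : Matrix (Fin (k + m)) (Fin n) ℝ) :
    Set (Submodule ℝ (Fin (k + m) → ℝ)) :=
  (fun V => V.map Z.mulVecLin) '' posGrassmannian k n

/-- The full fiber `π⁻¹(W)` of the rational map `π : Gr(k,n) ⇢ Gr(k,k+m)`, `V ↦ Z(V)`, which is
defined on those `V` which meet `ker Z` trivially. -/
def fiber (k m : ℕ) {n : ℕ} (Z : Matrix (Fin (k + m)) (Fin n) ℝ)
    (W : Submodule ℝ (Fin (k + m) → ℝ)) : Set (Submodule ℝ (Fin n → ℝ)) :=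
  {V | Module.finrank ℝ V = k ∧ Disjoint V (LinearMap.ker Z.mulVecLin) ∧
    V.map Z.mulVecLin = W}

/-- The cyclic `k`-interval `{j, j+1, …, j+k-1}` modulo `n`. -/
def cyclicInterval {n : ℕ} (k : ℕ) (j : Fin n) : Finset (Fin n) :=
  Finset.univ.filter fun i => ∃ t < k, (i : ℕ) = ((j : ℕ) + t) % n

/-! ### Differential forms, with values in the exterior algebra of the dual space -/

/-- The exterior algebra of constant forms on `E`; the product is the wedge product. -/
abbrev Forms (E : Type*) [AddCommGroup E] [Module ℝ E] : Type _ :=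
  ExteriorAlgebra ℝ (Module.Dual ℝ E)

/-- Contraction of a form with a vector. -/
def contract {E : Type*} [AddCommGroup E] [Module ℝ E] (v : E) : Forms E →ₗ[ℝ] Forms E :=
  CliffordAlgebra.contractLeft (Q := (0 : QuadraticForm ℝ (Module.Dual ℝ E)))
    (Module.Dual.eval ℝ E v)

/-- Pullback of a differential form along a (differentiable) map. -/
def pullback {E F : Type*} [AddCommGroup E] [Module ℝ E] [TopologicalSpace E] [AddCommGroup F]
    [Module ℝ F] [TopologicalSpace F] (f : E → F) (η : F → Forms F) (x : E) : Forms E :=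
  ExteriorAlgebra.map (fderiv ℝ f x : E →ₗ[ℝ] F).dualMap (η (f x))

/-- The constant form `dx₁ ∧ ⋯ ∧ dx_l` on `ℝˡ`. -/
def coordVolume (l : ℕ) : Forms (Fin l → ℝ) :=
  ExteriorAlgebra.ιMulti ℝ l fun i => (LinearMap.proj i : (Fin l → ℝ) →ₗ[ℝ] ℝ)

/-- The one-form `dC_{α i}` on the space of matrices. -/
def dEntry {k n : ℕ} (α : Fin k) (i : Fin n) : Forms (Matrix (Fin k) (Fin n) ℝ) :=
  ExteriorAlgebra.ι ℝ (Matrix.entryLinearMap ℝ ℝ α i)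

/-- The sign `ε_{I Ī}` of the permutation which lists `I` and then its complement, both in
increasing order: `-1` to the number of inversions. -/
def shuffleSign {n : ℕ} (I : Finset (Fin n)) : ℝ :=
  (-1) ^ ((I ×ˢ Iᶜ).filter fun p => p.2 < p.1).card

/-- `⟨C d^{n-k} C_α⟩ = ∑_I ε_{I Ī} p_I(C) ⋀_{i ∈ Ī} dC_{α i}`. -/
def rowForm {k n : ℕ} (C : Matrix (Fin k) (Fin n) ℝ) (α : Fin k) :
    Forms (Matrix (Fin k) (Fin n) ℝ) :=
  ∑ I ∈ Finset.powersetCard k (Finset.univ : Finset (Fin n)),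
    (shuffleSign I * plucker C I) • ((Iᶜ.sort).map fun i => dEntry α i).prod

/-- The standard (covariant) volume form `μ_{Gr(k,n)} = ⋀_α ⟨C d^{n-k} C_α⟩`. -/
def grassmannVolume {k n : ℕ} (C : Matrix (Fin k) (Fin n) ℝ) :
    Forms (Matrix (Fin k) (Fin n) ℝ) :=
  (List.ofFn fun α : Fin k => rowForm C α).prod

/-- The canonical form `μ_{Gr(k,n)} / ∏_j p_{I_j}` of the positive Grassmannian. -/
def canonicalForm {k n : ℕ} (C : Matrix (Fin k) (Fin n) ℝ) :
    Forms (Matrix (Fin k) (Fin n) ℝ) :=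
  (∏ j : Fin n, plucker C (cyclicInterval k j))⁻¹ • grassmannVolume C

/-! ### The fiber volume form -/

section
variable {k m l : ℕ}

/-- The matrices `C` at which the canonical form of `Gr₊(k,n)` has no pole and `π` is defined. -/
def regularLocus (Z : Matrix (Fin (k + m)) (Fin (k + m + l)) ℝ) :
    Set (Matrix (Fin k) (Fin (k + m + l)) ℝ) :=
  {C | (∀ j, plucker C (cyclicInterval k j) ≠ 0) ∧ LinearIndependent ℝ (C * Zᵀ).row}

/-- `ω` is a `k(n-m-k)`-form on `Gr(k,n)` (a basic covariant form of degree `-(k+m)` on matrices)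
with `Ω(Gr₊(k,n)) = ω ∧ π^* μ_{Gr(k,k+m)}`. The volume form on a fiber of `π` is the restriction of
such an `ω` to the fiber. -/
structure IsFiberFactor (Z : Matrix (Fin (k + m)) (Fin (k + m + l)) ℝ)
    (ω : Matrix (Fin k) (Fin (k + m + l)) ℝ → Forms (Matrix (Fin k) (Fin (k + m + l)) ℝ)) :
    Prop where
  degree : ∀ C ∈ regularLocus Z,
    ω C ∈ ⋀[ℝ]^(k * l) (Module.Dual ℝ (Matrix (Fin k) (Fin (k + m + l)) ℝ))
  horizontal : ∀ C ∈ regularLocus Z, ∀ X : Matrix (Fin k) (Fin k) ℝ,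
    contract (X * C) (ω C) = 0
  covariant : ∀ C ∈ regularLocus Z, ∀ G : Matrix (Fin k) (Fin k) ℝ, G.det ≠ 0 →
    pullback (fun C' => G * C') ω C = (G.det ^ (k + m))⁻¹ • ω C
  factor : ∀ C ∈ regularLocus Z,
    canonicalForm C = ω C * pullback (fun C' => C' * Zᵀ) grassmannVolume C

/-- The coefficients of `ω` are rational functions without poles on the regular locus. -/
def IsRegularRational (Z : Matrix (Fin (k + m)) (Fin (k + m + l)) ℝ)
    (ω : Matrix (Fin k) (Fin (k + m + l)) ℝ → Forms (Matrix (Fin k) (Fin (k + m + l)) ℝ)) :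
    Prop :=
  ∃ (N : ℕ) (P : Fin N → MvPolynomial (Fin k × Fin (k + m + l)) ℝ)
    (Q : MvPolynomial (Fin k × Fin (k + m + l)) ℝ)
    (η : Fin N → Forms (Matrix (Fin k) (Fin (k + m + l)) ℝ)),
    ∀ C ∈ regularLocus Z, MvPolynomial.eval (fun p => C p.1 p.2) Q ≠ 0 ∧
      ω C = ∑ s, (MvPolynomial.eval (fun p => C p.1 p.2) (P s) /
        MvPolynomial.eval (fun p => C p.1 p.2) Q) • η s

/-! ### The matrix `A` whose rows are a basis of `Z⁻¹(Y)` -/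

/-- The rows of `A` form a basis of `Z⁻¹(Y)`: the first `l` of them a basis of `ker Z`, the last
`k` of them preimages of the rows of `Y`. -/
structure IsFiberFrame (Z : Matrix (Fin (k + m)) (Fin (k + m + l)) ℝ)
    (Y : Matrix (Fin k) (Fin (k + m)) ℝ)
    (A : Matrix (Fin l ⊕ Fin k) (Fin (k + m + l)) ℝ) : Prop where
  indep : LinearIndependent ℝ A.row
  kernel : A.submatrix Sum.inl id * Zᵀ = 0
  lift : A.submatrix Sum.inr id * Zᵀ = Y

/-- The first `k + m` columns of `Z`. -/
def leadingBlock (Z : Matrix (Fin (k + m)) (Fin (k + m + l)) ℝ) :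
    Matrix (Fin (k + m)) (Fin (k + m)) ℝ :=
  Z.submatrix id (Fin.castAdd l)

/-- The last `l` columns of `Z`. -/
def trailingBlock (Z : Matrix (Fin (k + m)) (Fin (k + m + l)) ℝ) :
    Matrix (Fin (k + m)) (Fin l) ℝ :=
  Z.submatrix id (Fin.natAdd (k + m))

/-- For `Z = (z̃ | z)`, the block matrix with rows `(-(z̃⁻¹ z)ᵀ | 1)` and `(Y (z̃ᵀ)⁻¹ | 0)`. -/
def fiberMatrix (Z : Matrix (Fin (k + m)) (Fin (k + m + l)) ℝ)
    (Y : Matrix (Fin k) (Fin (k + m)) ℝ) :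
    Matrix (Fin l ⊕ Fin k) (Fin (k + m + l)) ℝ :=
  (Matrix.fromBlocks (-((leadingBlock Z)⁻¹ * trailingBlock Z)ᵀ) 1
    (Y * ((leadingBlock Z)ᵀ)⁻¹) 0).submatrix id finSumFinEquiv.symm

/-- The subspace `Y` meets no span of `m` columns of `Z`. -/
def IsGenericPoint (Z : Matrix (Fin (k + m)) (Fin (k + m + l)) ℝ)
    (Y : Matrix (Fin k) (Fin (k + m)) ℝ) : Prop :=
  ∀ J : Finset (Fin (k + m + l)), J.card = m →
    Disjoint (rowSpan Y) (Submodule.span ℝ (Z.col '' (J : Set (Fin (k + m + l)))))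

end

/-! ### Simple poles along an arrangement of affine hyperplanes -/

/-- The functions `L i` define pairwise distinct affine hyperplanes of `ℝˡ`, and the top-degree
form `η` is `f dx₁ ∧ ⋯ ∧ dx_l`, with `f` regular off these hyperplanes, and with a pole of order
exactly one at every point that lies on exactly one of them. -/
structure HasSimplePolesOn {l N : ℕ} (η : (Fin l → ℝ) → Forms (Fin l → ℝ))
    (L : Fin N → (Fin l → ℝ) → ℝ) : Prop where
  hyperplane : ∀ i, ∃ (a : Fin l → ℝ) (b : ℝ), a ≠ 0 ∧ ∀ x, L i x = a ⬝ᵥ x + b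
  distinct : ∀ i j, i ≠ j → {x | L i x = 0} ≠ {x | L j x = 0}
  poles : ∃ f : (Fin l → ℝ) → ℝ,
    (∀ x, (∀ i, L i x ≠ 0) → η x = f x • coordVolume l ∧ AnalyticAt ℝ f x) ∧
    ∀ i x, L i x = 0 → (∀ j, j ≠ i → L j x ≠ 0) →
      ∃ g : (Fin l → ℝ) → ℝ, AnalyticAt ℝ g x ∧ g x ≠ 0 ∧
        ∀ᶠ y in 𝓝 x, L i y ≠ 0 → f y = g y / L i y

/-! ### Coordinates on the fibers for `k = 1` (cyclic polytopes) -/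

section
variable {m l : ℕ}

/-- `λ = (λ₁, …, λ_l, 1)`. -/
def lam (x : Fin l → ℝ) : Fin l ⊕ Fin 1 → ℝ := Sum.elim x 1

/-- The one-row matrix `λ · A`. -/
def polytopeChart (A : Matrix (Fin l ⊕ Fin 1) (Fin (1 + m + l)) ℝ) (x : Fin l → ℝ) :
    Matrix (Fin 1) (Fin (1 + m + l)) ℝ :=
  (Matrix.of fun _ => lam x) * A

/-- `A` gives affine coordinates `λ₁, …, λ_l` on the fiber over `Y`, in which the fiber volume form
is `c dλ₁ ∧ ⋯ ∧ dλ_l / ∏ᵢ (λ · Aⁱ)` and has simple poles on the hyperplanes `λ · Aⁱ = 0`. -/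
structure PolytopeFiberFormula (Z : Matrix (Fin (1 + m)) (Fin (1 + m + l)) ℝ)
    (Y : Matrix (Fin 1) (Fin (1 + m)) ℝ)
    (A : Matrix (Fin l ⊕ Fin 1) (Fin (1 + m + l)) ℝ) (c : ℝ) : Prop where
  frame : IsFiberFrame Z Y A
  coordinates : Set.BijOn (fun x => rowSpan (polytopeChart A x)) Set.univ
    (fiber 1 m Z (rowSpan Y))
  formula : ∀ ω, IsFiberFactor Z ω → ∀ x : Fin l → ℝ, (∀ i, lam x ⬝ᵥ A.col i ≠ 0) →
    pullback (polytopeChart A) ω x = (c / ∏ i, lam x ⬝ᵥ A.col i) • coordVolume l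
  simplePoles : 2 ≤ l ∨ (l = 1 ∧ IsGenericPoint Z Y) → ∀ ω, IsFiberFactor Z ω →
    HasSimplePolesOn (pullback (polytopeChart A) ω) fun i x => lam x ⬝ᵥ A.col i

end

/-! ### Coordinates on the fibers for `k = l = n - m - 1` (conjugates of cyclic polytopes) -/

section
variable {m l : ℕ}

/-- `λ̄ = (1, λ̄₂, …, λ̄_{l+1})`, a point of the dual projective space. -/
def lamBar (y : Fin l → ℝ) : Fin 1 ⊕ Fin l → ℝ := Sum.elim 1 y

/-- The matrix `λ = (-λ̄' | 1)`, where `λ̄ = (1, λ̄')`. -/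
def dualLam (y : Fin l → ℝ) : Matrix (Fin l) (Fin 1 ⊕ Fin l) ℝ :=
  Matrix.fromCols (Matrix.of fun a _ => -y a) 1

/-- The row span of `λ` is the orthogonal complement of `λ̄`. -/
theorem dualLam_mulVec_lamBar (y : Fin l → ℝ) : dualLam y *ᵥ lamBar y = 0 := by
  ext a
  simp [dualLam, lamBar, Matrix.mulVec, dotProduct, Matrix.one_apply]

/-- The matrix `λ · A`. -/
def conjugateChart (A : Matrix (Fin 1 ⊕ Fin l) (Fin (l + m + 1)) ℝ) (y : Fin l → ℝ) :
    Matrix (Fin l) (Fin (l + m + 1)) ℝ :=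
  dualLam y * A

/-- The vector `(A^I)^⊥` normal to the columns of `A` in the `l`-set `I`, normalised by
`v · (A^I)^⊥ = det (v | A^I)` for all vectors `v`. -/
def normalVector (A : Matrix (Fin 1 ⊕ Fin l) (Fin (l + m + 1)) ℝ)
    (I : Finset (Fin (l + m + 1))) : Fin 1 ⊕ Fin l → ℝ :=
  fun r => if h : I.card = l then
    (Matrix.fromCols (Matrix.of fun s (_ : Fin 1) => if s = r then (1 : ℝ) else 0)
      (A.submatrix id (I.orderEmbOfFin h))).det else 0

/-- `A` gives affine coordinates `λ̄` on the fiber over `Y`, in which the fiber volume form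
is `c dλ̄₁ ∧ ⋯ ∧ dλ̄_l / ∏ᵢ (λ̄ · (A^{Iᵢ})^⊥)` and has simple poles on the hyperplanes
`λ̄ · (A^{Iᵢ})^⊥ = 0`. -/
structure ConjugateFiberFormula (Z : Matrix (Fin (l + m)) (Fin (l + m + 1)) ℝ)
    (Y : Matrix (Fin l) (Fin (l + m)) ℝ)
    (A : Matrix (Fin 1 ⊕ Fin l) (Fin (l + m + 1)) ℝ) (c : ℝ) : Prop where
  frame : IsFiberFrame Z Y A
  normal : ∀ i, normalVector A (cyclicInterval l i) ≠ 0 ∧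
    ∀ j ∈ cyclicInterval l i, normalVector A (cyclicInterval l i) ⬝ᵥ A.col j = 0
  coordinates : Set.BijOn (fun y => rowSpan (conjugateChart A y)) Set.univ
    (fiber l m Z (rowSpan Y))
  formula : ∀ ω, IsFiberFactor Z ω → ∀ y : Fin l → ℝ,
    (∀ i, lamBar y ⬝ᵥ normalVector A (cyclicInterval l i) ≠ 0) →
    pullback (conjugateChart A) ω y =
      (c / ∏ i, lamBar y ⬝ᵥ normalVector A (cyclicInterval l i)) • coordVolume l
  simplePoles : (2 ≤ l ∧ Even m) ∨ IsGenericPoint Z Y → ∀ ω, IsFiberFactor Z ω →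
    HasSimplePolesOn (pullback (conjugateChart A) ω)
      fun i y => lamBar y ⬝ᵥ normalVector A (cyclicInterval l i)

end

end Amplituhedron

end

/-! Everything rests on one reading of the standard volume form. The sum over minors in row `α` of
`μ_{Gr(k,n)}` is the volume form of `ℝⁿ` contracted with all rows of `C`, pulled back along `X ↦
X_α` (`normalForm_eq_sum`, `rowForm_eq_map`). Up to the factor `(-1)^{l(k+m)} det z̃`, the volume
form of `ℝⁿ` is the wedge of the last `l` coordinates with the pullback of the volume form of
`ℝ^{k+m}` along `Z`, and this stays true when multiples of the coordinates of `Zv` are subtracted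
from those `l` coordinates (`coordVolume_factor`). The corrections can be chosen so that the
corrected coordinates vanish on the rows of `C`. Contraction with the rows then passes to the second
factor, which becomes the corresponding row of `π^*μ` (`normalForm_factor`). Multiplying over the
rows gives an explicit rational factor `fiberForm`.

The restriction to a fiber does not depend on the chosen factor: `π^*μ` is nonzero and is killed by
contraction with tangent vectors of the fiber, so contracting `(ω - ω') ∧ π^*μ = 0` with `kl` such
vectors leaves a number times `π^*μ` (`map_fiberFactor_eq`). Along the fiber the corrections vanish,
and what remains is a constant times the wedge of the last `l` entries of all rows, over the product
of the cyclic minors (`map_fiberForm`). In the chart of a frame these entries are affine in the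
coordinates, and the cyclic minors are `λ · Aⁱ` for `k = 1` and `det(λ̄ | A^{I_i})` in the conjugate
case. Rescaling kernel rows of the frame normalises the constant.

Simplicity of the poles amounts to distinctness of the hyperplanes. For `k = 1`, `l ≥ 2`, some
kernel vector vanishes at `i` but not at `j`; for `l = 1`, a coincidence would put `Y` in a span of
`m` columns. In the conjugate case a coincidence yields a vector `u` over a nonzero point of `Y`
that vanishes on `I_i ∪ I_j`. Genericity excludes this since the union has more than `l` elements.
For even `m`, a vector in the row span of a totally positive matrix would agree on the union with a
nonzero multiple of the generator of `ker Z`, whose signs alternate; the union contains `l + 1`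
positions of alternating parity, while a vector in that row span cannot alternate in sign along `l +
1` columns (`not_alternating_of_totallyPositive`). -/

open Matrix Topology
open scoped BigOperators

noncomputable section

namespace Amplituhedron

/-! ### Exterior algebra: involution, contraction and products of one-forms -/

section ExteriorAlgebra

variable {E F : Type*} [AddCommGroup E] [Module ℝ E] [AddCommGroup F] [Module ℝ F]

/-- The grade involution of the algebra of forms. -/
def parity : Forms E →ₐ[ℝ] Forms E :=
  CliffordAlgebra.involute (Q := (0 : QuadraticForm ℝ (Module.Dual ℝ E)))

theorem parity_ι (a : Module.Dual ℝ E) :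
    parity (ExteriorAlgebra.ι ℝ a) = -ExteriorAlgebra.ι ℝ a :=
  CliffordAlgebra.involute_ι a

theorem forms_induction {P : Forms E → Prop} (algebraMap : ∀ r, P (algebraMap ℝ _ r))
    (add : ∀ x y, P x → P y → P (x + y))
    (ι_mul : ∀ x a, P x → P (ExteriorAlgebra.ι ℝ a * x)) (x : Forms E) : P x :=
  CliffordAlgebra.left_induction (Q := (0 : QuadraticForm ℝ (Module.Dual ℝ E)))
    algebraMap add ι_mul x

theorem ι_mul_swap (a b : Module.Dual ℝ E) :
    ExteriorAlgebra.ι ℝ a * ExteriorAlgebra.ι ℝ b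
      = -(ExteriorAlgebra.ι ℝ b * ExteriorAlgebra.ι ℝ a) :=
  eq_neg_of_add_eq_zero_left (ExteriorAlgebra.ι_add_mul_swap a b)

theorem ι_mul_comm_parity (a : Module.Dual ℝ E) (x : Forms E) :
    ExteriorAlgebra.ι ℝ a * x = parity x * ExteriorAlgebra.ι ℝ a := by
  induction x using forms_induction with
  | algebraMap r => rw [AlgHom.commutes]; exact (Algebra.commutes r _).symm
  | add x y hx hy => rw [mul_add, hx, hy, map_add, add_mul]
  | ι_mul x b hx =>
    rw [map_mul, parity_ι, ← mul_assoc, ι_mul_swap, neg_mul, mul_assoc, hx, neg_mul, neg_mul,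
      mul_assoc]

theorem contract_ι_mul (v : E) (a : Module.Dual ℝ E) (x : Forms E) :
    contract v (ExteriorAlgebra.ι ℝ a * x) = a v • x - ExteriorAlgebra.ι ℝ a * contract v x :=
  CliffordAlgebra.contractLeft_ι_mul _ a x

theorem contract_algebraMap (v : E) (r : ℝ) : contract v (algebraMap ℝ (Forms E) r) = 0 :=
  CliffordAlgebra.contractLeft_algebraMap _ _ r

theorem contract_one (v : E) : contract v (1 : Forms E) = 0 :=
  CliffordAlgebra.contractLeft_one _ _

theorem contract_mul (v : E) (x y : Forms E) :
    contract v (x * y) = contract v x * y + parity x * contract v y := by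
  induction x using forms_induction with
  | algebraMap r =>
    rw [contract_algebraMap, AlgHom.commutes, zero_mul, zero_add, ← Algebra.smul_def,
      ← Algebra.smul_def, map_smul]
  | add x x' hx hx' => rw [add_mul, map_add, hx, hx', map_add, map_add, add_mul, add_mul]; abel
  | ι_mul x a hx =>
    rw [mul_assoc, contract_ι_mul, hx, contract_ι_mul, map_mul, parity_ι]
    simp only [sub_mul, smul_mul_assoc, mul_add, mul_assoc, neg_mul]
    abel

theorem contract_contract (v : E) (x : Forms E) : contract v (contract v x) = 0 :=
  CliffordAlgebra.contractLeft_contractLeft _ x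

theorem contract_map (f : E →ₗ[ℝ] F) (v : E) (x : Forms F) :
    contract v (ExteriorAlgebra.map f.dualMap x)
      = ExteriorAlgebra.map f.dualMap (contract (f v) x) := by
  induction x using forms_induction with
  | algebraMap r => rw [AlgHom.commutes, contract_algebraMap, contract_algebraMap, map_zero]
  | add x y hx hy => simp only [map_add, hx, hy]
  | ι_mul x a hx =>
    rw [map_mul, ExteriorAlgebra.map_apply_ι, contract_ι_mul, contract_ι_mul, hx, map_sub,
      map_smul, map_mul, ExteriorAlgebra.map_apply_ι]
    rfl

/-- The linear dependence of the contraction on the vector. -/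
def contractLin : E →ₗ[ℝ] Module.End ℝ (Forms E) :=
  (CliffordAlgebra.contractLeft (Q := (0 : QuadraticForm ℝ (Module.Dual ℝ E)))) ∘ₗ
    Module.Dual.eval ℝ E

/-- The product of a list of one-forms. -/
def wedge (L : List (Module.Dual ℝ E)) : Forms E := (L.map (ExteriorAlgebra.ι ℝ)).prod

@[simp] theorem wedge_nil : wedge ([] : List (Module.Dual ℝ E)) = 1 := rfl

@[simp] theorem wedge_cons (a : Module.Dual ℝ E) (L : List (Module.Dual ℝ E)) :
    wedge (a :: L) = ExteriorAlgebra.ι ℝ a * wedge L := by simp [wedge]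

theorem wedge_append (L L' : List (Module.Dual ℝ E)) :
    wedge (L ++ L') = wedge L * wedge L' := by simp [wedge]

theorem wedge_ofFn {p : ℕ} (a : Fin p → Module.Dual ℝ E) :
    wedge (List.ofFn a) = ExteriorAlgebra.ιMulti ℝ p a := by
  rw [ExteriorAlgebra.ιMulti_apply, wedge, List.map_ofFn]; rfl

theorem map_wedge (f : Module.Dual ℝ E →ₗ[ℝ] Module.Dual ℝ F) (L : List (Module.Dual ℝ E)) :
    ExteriorAlgebra.map f (wedge L) = wedge (L.map f) := by
  induction L with
  | nil => simp
  | cons a L ih => simp [ih]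

theorem parity_wedge (L : List (Module.Dual ℝ E)) :
    parity (wedge L) = (-1 : ℝ) ^ L.length • wedge L := by
  induction L with
  | nil => simp
  | cons a L ih => simp [ih, parity_ι, pow_succ]

theorem wedge_mul_comm (L : List (Module.Dual ℝ E)) {x : Forms E} {q : ℕ}
    (hx : parity x = (-1 : ℝ) ^ q • x) :
    wedge L * x = (-1 : ℝ) ^ (L.length * q) • (x * wedge L) := by
  induction L with
  | nil => simp
  | cons a L ih =>
    rw [wedge_cons, mul_assoc, ih, mul_smul_comm, ← mul_assoc, ι_mul_comm_parity, hx,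
      smul_mul_assoc, smul_mul_assoc, smul_smul, mul_assoc, ← pow_add, List.length_cons]
    congr 2; ring

theorem mul_wedge_comm (L : List (Module.Dual ℝ E)) {x : Forms E} {q : ℕ}
    (hx : parity x = (-1 : ℝ) ^ q • x) :
    x * wedge L = (-1 : ℝ) ^ (L.length * q) • (wedge L * x) := by
  rw [wedge_mul_comm L hx, smul_smul, ← pow_add, ← two_mul]
  simp

theorem contract_wedge_eq_zero {v : E} {L : List (Module.Dual ℝ E)} (h : ∀ a ∈ L, a v = 0) :
    contract v (wedge L) = 0 := by
  induction L with
  | nil => exact contract_one v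
  | cons a L ih =>
    rw [wedge_cons, contract_ι_mul, h a (by simp), ih fun b hb => h b (by simp [hb])]
    simp

/-- Successive contraction with a list of vectors, the first of them first. -/
def contractList : List E → Module.End ℝ (Forms E)
  | [] => LinearMap.id
  | v :: L => contractList L ∘ₗ contract v

@[simp] theorem contractList_nil (x : Forms E) : contractList [] x = x := rfl

@[simp] theorem contractList_cons (v : E) (L : List E) (x : Forms E) :
    contractList (v :: L) x = contractList L (contract v x) := rfl

theorem contractList_concat (v : E) (L : List E) (x : Forms E) :
    contractList (L ++ [v]) x = contract v (contractList L x) := by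
  induction L generalizing x with
  | nil => rfl
  | cons w L ih => simp [ih]

/-- Successive contraction as an algebra homomorphism. -/
def contractHom : ExteriorAlgebra ℝ E →ₐ[ℝ] (Module.End ℝ (Forms E))ᵐᵒᵖ :=
  -- The opposite algebra is the target because the first vector of a product has to act first.
  ExteriorAlgebra.lift ℝ ⟨(MulOpposite.opLinearEquiv ℝ).toLinearMap ∘ₗ contractLin, fun v =>
    MulOpposite.unop_injective (LinearMap.ext fun x => contract_contract v x)⟩

theorem contractHom_ι (v : E) :
    contractHom (ExteriorAlgebra.ι ℝ v) = MulOpposite.op (contract v) := by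
  rw [contractHom, ExteriorAlgebra.lift_ι_apply]
  rfl

theorem contractHom_prod (L : List E) :
    (contractHom (L.map (ExteriorAlgebra.ι ℝ)).prod).unop = contractList L := by
  induction L with
  | nil => simp; rfl
  | cons v L ih =>
    rw [List.map_cons, List.prod_cons, map_mul, MulOpposite.unop_mul, ih, contractHom_ι]
    rfl

/-- Successive contraction as an alternating map. -/
def contractAlt (k : ℕ) (x : Forms E) : E [⋀^Fin k]→ₗ[ℝ] Forms E :=
  (LinearMap.applyₗ x ∘ₗ (MulOpposite.opLinearEquiv ℝ).symm.toLinearMap ∘ₗ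
    contractHom.toLinearMap).compAlternatingMap (ExteriorAlgebra.ιMulti ℝ k)

theorem contractAlt_apply {k : ℕ} (x : Forms E) (v : Fin k → E) :
    contractAlt k x v = contractList (List.ofFn v) x := by
  rw [← contractHom_prod, List.map_ofFn]
  simp only [contractAlt, LinearMap.compAlternatingMap_apply, ExteriorAlgebra.ιMulti_apply]
  rfl

theorem contractList_map (f : E →ₗ[ℝ] F) (L : List E) (x : Forms F) :
    contractList L (ExteriorAlgebra.map f.dualMap x)
      = ExteriorAlgebra.map f.dualMap (contractList (L.map f) x) := by
  induction L generalizing x with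
  | nil => rfl
  | cons v L ih => simp [contract_map, ih]

theorem contractList_wedge_mul {L : List E} {K : List (Module.Dual ℝ E)}
    (h : ∀ v ∈ L, ∀ a ∈ K, a v = 0) (x : Forms E) :
    contractList L (wedge K * x)
      = (-1 : ℝ) ^ (K.length * L.length) • (wedge K * contractList L x) := by
  induction L generalizing x with
  | nil => simp
  | cons v L ih =>
    rw [contractList_cons, contract_mul, contract_wedge_eq_zero (h v (by simp)), zero_mul,
      zero_add, parity_wedge, smul_mul_assoc, map_smul, ih fun w hw => h w (by simp [hw]),
      smul_smul, ← pow_add, contractList_cons, List.length_cons]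
    congr 2; ring

theorem contractList_mul_of_right {L : List E} {y : Forms E} (h : ∀ v ∈ L, contract v y = 0)
    (x : Forms E) : contractList L (x * y) = contractList L x * y := by
  induction L generalizing x with
  | nil => rfl
  | cons v L ih =>
    rw [contractList_cons, contract_mul, h v (by simp), mul_zero, add_zero,
      ih fun w hw => h w (by simp [hw]), contractList_cons]

theorem ι_mul_contractList {a : Module.Dual ℝ E} {L : List E} (h : ∀ v ∈ L, a v = 0)
    {x : Forms E} (hx : ExteriorAlgebra.ι ℝ a * x = 0) :
    ExteriorAlgebra.ι ℝ a * contractList L x = 0 := by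
  induction L generalizing x with
  | nil => exact hx
  | cons v L ih =>
    refine ih (fun w hw => h w (by simp [hw])) ?_
    have := contract_ι_mul v a x
    rw [hx, map_zero, h v (by simp), zero_smul, zero_sub] at this
    exact neg_eq_zero.1 this.symm

/-- Contracting `a ∧ x = 0` with `v`, where `a(v) = 1`, gives `x = a ∧ (v ⌟ x)`. This undoes the
contraction of a volume form with independent vectors. -/
theorem wedge_mul_contractList {p : ℕ} (a : Fin p → Module.Dual ℝ E) (v : Fin p → E)
    (h : ∀ i j, a i (v j) = if i = j then 1 else 0) {x : Forms E}
    (hx : ∀ i, ExteriorAlgebra.ι ℝ (a i) * x = 0) :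
    wedge (List.ofFn a) * contractList (List.ofFn v) x = x := by
  induction p with
  | zero => simp
  | succ p ih =>
    rw [List.ofFn_succ', List.ofFn_succ', List.concat_eq_append, List.concat_eq_append,
      wedge_append, contractList_concat, wedge_cons, wedge_nil, mul_one, mul_assoc]
    have h1 : ExteriorAlgebra.ι ℝ (a (Fin.last p)) *
        contractList (List.ofFn fun i => v (Fin.castSucc i)) x = 0 := by
      refine ι_mul_contractList (fun w hw => ?_) (hx _)
      obtain ⟨i, rfl⟩ := List.mem_ofFn.1 hw
      rw [h, if_neg (Fin.castSucc_lt_last i).ne']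
    have h2 := contract_ι_mul (v (Fin.last p)) (a (Fin.last p))
      (contractList (List.ofFn fun i => v (Fin.castSucc i)) x)
    rw [h1, map_zero, h, if_pos rfl, one_smul] at h2
    rw [← sub_eq_zero.1 h2.symm]
    exact ih _ _ (fun i j => by simp [h]) fun i => hx _

theorem contractList_wedge_append {p : ℕ} (a : Fin p → Module.Dual ℝ E) (v : Fin p → E)
    (h : ∀ i j, a i (v j) = if i = j then 1 else 0) {K : List (Module.Dual ℝ E)}
    (hK : ∀ j, ∀ b ∈ K, b (v j) = 0) :
    contractList (List.ofFn v) (wedge (List.ofFn a ++ K)) = wedge K := by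
  induction p with
  | zero => simp
  | succ p ih =>
    rw [List.ofFn_succ, List.ofFn_succ, List.cons_append, wedge_cons, contractList_cons,
      contract_ι_mul, h, if_pos rfl, one_smul, contract_wedge_eq_zero, mul_zero, sub_zero]
    · exact ih _ _ (fun i j => by simp [h]) fun j => hK _
    · intro b hb
      rcases List.mem_append.1 hb with hb | hb
      · obtain ⟨i, rfl⟩ := List.mem_ofFn.1 hb
        rw [h, if_neg (Fin.succ_ne_zero i)]
      · exact hK _ b hb

theorem contractList_wedge_dual {p : ℕ} (a : Fin p → Module.Dual ℝ E) (v : Fin p → E)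
    (h : ∀ i j, a i (v j) = if i = j then 1 else 0) :
    contractList (List.ofFn v) (wedge (List.ofFn a)) = 1 := by
  simpa using contractList_wedge_append a v h (K := []) (by simp)

theorem wedge_ne_zero_of_dual {p : ℕ} (a : Fin p → Module.Dual ℝ E) (v : Fin p → E)
    (h : ∀ i j, a i (v j) = if i = j then 1 else 0) : wedge (List.ofFn a) ≠ 0 := fun h0 => by
  have := contractList_wedge_dual a v h
  rw [h0, map_zero] at this
  exact zero_ne_one this

/-- Both sides are alternating in the rows of `B`, so it is enough to let the rows be distinct basis
vectors; these form a permutation of the standard basis, and its sign comes out on both sides. -/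
theorem alternating_matrix_smul {M N : Type*} [AddCommGroup M] [Module ℝ M] [AddCommGroup N]
    [Module ℝ N] {p : ℕ} (f : M [⋀^Fin p]→ₗ[ℝ] N) (B : Matrix (Fin p) (Fin p) ℝ)
    (v : Fin p → M) : f (fun i => ∑ j, B i j • v j) = B.det • f v := by
  let g : (Fin p → ℝ) [⋀^Fin p]→ₗ[ℝ] N :=
    f.compLinearMap (Fintype.linearCombination ℝ v)
  let g' : (Fin p → ℝ) [⋀^Fin p]→ₗ[ℝ] N :=
    (LinearMap.toSpanSingleton ℝ N (f v)).compAlternatingMap Matrix.detRowAlternating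
  have hg : g = g' := by
    refine Module.Basis.ext_alternating (Pi.basisFun ℝ (Fin p)) fun w hw => ?_
    let σ : Equiv.Perm (Fin p) := Equiv.ofBijective w (Finite.injective_iff_bijective.1 hw)
    have h1 : (fun i => (Pi.basisFun ℝ (Fin p)) (w i)) =
        (fun i => (Pi.basisFun ℝ (Fin p)) i) ∘ σ := rfl
    rw [h1, AlternatingMap.map_perm, AlternatingMap.map_perm]
    congr 1
    have h2 : g (fun i => (Pi.basisFun ℝ (Fin p)) i) = f v := by
      simp only [g, AlternatingMap.compLinearMap_apply]
      congr 1
      ext i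
      simp [Fintype.linearCombination_apply, Pi.single_apply]
    have h3 : g' (fun i => (Pi.basisFun ℝ (Fin p)) i) = f v := by
      have : (fun i => (Pi.basisFun ℝ (Fin p)) i) = (1 : Matrix (Fin p) (Fin p) ℝ) := by
        ext i j; simp [Matrix.one_apply, Pi.single_apply, eq_comm]
      simp only [g', LinearMap.compAlternatingMap_apply, LinearMap.toSpanSingleton_apply]
      rw [this]
      exact (congrArg (· • f v) (Matrix.det_one (n := Fin p) (R := ℝ))).trans (one_smul ℝ _)
    rw [h2, h3]
  have := congrArg (fun h => h B) hg
  exact this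

theorem wedge_matrix_smul {p : ℕ} (B : Matrix (Fin p) (Fin p) ℝ) (a : Fin p → Module.Dual ℝ E) :
    wedge (List.ofFn fun i => ∑ j, B i j • a j) = B.det • wedge (List.ofFn a) := by
  rw [wedge_ofFn, wedge_ofFn, alternating_matrix_smul]

theorem wedge_mem (L : List (Module.Dual ℝ E)) :
    wedge L ∈ ⋀[ℝ]^L.length (Module.Dual ℝ E) := by
  have h : wedge L = ExteriorAlgebra.ιMulti ℝ L.length L.get := by
    rw [← wedge_ofFn, List.ofFn_get]
  rw [h]
  exact ExteriorAlgebra.ιMulti_range ℝ _ ⟨_, rfl⟩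

end ExteriorAlgebra

/-! ### The rows of the standard volume form as contractions of a volume form -/

section RowForm

/-- Induction by adjoining an `x` below all of `S`. If `x ∈ I`, it already stands in front and
creates no inversion. Otherwise it has to pass every element of `S ∩ I`, and each of these is a new
inversion. For `S = univ` the exponent is that of `shuffleSign`. -/
theorem wedge_sort_shuffle {E : Type*} [AddCommGroup E] [Module ℝ E] {n : ℕ}
    (a : Fin n → Module.Dual ℝ E) (I S : Finset (Fin n)) :
    wedge (S.sort.map a) =
      (-1 : ℝ) ^ (((S ∩ I) ×ˢ (S \ I)).filter fun p => p.2 < p.1).card •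
        wedge ((S ∩ I).sort.map a ++ (S \ I).sort.map a) := by
  induction S using Finset.induction_on_min with
  | empty => simp
  | insert x S hx ih =>
    have hxS : x ∉ S := fun h => lt_irrefl _ (hx x h)
    rw [Finset.sort_insert _ (fun b hb => (hx b hb).le) hxS, List.map_cons, wedge_cons, ih]
    by_cases hxI : x ∈ I
    · rw [Finset.insert_inter_of_mem hxI, Finset.insert_sdiff_of_mem _ hxI,
        Finset.sort_insert _ (fun b hb => (hx b (Finset.mem_inter.1 hb).1).le)
          (fun h => hxS (Finset.mem_inter.1 h).1), List.map_cons, List.cons_append, wedge_cons,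
        mul_smul_comm]
      congr 3
      ext ⟨p, q⟩
      simp only [Finset.mem_filter, Finset.mem_product, Finset.mem_insert]
      constructor
      · rintro ⟨⟨h1, h2⟩, h3⟩
        exact ⟨⟨Or.inr h1, h2⟩, h3⟩
      · rintro ⟨⟨h1 | h1, h2⟩, h3⟩
        · subst h1
          exact absurd h3 (not_lt.2 (hx q (Finset.mem_sdiff.1 h2).1).le)
        · exact ⟨⟨h1, h2⟩, h3⟩
    · rw [Finset.insert_inter_of_notMem hxI, Finset.insert_sdiff_of_notMem _ hxI,
        Finset.sort_insert _ (fun b hb => (hx b (Finset.mem_sdiff.1 hb).1).le)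
          (fun h => hxS (Finset.mem_sdiff.1 h).1), List.map_cons, wedge_append, wedge_append,
        wedge_cons, mul_smul_comm, ← mul_assoc, ← mul_assoc,
        mul_wedge_comm (x := ExteriorAlgebra.ι ℝ (a x)) (q := 1) _ (by rw [parity_ι]; simp), smul_mul_assoc, smul_smul, mul_one,
        ← pow_add, List.length_map, Finset.length_sort]
      congr 2
      rw [Finset.insert_eq, Finset.product_union, Finset.filter_union,
        Finset.card_union_of_disjoint, add_comm]
      · congr 1
        rw [Finset.filter_true_of_mem, Finset.card_product, Finset.card_singleton, mul_one]
        intro p hp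
        obtain ⟨hp1, hp2⟩ := Finset.mem_product.1 hp
        rw [Finset.mem_singleton.1 hp2]
        exact hx _ (Finset.mem_inter.1 hp1).1
      · rw [Finset.disjoint_left]
        rintro p hp hp'
        have h1 := (Finset.mem_product.1 (Finset.mem_filter.1 hp).1).2
        have h2 := (Finset.mem_product.1 (Finset.mem_filter.1 hp').1).2
        rw [Finset.mem_singleton.1 h1] at h2
        exact hxS (Finset.mem_sdiff.1 h2).1

/-- The coordinate functions on `ℝⁿ`. -/
def coord {n : ℕ} (i : Fin n) : Module.Dual ℝ (Fin n → ℝ) := LinearMap.proj i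

@[simp] theorem coord_apply {n : ℕ} (i : Fin n) (v : Fin n → ℝ) : coord i v = v i := rfl

theorem coordVolume_eq_wedge (n : ℕ) : coordVolume n = wedge (List.ofFn (coord (n := n))) :=
  (wedge_ofFn _).symm

theorem coordVolume_eq_shuffle {n : ℕ} (I : Finset (Fin n)) :
    coordVolume n = shuffleSign I • wedge (I.sort.map coord ++ Iᶜ.sort.map coord) := by
  have h := wedge_sort_shuffle (coord (n := n)) I Finset.univ
  rw [Finset.univ_inter, ← Finset.compl_eq_univ_sdiff, Fin.sort_univ,
    ← List.ofFn_eq_map] at h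
  rw [coordVolume_eq_wedge, h, shuffleSign]

/-- The Plücker coordinate as an alternating map of the rows. -/
def pluckerAlt {k n : ℕ} (I : Finset (Fin n)) : (Fin n → ℝ) [⋀^Fin k]→ₗ[ℝ] ℝ :=
  if h : I.card = k then
    Matrix.detRowAlternating.compLinearMap (LinearMap.funLeft ℝ ℝ (I.orderEmbOfFin h))
  else 0

theorem pluckerAlt_apply {k n : ℕ} (I : Finset (Fin n)) (C : Matrix (Fin k) (Fin n) ℝ) :
    pluckerAlt I (fun α => C α) = plucker C I := by
  unfold pluckerAlt plucker
  split_ifs <;> rfl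

theorem plucker_of_card {k n : ℕ} (C : Matrix (Fin k) (Fin n) ℝ) {I : Finset (Fin n)}
    (h : I.card = k) : plucker C I = (C.submatrix id (I.orderEmbOfFin h)).det := dif_pos h

theorem plucker_single {k n : ℕ} {w : Fin k → Fin n} (hw : StrictMono w) (I : Finset (Fin n)) :
    plucker (Matrix.of fun α => Pi.single (w α) (1 : ℝ)) I
      = if I = Finset.univ.image w then 1 else 0 := by
  have hcard : (Finset.univ.image w).card = k := by
    rw [Finset.card_image_of_injective _ hw.injective, Finset.card_univ, Fintype.card_fin]
  split_ifs with h
  · subst h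
    rw [plucker_of_card _ hcard, ← Finset.orderEmbOfFin_unique hcard (by simp) hw]
    convert Matrix.det_one (n := Fin k) (R := ℝ)
    ext α β
    simp [Matrix.one_apply, Pi.single_apply, hw.injective.eq_iff, eq_comm]
  · by_cases hI : I.card = k
    · rw [plucker_of_card _ hI]
      obtain ⟨i, hi, hi'⟩ : ∃ i ∈ I, i ∉ Finset.univ.image w := by
        by_contra hcon
        push Not at hcon
        exact h (Finset.eq_of_subset_of_card_le hcon (by rw [hI, hcard]))
      obtain ⟨β, rfl⟩ : ∃ β, I.orderEmbOfFin hI β = i := by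
        have : i ∈ Set.range (I.orderEmbOfFin hI) := by rwa [Finset.range_orderEmbOfFin]
        exact this
      refine Matrix.det_eq_zero_of_column_eq_zero β fun α => ?_
      simp only [submatrix_apply, id, Matrix.of_apply]
      refine Pi.single_eq_of_ne (fun h0 => hi' ?_) _
      rw [h0]
      exact Finset.mem_image_of_mem _ (Finset.mem_univ _)
    · exact dif_neg hI

/-- The contraction of the volume form of `ℝⁿ` with the rows of `C`. -/
def normalForm {k n : ℕ} (C : Matrix (Fin k) (Fin n) ℝ) : Forms (Fin n → ℝ) :=
  contractList (List.ofFn fun α => C α) (coordVolume n)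

/-- Both sides are alternating in the rows of `C`. On basis vectors with increasing indices only one
minor survives, and the contraction strips the corresponding factors off the shuffled volume form.
-/
theorem normalForm_eq_sum {k n : ℕ} (C : Matrix (Fin k) (Fin n) ℝ) :
    normalForm C = ∑ I ∈ Finset.powersetCard k (Finset.univ : Finset (Fin n)),
      (shuffleSign I * plucker C I) • wedge (Iᶜ.sort.map coord) := by
  let g : (Fin n → ℝ) [⋀^Fin k]→ₗ[ℝ] Forms (Fin n → ℝ) := contractAlt k (coordVolume n)
  let g' : (Fin n → ℝ) [⋀^Fin k]→ₗ[ℝ] Forms (Fin n → ℝ) :=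
    ∑ I ∈ Finset.powersetCard k (Finset.univ : Finset (Fin n)),
      (LinearMap.toSpanSingleton ℝ _
        (shuffleSign I • wedge (Iᶜ.sort.map coord))).compAlternatingMap (pluckerAlt I)
  have hg' : ∀ C : Matrix (Fin k) (Fin n) ℝ, g' (fun α => C α) =
      ∑ I ∈ Finset.powersetCard k (Finset.univ : Finset (Fin n)),
        (shuffleSign I * plucker C I) • wedge (Iᶜ.sort.map coord) := fun C => by
    refine (map_sum (⟨⟨fun f => f fun α => C α, rfl⟩, fun _ _ => rfl⟩ :
      ((Fin n → ℝ) [⋀^Fin k]→ₗ[ℝ] Forms (Fin n → ℝ)) →+ _) _ _).trans ?_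
    refine Finset.sum_congr rfl fun I _ => ?_
    simp only [AddMonoidHom.coe_mk, ZeroHom.coe_mk, LinearMap.compAlternatingMap_apply,
      LinearMap.toSpanSingleton_apply, pluckerAlt_apply, smul_smul, mul_comm]
  suffices h : g = g' by
    rw [← hg', ← h]
    exact (contractAlt_apply _ _).symm
  have key : ∀ w : Fin k → Fin n, StrictMono w →
      g (fun i => Pi.basisFun ℝ (Fin n) (w i)) = g' (fun i => Pi.basisFun ℝ (Fin n) (w i)) := by
    intro w hw
    have hcard : (Finset.univ.image w).card = k := by
      rw [Finset.card_image_of_injective _ hw.injective, Finset.card_univ, Fintype.card_fin]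
    have hb : (fun i => Pi.basisFun ℝ (Fin n) (w i)) =
        fun α => (Matrix.of fun α => Pi.single (w α) (1 : ℝ)) α := by
      ext α i; simp
    have hsort : (Finset.univ.image w).sort.map coord = List.ofFn fun i => coord (w i) := by
      rw [← Finset.listMap_orderEmbOfFin_finRange _ hcard,
        ← Finset.orderEmbOfFin_unique hcard (by simp) hw, List.map_map, List.ofFn_eq_map]
      rfl
    rw [hb, hg', Finset.sum_eq_single (Finset.univ.image w)]
    · rw [plucker_single hw, if_pos rfl, mul_one]
      simp only [g]
      rw [contractAlt_apply, coordVolume_eq_shuffle (Finset.univ.image w), map_smul, hsort,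
        contractList_wedge_append]
      · intro i j
        simp [Pi.single_apply, hw.injective.eq_iff]
      · intro j b hbm
        obtain ⟨i, hi, rfl⟩ := List.mem_map.1 hbm
        rw [Finset.mem_sort, Finset.mem_compl] at hi
        refine Pi.single_eq_of_ne (fun h0 => hi ?_) _
        rw [h0]
        exact Finset.mem_image_of_mem _ (Finset.mem_univ _)
    · intro I _ hI
      rw [plucker_single hw, if_neg hI, mul_zero, zero_smul]
    · intro h
      exact absurd (Finset.mem_powersetCard.2 ⟨Finset.subset_univ _, hcard⟩) h
  -- Sorting an injective index sequence changes both sides by the same sign, which reduces to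
  -- increasing `w`.
  refine Module.Basis.ext_alternating (Pi.basisFun ℝ (Fin n)) fun w hw => ?_
  have hmono : StrictMono (w ∘ Tuple.sort w) :=
    (Tuple.monotone_sort w).strictMono_of_injective (hw.comp (Tuple.sort w).injective)
  have h1 := key _ hmono
  have h2 : (fun i => Pi.basisFun ℝ (Fin n) ((w ∘ Tuple.sort w) i)) =
      (fun i => Pi.basisFun ℝ (Fin n) (w i)) ∘ Tuple.sort w := rfl
  rw [h2, AlternatingMap.map_perm, AlternatingMap.map_perm] at h1
  exact smul_left_cancel _ h1

/-- The linear map which takes a matrix to its row with index `α`. -/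
def rowMap {k n : ℕ} (α : Fin k) : Matrix (Fin k) (Fin n) ℝ →ₗ[ℝ] (Fin n → ℝ) where
  toFun X := X α
  map_add' _ _ := rfl
  map_smul' _ _ := rfl

@[simp] theorem rowMap_apply {k n : ℕ} (α : Fin k) (X : Matrix (Fin k) (Fin n) ℝ) :
    rowMap α X = X α := rfl

theorem rowForm_eq_map {k n : ℕ} (C : Matrix (Fin k) (Fin n) ℝ) (α : Fin k) :
    rowForm C α = ExteriorAlgebra.map (rowMap α).dualMap (normalForm C) := by
  rw [normalForm_eq_sum, map_sum, rowForm]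
  refine Finset.sum_congr rfl fun I _ => ?_
  rw [map_smul, map_wedge, wedge, List.map_map, List.map_map]
  rfl

theorem parity_normalForm {k q : ℕ} (C : Matrix (Fin k) (Fin (k + q)) ℝ) :
    parity (normalForm C) = (-1 : ℝ) ^ q • normalForm C := by
  rw [normalForm_eq_sum, map_sum, Finset.smul_sum]
  refine Finset.sum_congr rfl fun I hI => ?_
  rw [map_smul, parity_wedge, smul_comm, List.length_map, Finset.length_sort,
    Finset.card_compl, Fintype.card_fin, (Finset.mem_powersetCard.1 hI).2, Nat.add_sub_cancel_left]

end RowForm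

/-! ### Factorisation of the standard volume form along `C ↦ C Zᵀ` -/

section Factorization

theorem pullback_affine {E F : Type*} [AddCommGroup E] [Module ℝ E] [TopologicalSpace E]
    [IsTopologicalAddGroup E] [ContinuousSMul ℝ E] [T2Space E] [FiniteDimensional ℝ E]
    [AddCommGroup F] [Module ℝ F] [TopologicalSpace F] [IsTopologicalAddGroup F]
    [ContinuousSMul ℝ F] [T2Space F] (D : E →ₗ[ℝ] F) (c : F) (η : F → Forms F) (x : E) :
    pullback (fun y => D y + c) η x = ExteriorAlgebra.map D.dualMap (η (D x + c)) := by
  have h : HasFDerivAt (fun y => D y + c) (LinearMap.toContinuousLinearMap D) x := by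
    have h0 := (LinearMap.toContinuousLinearMap D).hasFDerivAt (x := x)
    -- Only topologies are given on the two spaces, so the derivative is unfolded to its little-o
    -- form, in which the constant cancels.
    rw [HasFDerivAt, hasFDerivAtFilter_iff_isLittleOTVS] at h0 ⊢
    simp only [add_sub_add_right_eq_sub]
    exact h0
  rw [pullback, h.fderiv]
  rfl

theorem pullback_linear {E F : Type*} [AddCommGroup E] [Module ℝ E] [TopologicalSpace E]
    [IsTopologicalAddGroup E] [ContinuousSMul ℝ E] [T2Space E] [FiniteDimensional ℝ E]
    [AddCommGroup F] [Module ℝ F] [TopologicalSpace F] [IsTopologicalAddGroup F]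
    [ContinuousSMul ℝ F] [T2Space F] (D : E →ₗ[ℝ] F) (η : F → Forms F) (x : E) :
    pullback (fun y => D y) η x = ExteriorAlgebra.map D.dualMap (η (D x)) := by
  simpa using pullback_affine D 0 η x

variable {E : Type*} [AddCommGroup E] [Module ℝ E]

theorem prod_ofFn_wedge {k : ℕ} (L : Fin k → List (Module.Dual ℝ E)) :
    (List.ofFn fun α => wedge (L α)).prod = wedge (List.ofFn L).flatten := by
  induction k with
  | zero => simp
  | succ k ih => rw [List.ofFn_succ, List.ofFn_succ, List.prod_cons, ih, List.flatten_cons,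
      wedge_append]

theorem prod_ofFn_wedge_ofFn {k p : ℕ} (a : Fin k → Fin p → Module.Dual ℝ E) :
    (List.ofFn fun α => wedge (List.ofFn (a α))).prod = wedge (List.ofFn fun s : Fin (k * p) =>
        a (finProdFinEquiv.symm s).1 (finProdFinEquiv.symm s).2) := by
  rw [List.ofFn_mul, prod_ofFn_wedge]
  congr 3
  funext α
  congr 1
  funext i
  have : finProdFinEquiv.symm (⟨α * p + i, by
      calc (α : ℕ) * p + i < (α + 1) * p := by
            rw [Nat.add_mul, Nat.one_mul]; exact Nat.add_lt_add_left i.2 _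
        _ ≤ _ := Nat.mul_le_mul_right _ α.2⟩ : Fin (k * p)) = (α, i) := by
    rw [Equiv.symm_apply_eq]
    ext
    simp [finProdFinEquiv, add_comm, mul_comm]
  simp only [this]

theorem length_flatten_ofFn {A : Type*} {k p : ℕ} {L : Fin k → List A}
    (h : ∀ α, (L α).length = p) : (List.ofFn L).flatten.length = k * p := by
  induction k with
  | zero => simp
  | succ k ih =>
    rw [List.ofFn_succ, List.flatten_cons, List.length_append, h, ih fun α => h _]
    ring

/-- The factor `B` of a row has to pass `p` one-forms for each later row, at a cost of `pq` signs
apiece; there are `k.choose 2` pairs of rows. -/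
theorem prod_ofFn_mul {k p q : ℕ} {L : Fin k → List (Module.Dual ℝ E)} {B : Fin k → Forms E}
    (hL : ∀ α, (L α).length = p) (hB : ∀ α, parity (B α) = (-1 : ℝ) ^ q • B α) :
    (List.ofFn fun α => wedge (L α) * B α).prod =
      (-1 : ℝ) ^ (k.choose 2 * (p * q)) •
        ((List.ofFn fun α => wedge (L α)).prod * (List.ofFn B).prod) := by
  induction k with
  | zero => simp
  | succ k ih =>
    simp only [List.ofFn_succ, List.prod_cons]
    rw [ih (fun α => hL _) (fun α => hB _), prod_ofFn_wedge, mul_smul_comm, mul_assoc,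
      ← mul_assoc (B 0), mul_wedge_comm _ (hB 0), length_flatten_ofFn (fun α => hL _)]
    simp only [smul_mul_assoc, mul_smul_comm, smul_smul, mul_assoc, ← pow_add]
    congr 2
    rw [Nat.choose_succ_succ' k 1, Nat.choose_one_right]
    ring

theorem prod_ofFn_smul {k : ℕ} (c : ℝ) (A : Fin k → Forms E) :
    (List.ofFn fun α => c • A α).prod = c ^ k • (List.ofFn A).prod := by
  induction k with
  | zero => simp
  | succ k ih =>
    simp only [List.ofFn_succ, List.prod_cons]
    rw [ih, smul_mul_smul_comm, pow_succ']

theorem ι_mul_wedge_of_mem {a : Module.Dual ℝ E} {L : List (Module.Dual ℝ E)} (h : a ∈ L) :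
    ExteriorAlgebra.ι ℝ a * wedge L = 0 := by
  induction L with
  | nil => simp at h
  | cons b L ih =>
    rw [wedge_cons, ← mul_assoc]
    rcases List.mem_cons.1 h with rfl | h
    · rw [ExteriorAlgebra.ι_sq_zero, zero_mul]
    · rw [ι_mul_swap, neg_mul, mul_assoc, ih h, mul_zero, neg_zero]

theorem ι_mul_coordVolume {n : ℕ} (b : Fin n → ℝ) :
    ExteriorAlgebra.ι ℝ (∑ i, b i • coord i) * coordVolume n = 0 := by
  rw [map_sum, Finset.sum_mul]
  refine Finset.sum_eq_zero fun i _ => ?_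
  rw [map_smul, smul_mul_assoc, coordVolume_eq_wedge,
    ι_mul_wedge_of_mem (List.mem_ofFn.2 ⟨i, rfl⟩), smul_zero]

/-- A right inverse of a matrix with independent rows. -/
def rightInv {k q : ℕ} (G : Matrix (Fin k) (Fin q) ℝ) : Matrix (Fin q) (Fin k) ℝ :=
  Gᵀ * (G * Gᵀ)⁻¹

theorem det_gram_ne_zero {k q : ℕ} {G : Matrix (Fin k) (Fin q) ℝ}
    (hG : LinearIndependent ℝ G.row) : (G * Gᵀ).det ≠ 0 := by
  intro h
  obtain ⟨v, hv, h0⟩ := Matrix.exists_vecMul_eq_zero_iff.2 h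
  apply hv
  apply Matrix.vecMul_injective_iff.2 hG
  have h1 : (v ᵥ* G) ⬝ᵥ (v ᵥ* G) = 0 := by
    have h2 : (v ᵥ* (G * Gᵀ)) ⬝ᵥ v = 0 := by rw [h0, zero_dotProduct]
    rwa [← Matrix.vecMul_vecMul, ← Matrix.dotProduct_mulVec, Matrix.mulVec_transpose] at h2
  simp only [dotProduct_self_eq_zero.1 h1, Matrix.zero_vecMul]

theorem mul_rightInv {k q : ℕ} {G : Matrix (Fin k) (Fin q) ℝ}
    (hG : LinearIndependent ℝ G.row) : G * rightInv G = 1 := by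
  rw [rightInv, ← Matrix.mul_assoc, Matrix.mul_nonsing_inv _ (det_gram_ne_zero hG).isUnit]

variable {k m l : ℕ}

theorem map_coordVolume {q : ℕ} (T : E →ₗ[ℝ] (Fin q → ℝ)) :
    ExteriorAlgebra.map T.dualMap (coordVolume q)
      = wedge (List.ofFn fun a => coord a ∘ₗ T) := by
  rw [coordVolume_eq_wedge, map_wedge, List.map_ofFn]
  rfl

/-- The `N`-terms are combinations of the coordinates of `Zv`, whose wedge is the second factor, so
they do not count. The sign comes from moving `l` one-forms past `q`. -/
theorem coordVolume_factor {q l : ℕ} (Z : Matrix (Fin q) (Fin (q + l)) ℝ)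
    (N : Matrix (Fin q) (Fin l) ℝ) :
    wedge (List.ofFn fun j => coord (Fin.natAdd q j) -
      ∑ a, N a j • (coord a ∘ₗ Z.mulVecLin)) *
        ExteriorAlgebra.map Z.mulVecLin.dualMap (coordVolume q)
      = ((-1 : ℝ) ^ (l * q) * (Z.submatrix id (Fin.castAdd l)).det) • coordVolume (q + l) := by
  rw [map_coordVolume, wedge_mul_comm _ (parity_wedge _), ← wedge_append, ← List.ofFn_fin_append,
    mul_smul, List.length_ofFn, List.length_ofFn]
  congr 1
  let B : Matrix (Fin (q + l)) (Fin (q + l)) ℝ :=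
    (Matrix.fromBlocks (Z.submatrix id (Fin.castAdd l)) (Z.submatrix id (Fin.natAdd q))
      (-(Nᵀ * Z.submatrix id (Fin.castAdd l)))
      (1 - Nᵀ * Z.submatrix id (Fin.natAdd q))).submatrix finSumFinEquiv.symm finSumFinEquiv.symm
  have hB : B.det = (Z.submatrix id (Fin.castAdd l)).det := by
    -- The correction is a unipotent row operation on the matrix with rows `Z` and `(0 | 1)`.
    have h : Matrix.fromBlocks (Z.submatrix id (Fin.castAdd l)) (Z.submatrix id (Fin.natAdd q))
        (-(Nᵀ * Z.submatrix id (Fin.castAdd l))) (1 - Nᵀ * Z.submatrix id (Fin.natAdd q)) =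
        Matrix.fromBlocks 1 0 (-Nᵀ) 1 * Matrix.fromBlocks (Z.submatrix id (Fin.castAdd l))
          (Z.submatrix id (Fin.natAdd q)) 0 1 := by
      rw [Matrix.fromBlocks_multiply]
      congr 1 <;> simp [sub_eq_neg_add]
    rw [Matrix.det_submatrix_equiv_self, h, Matrix.det_mul, Matrix.det_fromBlocks_zero₁₂,
      Matrix.det_fromBlocks_zero₂₁]
    simp
  rw [coordVolume_eq_wedge, ← hB, ← wedge_matrix_smul]
  congr 2
  funext i
  apply LinearMap.ext
  intro v
  have hsum : ∀ f : Fin (q + l) → ℝ, ∑ j, f j =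
      ∑ j, f (Fin.castAdd l j) + ∑ j, f (Fin.natAdd q j) := Fin.sum_univ_add
  refine Fin.addCases (fun a => ?_) (fun j => ?_) i
  · simp [B, Matrix.mulVec, dotProduct, hsum]
  · simp only [Fin.append_right, LinearMap.sub_apply, LinearMap.sum_apply, LinearMap.smul_apply,
      LinearMap.comp_apply, coord_apply, Matrix.mulVecLin_apply, Matrix.mulVec, dotProduct,
      hsum, B, Matrix.submatrix_apply, finSumFinEquiv_symm_apply_natAdd,
      finSumFinEquiv_symm_apply_castAdd, Matrix.fromBlocks_apply₂₁, Matrix.fromBlocks_apply₂₂,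
      Matrix.neg_apply, Matrix.sub_apply, Matrix.mul_apply, Matrix.transpose_apply, id,
      smul_eq_mul, neg_mul, sub_mul, Finset.sum_sub_distrib, Finset.sum_neg_distrib, mul_add,
      Finset.sum_add_distrib, Finset.sum_mul, Finset.mul_sum]
    rw [Finset.sum_comm (f := fun a b => N a j * (Z a (Fin.castAdd l b) * v (Fin.castAdd l b))),
      Finset.sum_comm (f := fun a b => N a j * (Z a (Fin.natAdd q b) * v (Fin.natAdd q b)))]
    simp only [Matrix.one_apply, ite_mul, one_mul, zero_mul, Finset.sum_ite_eq, Finset.mem_univ,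
      if_true, mul_assoc]
    ring

/-- The coordinates `v ↦ v_{k+m+j}` on `ℝⁿ`, corrected so as to vanish on the rows of `C`. -/
def fiberCoord (Z : Matrix (Fin (k + m)) (Fin (k + m + l)) ℝ)
    (C : Matrix (Fin k) (Fin (k + m + l)) ℝ) (j : Fin l) :
    Module.Dual ℝ (Fin (k + m + l) → ℝ) :=
  coord (Fin.natAdd (k + m) j) -
    ∑ a, (rightInv (C * Zᵀ) * C) a (Fin.natAdd (k + m) j) • (coord a ∘ₗ Z.mulVecLin)

theorem mulVec_row {p q r : ℕ} (Z : Matrix (Fin q) (Fin r) ℝ) (C : Matrix (Fin p) (Fin r) ℝ)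
    (α : Fin p) : Z *ᵥ C α = (C * Zᵀ) α := by
  ext a
  simp [Matrix.mulVec, Matrix.mul_apply, dotProduct, mul_comm]

theorem fiberCoord_apply_row (Z : Matrix (Fin (k + m)) (Fin (k + m + l)) ℝ)
    (C : Matrix (Fin k) (Fin (k + m + l)) ℝ) {p : ℕ}
    (X : Matrix (Fin p) (Fin (k + m + l)) ℝ) (α : Fin p) (j : Fin l) :
    fiberCoord Z C j (X α) =
      (X - X * Zᵀ * (rightInv (C * Zᵀ) * C)) α (Fin.natAdd (k + m) j) := by
  rw [Matrix.sub_apply, Matrix.mul_apply]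
  simp [fiberCoord, mulVec_row, mul_comm]

/-- With `R` a right inverse of `CZᵀ`, one has `XC - X(CZᵀ)RC = 0`. This makes the fiber form
horizontal, and lets contractions with the rows of `C` pass through it. -/
theorem fiberCoord_row_eq_zero {Z : Matrix (Fin (k + m)) (Fin (k + m + l)) ℝ}
    {C : Matrix (Fin k) (Fin (k + m + l)) ℝ} (hC : LinearIndependent ℝ (C * Zᵀ).row)
    (X : Matrix (Fin k) (Fin k) ℝ) (α : Fin k) (j : Fin l) :
    fiberCoord Z C j ((X * C) α) = 0 := by
  rw [fiberCoord_apply_row, Matrix.mul_assoc X, Matrix.mul_assoc X, ← Matrix.mul_assoc (C * Zᵀ),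
    mul_rightInv hC, Matrix.one_mul, sub_self]
  rfl

/-- The constant by which the standard volume forms of rows differ. -/
def rowConst (Z : Matrix (Fin (k + m)) (Fin (k + m + l)) ℝ) : ℝ :=
  (-1) ^ (l * m) / (leadingBlock Z).det

/-- `coordVolume_factor` is contracted with the `k` rows of `C`. They kill the `l` corrected
coordinates and so move past them with sign `(-1)^{lk}`; by naturality they act on the second factor
as the rows of `CZᵀ`. The exponents `l(k+m)` and `lk` add up to `lm` modulo 2. -/
theorem normalForm_factor {Z : Matrix (Fin (k + m)) (Fin (k + m + l)) ℝ}
    (hZ : (leadingBlock Z).det ≠ 0)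
    {C : Matrix (Fin k) (Fin (k + m + l)) ℝ} (hC : LinearIndependent ℝ (C * Zᵀ).row) :
    normalForm C = rowConst Z • (wedge (List.ofFn (fiberCoord Z C)) *
      ExteriorAlgebra.map Z.mulVecLin.dualMap (normalForm (C * Zᵀ))) := by
  have h := coordVolume_factor Z
    (Matrix.of fun a j => (rightInv (C * Zᵀ) * C) a (Fin.natAdd (k + m) j))
  have h2 := congrArg (contractList (List.ofFn fun α => C α)) h
  rw [contractList_wedge_mul, contractList_map, map_smul] at h2
  · have h3 : (List.ofFn fun α => C α).map Z.mulVecLin = List.ofFn fun α => (C * Zᵀ) α := by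
      rw [List.map_ofFn]
      congr 1
      funext α
      exact mulVec_row Z C α
    rw [h3, List.length_ofFn, List.length_ofFn] at h2
    have h4 : normalForm C = (((-1 : ℝ) ^ (l * (k + m)) * (leadingBlock Z).det)⁻¹ *
        (-1) ^ (l * k)) • (wedge (List.ofFn (fiberCoord Z C)) *
      ExteriorAlgebra.map Z.mulVecLin.dualMap (normalForm (C * Zᵀ))) := by
      rw [mul_smul, eq_inv_smul_iff₀]
      · exact h2.symm
      · exact mul_ne_zero (pow_ne_zero _ (by norm_num)) hZ
    rw [h4]
    congr 1
    rw [rowConst, mul_inv, ← inv_pow, inv_neg, inv_one, div_eq_mul_inv, mul_right_comm, ← pow_add]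
    congr 1
    rw [show l * (k + m) + l * k = 2 * (l * k) + l * m by ring, pow_add, pow_mul]
    simp
  · intro v hv a ha
    obtain ⟨α, rfl⟩ := List.mem_ofFn.1 hv
    obtain ⟨j, rfl⟩ := List.mem_ofFn.1 ha
    have := fiberCoord_row_eq_zero hC 1 α j
    rwa [Matrix.one_mul] at this

/-- The map `X ↦ X Zᵀ`. -/
def mulTranspose {p q r : ℕ} (Z : Matrix (Fin q) (Fin r) ℝ) :
    Matrix (Fin p) (Fin r) ℝ →ₗ[ℝ] Matrix (Fin p) (Fin q) ℝ where
  toFun X := X * Zᵀ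
  map_add' X X' := Matrix.add_mul X X' Zᵀ
  map_smul' r X := Matrix.smul_mul r X Zᵀ

theorem pullback_grassmannVolume (Z : Matrix (Fin (k + m)) (Fin (k + m + l)) ℝ)
    (C : Matrix (Fin k) (Fin (k + m + l)) ℝ) :
    pullback (fun C' => C' * Zᵀ) grassmannVolume C =
      (List.ofFn fun α : Fin k => ExteriorAlgebra.map (rowMap α).dualMap
        (ExteriorAlgebra.map Z.mulVecLin.dualMap (normalForm (C * Zᵀ)))).prod := by
  have h := pullback_linear (mulTranspose (p := k) Z) grassmannVolume C
  refine h.trans ?_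
  rw [grassmannVolume, map_list_prod, List.map_ofFn]
  congr 2
  funext α
  simp only [Function.comp_apply, rowForm_eq_map]
  rw [← AlgHom.comp_apply, ← AlgHom.comp_apply, ExteriorAlgebra.map_comp_map,
    ExteriorAlgebra.map_comp_map]
  congr 2
  apply LinearMap.ext
  intro f
  apply LinearMap.ext
  intro X
  exact congrArg f (mulVec_row Z X α).symm

/-- The one-forms whose product is the fiber form up to a factor. -/
def fiberOneForm (Z : Matrix (Fin (k + m)) (Fin (k + m + l)) ℝ)
    (C : Matrix (Fin k) (Fin (k + m + l)) ℝ) (α : Fin k) (j : Fin l) :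
    Module.Dual ℝ (Matrix (Fin k) (Fin (k + m + l)) ℝ) :=
  fiberCoord Z C j ∘ₗ rowMap α

/-- The constant factor of the fiber form. -/
def fiberConst (Z : Matrix (Fin (k + m)) (Fin (k + m + l)) ℝ) : ℝ :=
  rowConst Z ^ k * (-1) ^ (k.choose 2 * (l * m))

/-- A rational form which represents the fiber volume form. -/
def fiberForm (Z : Matrix (Fin (k + m)) (Fin (k + m + l)) ℝ)
    (C : Matrix (Fin k) (Fin (k + m + l)) ℝ) :
    Forms (Matrix (Fin k) (Fin (k + m + l)) ℝ) :=
  (fiberConst Z * (∏ j, plucker C (cyclicInterval k j))⁻¹) •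
    (List.ofFn fun α => wedge (List.ofFn (fiberOneForm Z C α))).prod

theorem parity_map {E F : Type*} [AddCommGroup E] [Module ℝ E] [AddCommGroup F] [Module ℝ F]
    (f : Module.Dual ℝ E →ₗ[ℝ] Module.Dual ℝ F) (x : Forms E) :
    parity (ExteriorAlgebra.map f x) = ExteriorAlgebra.map f (parity x) := by
  induction x using forms_induction with
  | algebraMap r => simp only [AlgHom.commutes]
  | add x y hx hy => simp only [map_add, hx, hy]
  | ι_mul x a hx => simp only [map_mul, hx, ExteriorAlgebra.map_apply_ι, parity_ι, map_neg]

theorem canonicalForm_factor {Z : Matrix (Fin (k + m)) (Fin (k + m + l)) ℝ}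
    (hZ : (leadingBlock Z).det ≠ 0)
    {C : Matrix (Fin k) (Fin (k + m + l)) ℝ} (hC : LinearIndependent ℝ (C * Zᵀ).row) :
    canonicalForm C = fiberForm Z C * pullback (fun C' => C' * Zᵀ) grassmannVolume C := by
  rw [pullback_grassmannVolume, canonicalForm, fiberForm, grassmannVolume, smul_mul_assoc,
    mul_comm (fiberConst Z), mul_smul, fiberConst, mul_smul]
  congr 1
  rw [← prod_ofFn_mul (fun α => List.length_ofFn), ← prod_ofFn_smul]
  · congr 2
    funext α
    rw [rowForm_eq_map, normalForm_factor hZ hC, map_smul, map_mul, map_wedge, List.map_ofFn]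
    rfl
  · intro α
    rw [parity_map, parity_map, parity_normalForm, map_smul, map_smul]

theorem prod_map_coordVolume_ne_zero (k n : ℕ) :
    (List.ofFn fun α : Fin k => ExteriorAlgebra.map (rowMap (n := n) α).dualMap
      (coordVolume n)).prod ≠ 0 := by
  have h : (List.ofFn fun α : Fin k => ExteriorAlgebra.map (rowMap (n := n) α).dualMap
      (coordVolume n)).prod = wedge (List.ofFn fun s : Fin (k * n) =>
        coord (finProdFinEquiv.symm s).2 ∘ₗ rowMap (finProdFinEquiv.symm s).1) := by
    rw [← prod_ofFn_wedge_ofFn fun (α : Fin k) (i : Fin n) => coord i ∘ₗ rowMap α]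
    simp only [map_coordVolume]
  rw [h]
  refine wedge_ne_zero_of_dual _ (fun s => Matrix.single (finProdFinEquiv.symm s).1
    (finProdFinEquiv.symm s).2 (1 : ℝ)) fun s t => ?_
  have h1 : s = t ↔ finProdFinEquiv.symm s = finProdFinEquiv.symm t :=
    finProdFinEquiv.symm.injective.eq_iff.symm
  simp only [h1, Prod.ext_iff, LinearMap.comp_apply, rowMap_apply, coord_apply]
  rw [Matrix.single_apply]
  simp only [eq_comm]

/-- In each row the factor of `π^*μ` can be completed by one-forms to a nonzero multiple of the
volume form of `ℝⁿ`. The product over the rows is then a nonzero top form on matrices, and up to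
sign it contains `π^*μ` as a factor. -/
theorem pullback_grassmannVolume_ne_zero {Z : Matrix (Fin (k + m)) (Fin (k + m + l)) ℝ}
    (hZ : (leadingBlock Z).det ≠ 0)
    {C : Matrix (Fin k) (Fin (k + m + l)) ℝ} (hC : LinearIndependent ℝ (C * Zᵀ).row) :
    pullback (fun C' => C' * Zᵀ) grassmannVolume C ≠ 0 := by
  intro h0
  rw [pullback_grassmannVolume] at h0
  -- One-forms dual to the rows of `CZᵀ`; wedging with them undoes the contraction in `normalForm (C
  -- * Zᵀ)`.
  let φ : Fin k → Module.Dual ℝ (Fin (k + m) → ℝ) := fun β =>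
    ∑ a, rightInv (C * Zᵀ) a β • coord a
  have hφ : wedge (List.ofFn φ) * normalForm (C * Zᵀ) = coordVolume (k + m) := by
    refine wedge_mul_contractList φ _ (fun i j => ?_) fun i => ι_mul_coordVolume _
    have h1 : φ i ((C * Zᵀ) j) = (C * Zᵀ * rightInv (C * Zᵀ)) j i := by
      rw [Matrix.mul_apply (M := C * Zᵀ)]
      simp [φ, mul_comm]
    rw [h1, mul_rightInv hC, Matrix.one_apply]
    simp only [eq_comm]
  let K : List (Module.Dual ℝ (Fin (k + m + l) → ℝ)) :=
    List.ofFn (fiberCoord Z C) ++ (List.ofFn φ).map Z.mulVecLin.dualMap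
  have hK : wedge K * ExteriorAlgebra.map Z.mulVecLin.dualMap (normalForm (C * Zᵀ)) =
      ((-1 : ℝ) ^ (l * (k + m)) * (leadingBlock Z).det) • coordVolume (k + m + l) := by
    rw [wedge_append, ← map_wedge, mul_assoc, ← map_mul, hφ]
    exact coordVolume_factor Z
      (Matrix.of fun a j => (rightInv (C * Zᵀ) * C) a (Fin.natAdd (k + m) j))
  have h1 := prod_ofFn_mul (k := k) (p := K.length) (q := m)
    (L := fun α => K.map (rowMap α).dualMap)
    (B := fun α => ExteriorAlgebra.map (rowMap α).dualMap
        (ExteriorAlgebra.map Z.mulVecLin.dualMap (normalForm (C * Zᵀ))))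
    (fun α => List.length_map _)
    (fun α => by rw [parity_map, parity_map, parity_normalForm, map_smul, map_smul])
  rw [h0, mul_zero, smul_zero] at h1
  have h2 : (List.ofFn fun α : Fin k => wedge (K.map (rowMap α).dualMap) *
      ExteriorAlgebra.map (rowMap α).dualMap
        (ExteriorAlgebra.map Z.mulVecLin.dualMap (normalForm (C * Zᵀ)))).prod =
      ((-1 : ℝ) ^ (l * (k + m)) * (leadingBlock Z).det) ^ k •
      (List.ofFn fun α : Fin k => ExteriorAlgebra.map (rowMap α).dualMap
        (coordVolume (k + m + l))).prod := by
    rw [← prod_ofFn_smul]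
    congr 2
    funext α
    rw [← map_wedge, ← map_mul, hK, map_smul]
  rw [h1] at h2
  refine smul_ne_zero (pow_ne_zero _ (mul_ne_zero (pow_ne_zero _ (by norm_num)) hZ))
    (prod_map_coordVolume_ne_zero k (k + m + l)) h2.symm

end Factorization

/-! ### The fiber form -/

section FiberForm

variable {k m l : ℕ}

theorem fiberForm_mem (Z : Matrix (Fin (k + m)) (Fin (k + m + l)) ℝ)
    (C : Matrix (Fin k) (Fin (k + m + l)) ℝ) :
    fiberForm Z C ∈ ⋀[ℝ]^(k * l) (Module.Dual ℝ (Matrix (Fin k) (Fin (k + m + l)) ℝ)) := by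
  refine Submodule.smul_mem _ _ ?_
  rw [prod_ofFn_wedge_ofFn]
  have := wedge_mem (List.ofFn fun s : Fin (k * l) =>
    fiberOneForm Z C (finProdFinEquiv.symm s).1 (finProdFinEquiv.symm s).2)
  rwa [List.length_ofFn] at this

theorem contract_fiberForm {Z : Matrix (Fin (k + m)) (Fin (k + m + l)) ℝ}
    {C : Matrix (Fin k) (Fin (k + m + l)) ℝ} (hC : LinearIndependent ℝ (C * Zᵀ).row)
    (X : Matrix (Fin k) (Fin k) ℝ) : contract (X * C) (fiberForm Z C) = 0 := by
  rw [fiberForm, map_smul, prod_ofFn_wedge_ofFn, contract_wedge_eq_zero, smul_zero]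
  intro a ha
  obtain ⟨s, rfl⟩ := List.mem_ofFn.1 ha
  exact fiberCoord_row_eq_zero hC X _ _

theorem plucker_mul {n : ℕ} (G : Matrix (Fin k) (Fin k) ℝ) (C : Matrix (Fin k) (Fin n) ℝ)
    (I : Finset (Fin n)) : plucker (G * C) I = G.det * plucker C I := by
  unfold plucker
  split_ifs with h
  · rw [← Matrix.det_mul]
    rfl
  · rw [mul_zero]

/-- This equivariance makes `fiberCoord` invariant under a change of basis of the row span of `C`.
-/
theorem rightInv_mul {q : ℕ} {G : Matrix (Fin k) (Fin k) ℝ} (hG : G.det ≠ 0)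
    (H : Matrix (Fin k) (Fin q) ℝ) : rightInv (G * H) * G = rightInv H := by
  have h1 : IsUnit G.det := hG.isUnit
  have h2 : IsUnit Gᵀ.det := by rwa [Matrix.det_transpose]
  rw [rightInv, rightInv, Matrix.transpose_mul,
    show G * H * (Hᵀ * Gᵀ) = G * (H * Hᵀ) * Gᵀ by simp only [Matrix.mul_assoc],
    Matrix.mul_inv_rev, Matrix.mul_inv_rev, Matrix.mul_assoc, Matrix.mul_assoc, Matrix.mul_assoc,
    Matrix.mul_assoc _ G⁻¹ G,
    Matrix.nonsing_inv_mul _ h1, Matrix.mul_one, ← Matrix.mul_assoc Gᵀ,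
    Matrix.mul_nonsing_inv _ h2, Matrix.one_mul]

theorem fiberCoord_mul (Z : Matrix (Fin (k + m)) (Fin (k + m + l)) ℝ)
    (C : Matrix (Fin k) (Fin (k + m + l)) ℝ) {G : Matrix (Fin k) (Fin k) ℝ} (hG : G.det ≠ 0) :
    fiberCoord Z (G * C) = fiberCoord Z C := by
  unfold fiberCoord
  rw [Matrix.mul_assoc G C, ← Matrix.mul_assoc _ G C, rightInv_mul hG]

theorem wedge_fiberOneForm_mul (Z : Matrix (Fin (k + m)) (Fin (k + m + l)) ℝ)
    (C : Matrix (Fin k) (Fin (k + m + l)) ℝ) (G : Matrix (Fin k) (Fin k) ℝ) :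
    ExteriorAlgebra.map (mulLeftLinearMap (Fin (k + m + l)) ℝ G).dualMap
      (List.ofFn fun α => wedge (List.ofFn (fiberOneForm Z C α))).prod =
    G.det ^ l • (List.ofFn fun α => wedge (List.ofFn (fiberOneForm Z C α))).prod := by
  rw [prod_ofFn_wedge_ofFn, map_wedge, List.map_ofFn]
  -- `G` mixes the rows and leaves the index `j` alone, so it acts on the `kl` one-forms as `G ⊗ 1`,
  -- of determinant `(det G)^l`.
  let B : Matrix (Fin (k * l)) (Fin (k * l)) ℝ :=
    (Matrix.kroneckerMap (· * ·) G (1 : Matrix (Fin l) (Fin l) ℝ)).submatrix finProdFinEquiv.symm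
      finProdFinEquiv.symm
  have hB : B.det = G.det ^ l := by
    rw [Matrix.det_submatrix_equiv_self, Matrix.det_kronecker]
    simp
  rw [← hB, ← wedge_matrix_smul]
  congr 2
  funext s
  rw [← finProdFinEquiv.sum_comp, Fintype.sum_prod_type]
  simp only [B, Matrix.submatrix_apply, Equiv.symm_apply_apply, Matrix.kroneckerMap_apply,
    Matrix.one_apply, mul_ite, mul_one, mul_zero, ite_smul, zero_smul, Finset.sum_ite_eq,
    Finset.mem_univ, if_true]
  apply LinearMap.ext
  intro X
  have h : (G * X) (finProdFinEquiv.symm s).1 = ∑ β, G (finProdFinEquiv.symm s).1 β • X β := by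
    ext i
    simp [Matrix.mul_apply]
  simp only [Function.comp_apply, LinearMap.dualMap_apply, fiberOneForm, LinearMap.comp_apply,
    rowMap_apply, mulLeftLinearMap_apply, h, map_sum, map_smul, LinearMap.sum_apply,
    LinearMap.smul_apply]

/-- The `k + m + l` minors in the denominator scale by `det G` each and the one-forms together by
`(det G)^l`, which leaves degree `-(k + m)`. -/
theorem fiberForm_covariant (Z : Matrix (Fin (k + m)) (Fin (k + m + l)) ℝ)
    (C : Matrix (Fin k) (Fin (k + m + l)) ℝ) {G : Matrix (Fin k) (Fin k) ℝ} (hG : G.det ≠ 0) :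
    pullback (fun C' => G * C') (fiberForm Z) C = (G.det ^ (k + m))⁻¹ • fiberForm Z C := by
  refine (pullback_linear (mulLeftLinearMap (Fin (k + m + l)) ℝ G) (fiberForm Z) C).trans ?_
  have h : fiberOneForm Z (G * C) = fiberOneForm Z C := by
    unfold fiberOneForm
    rw [fiberCoord_mul Z C hG]
  rw [mulLeftLinearMap_apply, fiberForm, map_smul, h, wedge_fiberOneForm_mul, fiberForm, smul_smul,
    smul_smul]
  congr 1
  simp only [plucker_mul, Finset.prod_mul_distrib, Finset.prod_const, Finset.card_univ,
    Fintype.card_fin]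
  rw [pow_add _ (k + m) l]
  field_simp

theorem isFiberFactor_fiberForm {Z : Matrix (Fin (k + m)) (Fin (k + m + l)) ℝ}
    (hZ : (leadingBlock Z).det ≠ 0) : IsFiberFactor Z (fiberForm Z) where
  degree C _ := fiberForm_mem Z C
  horizontal _ hC X := contract_fiberForm hC.2 X
  covariant C _ _ hG := fiberForm_covariant Z C hG
  factor _ hC := canonicalForm_factor hZ hC.2

/-! ### Rationality -/

section Rational

variable {n : ℕ}

/-- The differential forms on the space of matrices with polynomial coefficients. -/
def polyForms (k n : ℕ) :
    Subalgebra ℝ (Matrix (Fin k) (Fin n) ℝ → Forms (Matrix (Fin k) (Fin n) ℝ)) :=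
  Algebra.adjoin ℝ (Set.range fun s : MvPolynomial (Fin k × Fin n) ℝ ×
    Forms (Matrix (Fin k) (Fin n) ℝ) => fun C => MvPolynomial.eval (fun p => C p.1 p.2) s.1 • s.2)

/-- The generators already form a multiplicative monoid. Hence any product of polynomial forms is a
finite sum of polynomials times constant forms, the shape required by `IsRegularRational`. -/
theorem polyForms_eq_span : (Subalgebra.toSubmodule (polyForms k n)) =
    Submodule.span ℝ (Set.range fun s : MvPolynomial (Fin k × Fin n) ℝ ×
      Forms (Matrix (Fin k) (Fin n) ℝ) => fun C =>
        MvPolynomial.eval (fun p => C p.1 p.2) s.1 • s.2) := by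
  rw [polyForms, Algebra.adjoin_eq_span]
  congr 1
  apply Set.Subset.antisymm _ Submonoid.subset_closure
  let S : Submonoid (Matrix (Fin k) (Fin n) ℝ → Forms (Matrix (Fin k) (Fin n) ℝ)) :=
    { carrier := Set.range fun s : MvPolynomial (Fin k × Fin n) ℝ ×
        Forms (Matrix (Fin k) (Fin n) ℝ) => fun C =>
          MvPolynomial.eval (fun p => C p.1 p.2) s.1 • s.2
      one_mem' := ⟨(1, 1), by funext C; simp⟩
      mul_mem' := by
        rintro _ _ ⟨s, rfl⟩ ⟨t, rfl⟩
        refine ⟨(s.1 * t.1, s.2 * t.2), ?_⟩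
        funext C
        simp only [Pi.mul_apply, smul_mul_smul_comm, map_mul] }
  exact (Submonoid.closure_le (S := S)).2 subset_rfl

theorem polynomial_smul_mem (P : MvPolynomial (Fin k × Fin n) ℝ)
    (η : Forms (Matrix (Fin k) (Fin n) ℝ)) :
    (fun C : Matrix (Fin k) (Fin n) ℝ => MvPolynomial.eval (fun p => C p.1 p.2) P • η)
      ∈ polyForms k n := Algebra.subset_adjoin ⟨(P, η), rfl⟩

theorem isRegularRational_of_polyForms {Z : Matrix (Fin (k + m)) (Fin (k + m + l)) ℝ}
    {ω τ : Matrix (Fin k) (Fin (k + m + l)) ℝ → Forms (Matrix (Fin k) (Fin (k + m + l)) ℝ)}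
    (hτ : τ ∈ polyForms k (k + m + l)) (Q : MvPolynomial (Fin k × Fin (k + m + l)) ℝ)
    (h : ∀ C ∈ regularLocus Z, MvPolynomial.eval (fun p => C p.1 p.2) Q ≠ 0 ∧
      MvPolynomial.eval (fun p => C p.1 p.2) Q • ω C = τ C) : IsRegularRational Z ω := by
  rw [← Subalgebra.mem_toSubmodule, polyForms_eq_span, Submodule.mem_span_set'] at hτ
  obtain ⟨N, c, g, hg⟩ := hτ
  choose s hs using fun i => (g i).2
  refine ⟨N, fun i => MvPolynomial.C (c i) * (s i).1, Q, fun i => (s i).2, fun C hC => ?_⟩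
  obtain ⟨h1, h2⟩ := h C hC
  refine ⟨h1, ?_⟩
  rw [← eq_inv_smul_iff₀ h1] at h2
  rw [h2, ← hg, Finset.sum_apply, Finset.smul_sum]
  refine Finset.sum_congr rfl fun i _ => ?_
  rw [Pi.smul_apply, ← hs, map_mul, MvPolynomial.eval_C, smul_smul, smul_smul]
  congr 1
  field_simp

/-- The generic matrix. -/
def genericMatrix (k n : ℕ) : Matrix (Fin k) (Fin n) (MvPolynomial (Fin k × Fin n) ℝ) :=
  Matrix.of fun α i => MvPolynomial.X (α, i)

theorem genericMatrix_map (C : Matrix (Fin k) (Fin n) ℝ) :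
    (genericMatrix k n).map (MvPolynomial.eval fun p => C p.1 p.2) = C := by
  ext α i
  simp [genericMatrix]

theorem exists_plucker_polynomial (I : Finset (Fin n)) :
    ∃ P : MvPolynomial (Fin k × Fin n) ℝ, ∀ C : Matrix (Fin k) (Fin n) ℝ,
      MvPolynomial.eval (fun p => C p.1 p.2) P = plucker C I := by
  by_cases h : I.card = k
  · refine ⟨((genericMatrix k n).submatrix id (I.orderEmbOfFin h)).det, fun C => ?_⟩
    rw [plucker_of_card _ h, RingHom.map_det, RingHom.mapMatrix_apply, ← Matrix.submatrix_map,
      genericMatrix_map]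
  · exact ⟨0, fun C => by simp [plucker, h]⟩

theorem exists_mul_transpose_polynomial {q : ℕ} (Z : Matrix (Fin q) (Fin n) ℝ) :
    ∃ H : Matrix (Fin k) (Fin q) (MvPolynomial (Fin k × Fin n) ℝ),
      ∀ C : Matrix (Fin k) (Fin n) ℝ,
        H.map (MvPolynomial.eval fun p => C p.1 p.2) = C * Zᵀ := by
  refine ⟨genericMatrix k n *
    (Zᵀ.map MvPolynomial.C : Matrix (Fin n) (Fin q) (MvPolynomial (Fin k × Fin n) ℝ)), fun C => ?_⟩
  rw [Matrix.map_mul, genericMatrix_map, Matrix.map_map]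
  congr 1
  ext i j
  simp

theorem exists_gram_polynomial {q : ℕ} (Z : Matrix (Fin q) (Fin n) ℝ) :
    ∃ P : MvPolynomial (Fin k × Fin n) ℝ, ∀ C : Matrix (Fin k) (Fin n) ℝ,
      MvPolynomial.eval (fun p => C p.1 p.2) P = (C * Zᵀ * (C * Zᵀ)ᵀ).det := by
  obtain ⟨H, hH⟩ := exists_mul_transpose_polynomial (k := k) Z
  refine ⟨(H * Hᵀ).det, fun C => ?_⟩
  rw [RingHom.map_det, RingHom.mapMatrix_apply, Matrix.map_mul, Matrix.transpose_map, hH]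

/-- The adjugate replaces the inverse: this is `rightInv (C * Zᵀ) * C` with the Gram determinant
cleared. -/
theorem exists_rightInv_polynomial {q : ℕ} (Z : Matrix (Fin q) (Fin n) ℝ) (a : Fin q)
    (t : Fin n) :
    ∃ P : MvPolynomial (Fin k × Fin n) ℝ, ∀ C : Matrix (Fin k) (Fin n) ℝ,
      MvPolynomial.eval (fun p => C p.1 p.2) P =
        ((C * Zᵀ)ᵀ * (C * Zᵀ * (C * Zᵀ)ᵀ).adjugate * C) a t := by
  obtain ⟨H, hH⟩ := exists_mul_transpose_polynomial (k := k) Z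
  refine ⟨(Hᵀ * (H * Hᵀ).adjugate * genericMatrix k n) a t, fun C => ?_⟩
  have h : ((Hᵀ * (H * Hᵀ).adjugate * genericMatrix k n).map
      (MvPolynomial.eval fun p => C p.1 p.2)) =
      (C * Zᵀ)ᵀ * (C * Zᵀ * (C * Zᵀ)ᵀ).adjugate * C := by
    have h1 := RingHom.map_adjugate (MvPolynomial.eval fun p : Fin k × Fin n => C p.1 p.2) (H * Hᵀ)
    rw [RingHom.mapMatrix_apply, RingHom.mapMatrix_apply] at h1
    rw [Matrix.map_mul, Matrix.map_mul, h1, genericMatrix_map, Matrix.map_mul,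
      Matrix.transpose_map, hH]
  rw [← h]
  rfl

theorem isRegularRational_fiberForm (Z : Matrix (Fin (k + m)) (Fin (k + m + l)) ℝ) :
    IsRegularRational Z (fiberForm Z) := by
  choose p hp using fun j : Fin (k + m + l) =>
    exists_plucker_polynomial (k := k) (cyclicInterval k j)
  obtain ⟨D, hD⟩ := exists_gram_polynomial (k := k) Z
  choose R hR using exists_rightInv_polynomial (k := k) Z
  -- The Gram determinant times the one-form `fiberOneForm Z C α j`; unlike the latter it is
  -- polynomial in `C`.
  let σ : Fin k → Fin l → Matrix (Fin k) (Fin (k + m + l)) ℝ →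
      Forms (Matrix (Fin k) (Fin (k + m + l)) ℝ) := fun α j C =>
    MvPolynomial.eval (fun p => C p.1 p.2) D •
      ExteriorAlgebra.ι ℝ (coord (Fin.natAdd (k + m) j) ∘ₗ rowMap α) -
    ∑ a, MvPolynomial.eval (fun p => C p.1 p.2) (R a (Fin.natAdd (k + m) j)) •
      ExteriorAlgebra.ι ℝ (coord a ∘ₗ Z.mulVecLin ∘ₗ rowMap α)
  have hσ : ∀ α j, σ α j ∈ polyForms k (k + m + l) := fun α j => by
    have h2 : σ α j = (fun C => MvPolynomial.eval (fun p => C p.1 p.2) D •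
        ExteriorAlgebra.ι ℝ (coord (Fin.natAdd (k + m) j) ∘ₗ rowMap α)) -
      ∑ a, fun C => MvPolynomial.eval (fun p => C p.1 p.2) (R a (Fin.natAdd (k + m) j)) •
        ExteriorAlgebra.ι ℝ (coord a ∘ₗ Z.mulVecLin ∘ₗ rowMap α) := by
      funext C
      simp [σ]
    rw [h2]
    exact sub_mem (polynomial_smul_mem _ _) (sum_mem fun a _ => polynomial_smul_mem _ _)
  have hσ' : ∀ α j C, LinearIndependent ℝ (C * Zᵀ).row → σ α j C =
      MvPolynomial.eval (fun p => C p.1 p.2) D • ExteriorAlgebra.ι ℝ (fiberOneForm Z C α j) := by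
    intro α j C hC
    have h1 : fiberOneForm Z C α j = coord (Fin.natAdd (k + m) j) ∘ₗ rowMap α -
        ∑ a, (rightInv (C * Zᵀ) * C) a (Fin.natAdd (k + m) j) •
          (coord a ∘ₗ Z.mulVecLin ∘ₗ rowMap α) := by
      apply LinearMap.ext
      intro X
      simp [fiberOneForm, fiberCoord]
    simp only [σ, h1, map_sub, map_sum, map_smul, smul_sub, Finset.smul_sum, smul_smul, hR, hD]
    congr 1
    refine Finset.sum_congr rfl fun a _ => ?_
    congr 1
    rw [rightInv, Matrix.inv_def, Ring.inverse_eq_inv', Matrix.mul_smul, Matrix.smul_mul,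
      Matrix.smul_apply, smul_eq_mul, ← mul_assoc, mul_inv_cancel₀ (det_gram_ne_zero hC), one_mul]
  -- The common denominator: all cyclic minors, and one Gram determinant for each of the `kl`
  -- one-forms. Over `ℝ` the latter is nonzero wherever the rows of `CZᵀ` are independent.
  refine isRegularRational_of_polyForms (τ := fiberConst Z •
    (List.ofFn fun α => (List.ofFn (σ α)).prod).prod) ?_ ((∏ j, p j) * D ^ (l * k)) ?_
  · refine Subalgebra.smul_mem _ (list_prod_mem ?_) _
    intro x hx
    obtain ⟨α, rfl⟩ := List.mem_ofFn.1 hx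
    refine list_prod_mem ?_
    intro x hx
    obtain ⟨j, rfl⟩ := List.mem_ofFn.1 hx
    exact hσ α j
  · rintro C ⟨hC1, hC2⟩
    have h1 : MvPolynomial.eval (fun p => C p.1 p.2) (∏ j, p j) =
        ∏ j, plucker C (cyclicInterval k j) := by
      rw [map_prod]
      exact Finset.prod_congr rfl fun j _ => hp j C
    have h2 : MvPolynomial.eval (fun p => C p.1 p.2) D ≠ 0 := by
      rw [hD]
      exact det_gram_ne_zero hC2
    have h3 : ∏ j, plucker C (cyclicInterval k j) ≠ 0 :=
      Finset.prod_ne_zero_iff.2 fun j _ => hC1 j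
    rw [map_mul, h1, map_pow]
    refine ⟨mul_ne_zero h3 (pow_ne_zero _ h2), ?_⟩
    have h4 : (List.ofFn fun α => (List.ofFn (σ α)).prod).prod C =
        MvPolynomial.eval (fun p => C p.1 p.2) D ^ (l * k) •
          (List.ofFn fun α => wedge (List.ofFn (fiberOneForm Z C α))).prod := by
      have h5 : ∀ L : List (Matrix (Fin k) (Fin (k + m + l)) ℝ →
          Forms (Matrix (Fin k) (Fin (k + m + l)) ℝ)), L.prod C = (L.map fun f => f C).prod :=
        fun L => map_list_prod (Pi.evalMonoidHom _ C) L
      rw [h5, List.map_ofFn, pow_mul, ← prod_ofFn_smul]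
      congr 2
      funext α
      simp only [Function.comp_apply]
      rw [h5, List.map_ofFn, wedge, List.map_ofFn]
      have h6 := prod_ofFn_smul (MvPolynomial.eval (fun p => C p.1 p.2) D)
        fun j => ExteriorAlgebra.ι ℝ (fiberOneForm Z C α j)
      refine Eq.trans ?_ h6
      congr 2
      funext j
      exact hσ' α j C hC2
    rw [Pi.smul_apply, h4, fiberForm, smul_smul, smul_smul]
    congr 1
    field_simp

end Rational

/-! ### Uniqueness of the restriction to a fiber -/

section Uniqueness

variable {E : Type*} [AddCommGroup E] [Module ℝ E]

theorem contract_mem_exteriorPower (v : E) {p : ℕ} {x : Forms E}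
    (hx : x ∈ ⋀[ℝ]^(p + 1) (Module.Dual ℝ E)) : contract v x ∈ ⋀[ℝ]^p (Module.Dual ℝ E) := by
  induction p generalizing x with
  | zero =>
    rw [ExteriorAlgebra.exteriorPower, zero_add, pow_one] at hx
    obtain ⟨a, rfl⟩ := hx
    rw [ExteriorAlgebra.exteriorPower, pow_zero]
    have h := contract_ι_mul v a 1
    rw [mul_one, contract_one, mul_zero, sub_zero] at h
    rw [h, ← Algebra.algebraMap_eq_smul_one]
    exact Submodule.algebraMap_mem _
  | succ p ih =>
    rw [ExteriorAlgebra.exteriorPower, pow_succ'] at hx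
    induction hx using Submodule.mul_induction_on' with
    | mem_mul_mem a ha y hy =>
      obtain ⟨a, rfl⟩ := ha
      rw [contract_ι_mul]
      refine sub_mem (Submodule.smul_mem _ _ hy) ?_
      rw [ExteriorAlgebra.exteriorPower, pow_succ']
      exact Submodule.mul_mem_mul ⟨a, rfl⟩ (ih hy)
    | add x _ y _ hx hy => rw [map_add]; exact add_mem hx hy

theorem contractList_eq_algebraMap (L : List E) {x : Forms E}
    (hx : x ∈ ⋀[ℝ]^L.length (Module.Dual ℝ E)) :
    ∃ s : ℝ, contractList L x = algebraMap ℝ _ s := by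
  induction L generalizing x with
  | nil =>
    rw [List.length_nil, ExteriorAlgebra.exteriorPower, pow_zero] at hx
    obtain ⟨s, hs⟩ := Submodule.mem_one.1 hx
    exact ⟨s, hs.symm⟩
  | cons v L ih => exact ih (contract_mem_exteriorPower v hx)

theorem map_eq_smul_coordVolume {d : ℕ} (D : (Fin d → ℝ) →ₗ[ℝ] E) {x : Forms E}
    (hx : x ∈ ⋀[ℝ]^d (Module.Dual ℝ E)) :
    ∃ s : ℝ, ExteriorAlgebra.map D.dualMap x = s • coordVolume d := by
  rw [← ExteriorAlgebra.ιMulti_span_fixedDegree] at hx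
  induction hx using Submodule.span_induction with
  | mem x hx =>
    obtain ⟨a, rfl⟩ := hx
    refine ⟨(Matrix.of fun i j => a i (D (Pi.single j 1))).det, ?_⟩
    rw [← wedge_ofFn, map_wedge, List.map_ofFn, coordVolume_eq_wedge, ← wedge_matrix_smul]
    congr 2
    funext i
    refine LinearMap.pi_ext' fun j => LinearMap.ext_ring ?_
    simp [Pi.single_apply]
  | zero => exact ⟨0, by simp⟩
  | add x y _ _ hx hy =>
    obtain ⟨s, hs⟩ := hx
    obtain ⟨t, ht⟩ := hy
    exact ⟨s + t, by rw [map_add, hs, ht, add_smul]⟩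
  | smul r x _ hx =>
    obtain ⟨s, hs⟩ := hx
    exact ⟨r * s, by rw [map_smul, hs, smul_smul]⟩

/-- Contraction with the images of the `d` basis vectors sees only `x` and turns `x ∧ y = 0` into `s
y = 0`, where the number `s` is the coefficient of the pullback of `x`. -/
theorem map_eq_zero_of_mul_eq_zero {d : ℕ} (D : (Fin d → ℝ) →ₗ[ℝ] E) {x y : Forms E}
    (hx : x ∈ ⋀[ℝ]^d (Module.Dual ℝ E)) (hy : ∀ v, contract (D v) y = 0) (hy0 : y ≠ 0)
    (h : x * y = 0) : ExteriorAlgebra.map D.dualMap x = 0 := by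
  let L : List (Fin d → ℝ) := List.ofFn fun i => Pi.single i 1
  obtain ⟨s, hs⟩ := contractList_eq_algebraMap (L.map D) (x := x) (by simpa [L] using hx)
  obtain ⟨t, ht⟩ := map_eq_smul_coordVolume D hx
  have h1 : s = 0 := by
    have h2 := contractList_mul_of_right (L := L.map D) (y := y) (fun v hv => by
      obtain ⟨w, -, rfl⟩ := List.mem_map.1 hv
      exact hy w) x
    rw [h, map_zero, hs, ← Algebra.smul_def] at h2
    exact (smul_eq_zero.1 h2.symm).resolve_right hy0
  have h2 := contractList_map D L x
  rw [hs, h1, map_zero, map_zero, ht, map_smul, coordVolume_eq_wedge,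
    contractList_wedge_dual] at h2
  · rw [ht, (smul_eq_zero.1 h2).resolve_right one_ne_zero, zero_smul]
  · intro i j
    simp [Pi.single_apply]

end Uniqueness

/-- The difference of two factors of `Ω` has zero product with `π^*μ`, and directions with `XZᵀ = 0`
are killed by `π^*μ`. -/
theorem map_fiberFactor_eq {Z : Matrix (Fin (k + m)) (Fin (k + m + l)) ℝ}
    (hZ : (leadingBlock Z).det ≠ 0)
    {ω : Matrix (Fin k) (Fin (k + m + l)) ℝ → Forms (Matrix (Fin k) (Fin (k + m + l)) ℝ)}
    (hω : IsFiberFactor Z ω) {C : Matrix (Fin k) (Fin (k + m + l)) ℝ} (hC : C ∈ regularLocus Z)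
    {d : ℕ} (hd : d = k * l) (D : (Fin d → ℝ) →ₗ[ℝ] Matrix (Fin k) (Fin (k + m + l)) ℝ)
    (hD : ∀ v, D v * Zᵀ = 0) :
    ExteriorAlgebra.map D.dualMap (ω C) = ExteriorAlgebra.map D.dualMap (fiberForm Z C) := by
  subst hd
  rw [← sub_eq_zero, ← map_sub]
  have h1 := pullback_linear (mulTranspose (p := k) Z) grassmannVolume C
  refine map_eq_zero_of_mul_eq_zero D (sub_mem (hω.degree C hC) (fiberForm_mem Z C))
    (fun v => ?_) (pullback_grassmannVolume_ne_zero hZ hC.2) ?_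
  · refine (congrArg _ h1).trans ?_
    rw [contract_map]
    have h2 : mulTranspose Z (D v) = 0 := hD v
    rw [h2]
    simp [contract]
  · rw [sub_mul, ← hω.factor C hC, ← canonicalForm_factor hZ hC.2, sub_self]

/-- The corrections in `fiberCoord` factor through `X ↦ XZᵀ`, so they disappear in these directions.
-/
theorem map_fiberForm {Z : Matrix (Fin (k + m)) (Fin (k + m + l)) ℝ}
    (C : Matrix (Fin k) (Fin (k + m + l)) ℝ) {E : Type*} [AddCommGroup E] [Module ℝ E]
    (D : E →ₗ[ℝ] Matrix (Fin k) (Fin (k + m + l)) ℝ) (hD : ∀ v, D v * Zᵀ = 0) :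
    ExteriorAlgebra.map D.dualMap (fiberForm Z C) =
      (fiberConst Z * (∏ j, plucker C (cyclicInterval k j))⁻¹) •
        (List.ofFn fun α => wedge (List.ofFn fun j : Fin l =>
          coord (Fin.natAdd (k + m) j) ∘ₗ rowMap α ∘ₗ D)).prod := by
  rw [fiberForm, map_smul, map_list_prod, List.map_ofFn]
  congr 3
  funext α
  rw [Function.comp_apply, map_wedge, List.map_ofFn]
  congr 2
  funext j
  apply LinearMap.ext
  intro v
  have h := fiberCoord_apply_row Z C (D v) α j
  rw [hD, Matrix.zero_mul, sub_zero] at h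
  exact h

end FiberForm

/-! ### Minors of totally positive matrices -/

section Minors

variable {q n : ℕ}

theorem TotallyPositive.det_pos {Z : Matrix (Fin q) (Fin n) ℝ} (hZ : TotallyPositive Z)
    {w : Fin q → Fin n} (hw : StrictMono w) : 0 < (Z.submatrix id w).det := by
  have hcard : (Finset.univ.image w).card = q := by
    rw [Finset.card_image_of_injective _ hw.injective, Finset.card_univ, Fintype.card_fin]
  have h := hZ _ hcard
  rwa [plucker_of_card _ hcard, ← Finset.orderEmbOfFin_unique hcard (by simp) hw] at h

theorem TotallyPositive.det_leading_ne_zero {l : ℕ} {Z : Matrix (Fin q) (Fin (q + l)) ℝ}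
    (hZ : TotallyPositive Z) : (Z.submatrix id (Fin.castAdd l)).det ≠ 0 :=
  (hZ.det_pos (Fin.strictMono_castAdd l)).ne'

/-- Laplace expansion of the determinant of `B` with its row `a` repeated on top. -/
theorem sum_minors_mul (B : Matrix (Fin q) (Fin (q + 1)) ℝ) (a : Fin q) :
    ∑ r : Fin (q + 1), (-1) ^ (r : ℕ) * (B.submatrix id r.succAbove).det * B a r = 0 := by
  let M : Matrix (Fin (q + 1)) (Fin (q + 1)) ℝ := Matrix.of (Fin.cons (B a) B)
  have h : M.det = 0 := by
    refine Matrix.det_zero_of_row_eq (i := 0) (j := a.succ) (Fin.succ_ne_zero a).symm ?_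
    rfl
  rw [Matrix.det_succ_row_zero] at h
  rw [← h]
  refine Finset.sum_congr rfl fun r _ => ?_
  have h1 : M.submatrix Fin.succ r.succAbove = B.submatrix id r.succAbove := rfl
  have h2 : M 0 r = B a r := rfl
  rw [h1, h2]
  ring

/-- The vector of signed minors of `Z` on the columns listed by `w`. -/
def minorVector (Z : Matrix (Fin q) (Fin n) ℝ) (w : Fin (q + 1) → Fin n) : Fin n → ℝ :=
  ∑ r : Fin (q + 1), ((-1) ^ (r : ℕ) * (Z.submatrix id (w ∘ r.succAbove)).det) • Pi.single (w r) (1 : ℝ)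

theorem mulVec_minorVector (Z : Matrix (Fin q) (Fin n) ℝ) (w : Fin (q + 1) → Fin n) :
    Z *ᵥ minorVector Z w = 0 := by
  ext a
  rw [minorVector, Matrix.mulVec_sum, Finset.sum_apply]
  refine (Finset.sum_congr rfl fun r _ => ?_).trans (sum_minors_mul (Z.submatrix id w) a)
  rw [Matrix.mulVec_smul, Matrix.mulVec_single_one]
  simp [Matrix.col_apply, Function.comp_def]

theorem minorVector_apply (Z : Matrix (Fin q) (Fin n) ℝ) {w : Fin (q + 1) → Fin n}
    (hw : Function.Injective w) (r : Fin (q + 1)) :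
    minorVector Z w (w r) = (-1) ^ (r : ℕ) * (Z.submatrix id (w ∘ r.succAbove)).det := by
  rw [minorVector, Finset.sum_apply, Finset.sum_eq_single r]
  · simp
  · intro s _ hs
    simp [hw.ne hs.symm]
  · simp

theorem minorVector_of_notMem (Z : Matrix (Fin q) (Fin n) ℝ) {w : Fin (q + 1) → Fin n}
    {i : Fin n} (hi : i ∉ Set.range w) : minorVector Z w i = 0 := by
  rw [minorVector, Finset.sum_apply]
  refine Finset.sum_eq_zero fun r _ => ?_
  have : i ≠ w r := fun h => hi ⟨r, h.symm⟩
  simp [this]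

/-- The linear relation between `q + 1` columns has their maximal minors as coefficients, up to
sign, and none of these vanishes. -/
theorem TotallyPositive.exists_kernel_vector {Z : Matrix (Fin q) (Fin n) ℝ}
    (hZ : TotallyPositive Z) {S : Finset (Fin n)} (hS : S.card = q + 1) :
    ∃ u : Fin n → ℝ, Z *ᵥ u = 0 ∧ (∀ i ∉ S, u i = 0) ∧ ∀ i ∈ S, u i ≠ 0 := by
  have hw : StrictMono (S.orderEmbOfFin hS) := (S.orderEmbOfFin hS).strictMono
  refine ⟨minorVector Z (S.orderEmbOfFin hS), mulVec_minorVector _ _, fun i hi => ?_,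
    fun i hi => ?_⟩
  · exact minorVector_of_notMem _ (by rwa [Finset.range_orderEmbOfFin])
  · obtain ⟨r, rfl⟩ : i ∈ Set.range (S.orderEmbOfFin hS) := by
      rwa [Finset.range_orderEmbOfFin]
    rw [minorVector_apply _ hw.injective]
    exact mul_ne_zero (pow_ne_zero _ (by norm_num))
      (hZ.det_pos (hw.comp (Fin.strictMono_succAbove r))).ne'

end Minors

/-! ### Frames and affine coordinates on the fibers -/

section Frames

variable {k m l : ℕ}

theorem mem_rowSpan {p n : ℕ} {C : Matrix (Fin p) (Fin n) ℝ} {v : Fin n → ℝ} :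
    v ∈ rowSpan C ↔ ∃ c : Fin p → ℝ, c ᵥ* C = v := by
  rw [rowSpan, ← range_vecMulLinear]
  rfl

theorem mulVec_vecMul {p q n : ℕ} (Z : Matrix (Fin q) (Fin n) ℝ) (C : Matrix (Fin p) (Fin n) ℝ)
    (c : Fin p → ℝ) : Z *ᵥ (c ᵥ* C) = c ᵥ* (C * Zᵀ) := by
  rw [← Matrix.vecMul_vecMul, Matrix.vecMul_transpose]

theorem vecMul_eq_zero_iff {p n : ℕ} {Y : Matrix (Fin p) (Fin n) ℝ}
    (hY : LinearIndependent ℝ Y.row) {c : Fin p → ℝ} : c ᵥ* Y = 0 ↔ c = 0 := by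
  refine ⟨fun h => Matrix.vecMul_injective_iff.2 hY ?_, fun h => by rw [h, Matrix.zero_vecMul]⟩
  simpa using h

theorem linearIndependent_row_iff {p n : ℕ} {Y : Matrix (Fin p) (Fin n) ℝ} :
    LinearIndependent ℝ Y.row ↔ ∀ c : Fin p → ℝ, c ᵥ* Y = 0 → c = 0 := by
  refine ⟨fun h c => (vecMul_eq_zero_iff h).1, fun h => Matrix.vecMul_injective_iff.1 ?_⟩
  exact (injective_iff_map_eq_zero Y.vecMulLinear).2 h

/-- A subspace `V` in the fiber is mapped isomorphically onto the span of `Y`, so each row of `Y`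
has exactly one preimage in `V`. -/
theorem bijOn_rowSpan_fiber {n : ℕ} (Z : Matrix (Fin (k + m)) (Fin n) ℝ)
    {Y : Matrix (Fin k) (Fin (k + m)) ℝ} (hY : LinearIndependent ℝ Y.row) :
    Set.BijOn rowSpan {C : Matrix (Fin k) (Fin n) ℝ | C * Zᵀ = Y} (fiber k m Z (rowSpan Y)) := by
  have hdisj : ∀ C : Matrix (Fin k) (Fin n) ℝ, C * Zᵀ = Y → ∀ v ∈ rowSpan C, Z *ᵥ v = 0 →
      v = 0 := by
    rintro C hC v hv h
    obtain ⟨c, rfl⟩ := mem_rowSpan.1 hv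
    rw [mulVec_vecMul, hC, vecMul_eq_zero_iff hY] at h
    rw [h, Matrix.zero_vecMul]
  refine ⟨fun C hC => ⟨?_, ?_, ?_⟩, fun C hC C' hC' h => ?_, fun V hV => ?_⟩
  · have hind : LinearIndependent ℝ C.row := linearIndependent_row_iff.2 fun c hc => by
      rw [← vecMul_eq_zero_iff hY, ← (show C * Zᵀ = Y from hC), ← mulVec_vecMul, hc,
        Matrix.mulVec_zero]
    rw [rowSpan, finrank_span_eq_card hind, Fintype.card_fin]
  · rw [Submodule.disjoint_def]
    exact fun v hv hv' => hdisj C hC v hv hv'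
  · ext y
    rw [Submodule.mem_map, mem_rowSpan]
    constructor
    · rintro ⟨v, hv, rfl⟩
      obtain ⟨c, rfl⟩ := mem_rowSpan.1 hv
      exact ⟨c, by rw [Matrix.mulVecLin_apply, mulVec_vecMul, hC]⟩
    · rintro ⟨c, rfl⟩
      refine ⟨c ᵥ* C, mem_rowSpan.2 ⟨c, rfl⟩, ?_⟩
      rw [Matrix.mulVecLin_apply, mulVec_vecMul, hC]
  · ext α i
    have h1 : C α - C' α ∈ rowSpan C :=
      sub_mem (Submodule.subset_span ⟨α, rfl⟩)
        ((show rowSpan C = rowSpan C' from h) ▸ Submodule.subset_span ⟨α, rfl⟩)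
    have h2 := hdisj C hC _ h1 (by
      rw [Matrix.mulVec_sub, mulVec_row, mulVec_row, (show C * Zᵀ = Y from hC),
        (show C' * Zᵀ = Y from hC'), sub_self])
    exact sub_eq_zero.1 (congrFun h2 i)
  · obtain ⟨hV1, hV2, hV3⟩ := hV
    have h1 : ∀ α, ∃ v ∈ V, Z *ᵥ v = Y α := fun α => by
      have h2 : Y α ∈ V.map Z.mulVecLin := by
        rw [hV3]
        exact Submodule.subset_span ⟨α, rfl⟩
      exact Submodule.mem_map.1 h2
    choose C hC1 hC2 using h1
    have hC : Matrix.of C * Zᵀ = Y := by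
      ext α a
      rw [← mulVec_row]
      exact congrFun (hC2 α) a
    refine ⟨Matrix.of C, hC, ?_⟩
    have hle : rowSpan (Matrix.of C) ≤ V := Submodule.span_le.2 (by
      rintro _ ⟨α, rfl⟩
      exact hC1 α)
    have hind : LinearIndependent ℝ (Matrix.of C).row := linearIndependent_row_iff.2 fun c hc => by
      rw [← vecMul_eq_zero_iff hY, ← hC, ← mulVec_vecMul, hc, Matrix.mulVec_zero]
    refine Submodule.eq_of_le_of_finrank_eq hle ?_
    rw [hV1, rowSpan, finrank_span_eq_card hind, Fintype.card_fin]

theorem mulVec_eq_leading_add_trailing (Z : Matrix (Fin (k + m)) (Fin (k + m + l)) ℝ)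
    (u : Fin (k + m + l) → ℝ) : Z *ᵥ u = leadingBlock Z *ᵥ (u ∘ Fin.castAdd l) +
      trailingBlock Z *ᵥ (u ∘ Fin.natAdd (k + m)) := by
  ext a
  simp [Matrix.mulVec, dotProduct, Fin.sum_univ_add, leadingBlock, trailingBlock]

/-- `ker Z` is a graph over the last `l` coordinates because `z̃` is invertible; hence frames are
controlled by `trailingMinor`. -/
theorem eq_zero_of_trailing_eq_zero {Z : Matrix (Fin (k + m)) (Fin (k + m + l)) ℝ}
    (hZ : (leadingBlock Z).det ≠ 0) {u : Fin (k + m + l) → ℝ} (hu : Z *ᵥ u = 0)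
    (ht : ∀ j, u (Fin.natAdd (k + m) j) = 0) : u = 0 := by
  have h0 : u ∘ Fin.natAdd (k + m) = 0 := funext ht
  rw [mulVec_eq_leading_add_trailing, h0, Matrix.mulVec_zero, add_zero] at hu
  have h1 := Matrix.eq_zero_of_mulVec_eq_zero hZ hu
  funext i
  exact Fin.addCases (fun a => congrFun h1 a) ht i

/-- The last `l` columns of the rows in `ker Z` of a frame. -/
def trailingMinor (A : Matrix (Fin l ⊕ Fin k) (Fin (k + m + l)) ℝ) : Matrix (Fin l) (Fin l) ℝ :=
  A.submatrix Sum.inl (Fin.natAdd (k + m))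

section

variable {Z : Matrix (Fin (k + m)) (Fin (k + m + l)) ℝ} {Y : Matrix (Fin k) (Fin (k + m)) ℝ}
  {A : Matrix (Fin l ⊕ Fin k) (Fin (k + m + l)) ℝ}

theorem isFiberFrame_of_det_ne_zero (hY : LinearIndependent ℝ Y.row)
    (h1 : A.submatrix Sum.inl id * Zᵀ = 0) (h2 : A.submatrix Sum.inr id * Zᵀ = Y)
    (h3 : (trailingMinor A).det ≠ 0) : IsFiberFrame Z Y A := by
  refine ⟨Matrix.vecMul_injective_iff.1 ?_, h1, h2⟩
  refine (injective_iff_map_eq_zero A.vecMulLinear).2 fun c hc => ?_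
  rw [Matrix.vecMulLinear_apply] at hc
  have hsum : c ᵥ* A = (c ∘ Sum.inl) ᵥ* A.submatrix Sum.inl id +
      (c ∘ Sum.inr) ᵥ* A.submatrix Sum.inr id := by
    ext i
    simp [Matrix.vecMul, dotProduct]
  have hr : c ∘ Sum.inr = 0 := by
    have h4 : Z *ᵥ (c ᵥ* A) = 0 := by rw [hc, Matrix.mulVec_zero]
    rwa [hsum, Matrix.mulVec_add, mulVec_vecMul, mulVec_vecMul, h1, h2, Matrix.vecMul_zero,
      zero_add, vecMul_eq_zero_iff hY] at h4
  have hl : c ∘ Sum.inl = 0 := by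
    rw [hsum, hr, Matrix.zero_vecMul, add_zero] at hc
    refine Matrix.eq_zero_of_vecMul_eq_zero h3 (funext fun j => ?_)
    exact congrFun hc (Fin.natAdd (k + m) j)
  funext r
  rcases r with j | α
  · exact congrFun hl j
  · exact congrFun hr α

theorem IsFiberFrame.row_mem_kernel (hA : IsFiberFrame Z Y A) (x : Fin l → ℝ) :
    Z *ᵥ (x ᵥ* A.submatrix Sum.inl id) = 0 := by
  rw [mulVec_vecMul, hA.kernel, Matrix.vecMul_zero]

theorem IsFiberFrame.det_trailingMinor_ne_zero (hA : IsFiberFrame Z Y A)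
    (hZ : (leadingBlock Z).det ≠ 0) : (trailingMinor A).det ≠ 0 := by
  intro h
  obtain ⟨x, hx, h0⟩ := Matrix.exists_vecMul_eq_zero_iff.2 h
  have h1 : x ᵥ* A.submatrix Sum.inl id = 0 :=
    eq_zero_of_trailing_eq_zero hZ (hA.row_mem_kernel x) fun j => congrFun h0 j
  have h2 : (Sum.elim x 0 : Fin l ⊕ Fin k → ℝ) ᵥ* A = 0 := by
    rw [← h1]
    ext i
    simp [Matrix.vecMul, dotProduct]
  have h3 := Matrix.vecMul_injective_iff.2 hA.indep
    (a₁ := Sum.elim x 0) (a₂ := 0) (by simpa using h2)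
  exact hx (funext fun j => congrFun h3 (Sum.inl j))

theorem IsFiberFrame.exists_of_mem_kernel (hA : IsFiberFrame Z Y A)
    (hZ : (leadingBlock Z).det ≠ 0) {u : Fin (k + m + l) → ℝ} (hu : Z *ᵥ u = 0) :
    ∃ x : Fin l → ℝ, x ᵥ* A.submatrix Sum.inl id = u := by
  have hdet := hA.det_trailingMinor_ne_zero hZ
  refine ⟨(u ∘ Fin.natAdd (k + m)) ᵥ* (trailingMinor A)⁻¹, ?_⟩
  rw [← sub_eq_zero]
  refine eq_zero_of_trailing_eq_zero hZ ?_ fun j => ?_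
  · rw [Matrix.mulVec_sub, hA.row_mem_kernel, hu, sub_zero]
  · have h1 : (((u ∘ Fin.natAdd (k + m)) ᵥ* (trailingMinor A)⁻¹) ᵥ* trailingMinor A) j =
        u (Fin.natAdd (k + m) j) := by
      rw [Matrix.vecMul_vecMul, Matrix.nonsing_inv_mul _ hdet.isUnit, Matrix.vecMul_one]
      rfl
    exact sub_eq_zero.2 h1

/-- The matrices which are mapped to `Y` form an affine space with coordinates given by a frame. -/
theorem IsFiberFrame.bijective_chart (hA : IsFiberFrame Z Y A) (hZ : (leadingBlock Z).det ≠ 0) :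
    Set.BijOn (fun X : Matrix (Fin k) (Fin l) ℝ =>
      X * A.submatrix Sum.inl id + A.submatrix Sum.inr id) Set.univ {C | C * Zᵀ = Y} := by
  refine ⟨fun X _ => ?_, fun X _ X' _ h => ?_, fun C hC => ?_⟩
  · show (X * A.submatrix Sum.inl id + A.submatrix Sum.inr id) * Zᵀ = Y
    rw [Matrix.add_mul, Matrix.mul_assoc, hA.kernel, hA.lift, Matrix.mul_zero, zero_add]
  · have h1 : X * trailingMinor A = X' * trailingMinor A := by
      have h2 := add_right_cancel h
      ext α j
      exact congrFun (congrFun h2 α) (Fin.natAdd (k + m) j)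
    have h2 := congrArg (· * (trailingMinor A)⁻¹) h1
    simpa [Matrix.mul_assoc,
      Matrix.mul_nonsing_inv _ (hA.det_trailingMinor_ne_zero hZ).isUnit] using h2
  · have h1 : ∀ α, ∃ x : Fin l → ℝ,
        x ᵥ* A.submatrix Sum.inl id = C α - A.submatrix Sum.inr id α := fun α =>
      hA.exists_of_mem_kernel hZ (by
        rw [Matrix.mulVec_sub, mulVec_row, mulVec_row, hA.lift, (show C * Zᵀ = Y from hC),
          sub_self])
    choose X hX using h1
    refine ⟨Matrix.of X, trivial, ?_⟩
    ext α i
    have h2 := congrFun (hX α) i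
    rw [Pi.sub_apply] at h2
    show (Matrix.of X * A.submatrix Sum.inl id) α i + A.submatrix Sum.inr id α i = C α i
    rw [← eq_sub_iff_add_eq, ← h2]
    rfl

end

/-- The frame `A₀`, with its rows in `ker Z` multiplied by scalars. -/
def scaledFrame (Z : Matrix (Fin (k + m)) (Fin (k + m + l)) ℝ)
    (Y : Matrix (Fin k) (Fin (k + m)) ℝ) (r : Fin l → ℝ) :
    Matrix (Fin l ⊕ Fin k) (Fin (k + m + l)) ℝ :=
  Matrix.of fun s i => Sum.elim r 1 s * fiberMatrix Z Y s i

theorem scaledFrame_one (Z : Matrix (Fin (k + m)) (Fin (k + m + l)) ℝ)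
    (Y : Matrix (Fin k) (Fin (k + m)) ℝ) : scaledFrame Z Y 1 = fiberMatrix Z Y := by
  ext s i
  rcases s with j | α <;> simp [scaledFrame]

theorem trailingMinor_scaledFrame (Z : Matrix (Fin (k + m)) (Fin (k + m + l)) ℝ)
    (Y : Matrix (Fin k) (Fin (k + m)) ℝ) (r : Fin l → ℝ) :
    trailingMinor (scaledFrame Z Y r) = Matrix.diagonal r := by
  ext i j
  simp [trailingMinor, scaledFrame, fiberMatrix, Matrix.one_apply, Matrix.diagonal_apply]

theorem isFiberFrame_scaledFrame {Z : Matrix (Fin (k + m)) (Fin (k + m + l)) ℝ}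
    (hZ : (leadingBlock Z).det ≠ 0) {Y : Matrix (Fin k) (Fin (k + m)) ℝ}
    (hY : LinearIndependent ℝ Y.row) {r : Fin l → ℝ} (hr : ∀ j, r j ≠ 0) :
    IsFiberFrame Z Y (scaledFrame Z Y r) := by
  have hT : IsUnit (leadingBlock Z)ᵀ.det := by
    rw [Matrix.det_transpose]
    exact hZ.isUnit
  refine isFiberFrame_of_det_ne_zero hY ?_ ?_ ?_
  · ext j a
    have h1 : -((leadingBlock Z)⁻¹ * trailingBlock Z)ᵀ * (leadingBlock Z)ᵀ + (trailingBlock Z)ᵀ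
        = 0 := by
      rw [Matrix.neg_mul, ← Matrix.transpose_mul, ← Matrix.mul_assoc,
        Matrix.mul_nonsing_inv _ hZ.isUnit, Matrix.one_mul, neg_add_cancel]
    have h2 := congrFun (congrFun h1 j) a
    simp only [Matrix.add_apply, Matrix.mul_apply, Matrix.transpose_apply, Matrix.zero_apply,
      leadingBlock, trailingBlock, Matrix.submatrix_apply, id, Matrix.neg_apply] at h2
    rw [Matrix.mul_apply, Fin.sum_univ_add]
    simp only [Matrix.mul_apply, scaledFrame, fiberMatrix, leadingBlock, trailingBlock, Matrix.submatrix_apply, Matrix.of_apply, Sum.elim_inl, id,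
      finSumFinEquiv_symm_apply_castAdd, finSumFinEquiv_symm_apply_natAdd, Matrix.transpose_apply,
      Matrix.fromBlocks_apply₁₁, Matrix.fromBlocks_apply₁₂, Matrix.neg_apply, Matrix.zero_apply,
      Matrix.one_apply, mul_ite, mul_one, mul_zero, ite_mul, zero_mul, Finset.sum_ite_eq,
      Finset.mem_univ, if_true, mul_assoc, ← Finset.mul_sum, ← mul_add]
    rw [h2, mul_zero]
  · ext α a
    have h1 : Y * ((leadingBlock Z)ᵀ)⁻¹ * (leadingBlock Z)ᵀ = Y := by
      rw [Matrix.mul_assoc, Matrix.nonsing_inv_mul _ hT, Matrix.mul_one]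
    have h2 := congrFun (congrFun h1 α) a
    rw [← h2, Matrix.mul_apply, Matrix.mul_apply (N := (leadingBlock Z)ᵀ), Fin.sum_univ_add]
    simp [scaledFrame, fiberMatrix, leadingBlock]
  · rw [trailingMinor_scaledFrame, Matrix.det_diagonal]
    exact Finset.prod_ne_zero_iff.2 fun j _ => hr j

theorem mulVec_mem_span_col {q n : ℕ} (Z : Matrix (Fin q) (Fin n) ℝ) {u : Fin n → ℝ}
    {J : Finset (Fin n)} (hu : ∀ i ∉ J, u i = 0) :
    Z *ᵥ u ∈ Submodule.span ℝ (Z.col '' (J : Set (Fin n))) := by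
  have h : Z *ᵥ u = ∑ i, u i • Z.col i := by
    ext a
    simp [Matrix.mulVec, dotProduct, mul_comm]
  rw [h]
  refine Submodule.sum_mem _ fun i _ => ?_
  by_cases hi : i ∈ J
  · exact Submodule.smul_mem _ _ (Submodule.subset_span (Set.mem_image_of_mem _ hi))
  · rw [hu i hi]
    simp

end Frames

/-! ### Cyclic intervals -/

section CyclicIntervals

variable {k n : ℕ}

theorem mem_cyclicInterval (hk : k ≤ n) {i j : Fin n} :
    i ∈ cyclicInterval k j ↔
      ((j : ℕ) ≤ i ∧ (i : ℕ) < j + k) ∨ (i : ℕ) + n < j + k := by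
  simp only [cyclicInterval, Finset.mem_filter, Finset.mem_univ, true_and]
  have hi := i.2
  have hj := j.2
  constructor
  · rintro ⟨t, ht, h⟩
    rcases lt_or_ge ((j : ℕ) + t) n with h1 | h1
    · rw [Nat.mod_eq_of_lt h1] at h
      omega
    · rw [Nat.mod_eq_sub_mod h1, Nat.mod_eq_of_lt (by omega)] at h
      omega
  · rintro (⟨h1, h2⟩ | h)
    · exact ⟨i - j, by omega, by rw [Nat.mod_eq_of_lt (by omega)]; omega⟩
    · refine ⟨i + n - j, by omega, ?_⟩
      rw [show (j : ℕ) + (i + n - j) = i + n by omega, Nat.add_mod_right, Nat.mod_eq_of_lt hi]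

theorem card_cyclicInterval (hk : k ≤ n) (j : Fin n) : (cyclicInterval k j).card = k := by
  have hj := j.2
  have hn : 0 < n := by omega
  have h : cyclicInterval k j = (Finset.range k).image
      fun t => (⟨((j : ℕ) + t) % n, Nat.mod_lt _ hn⟩ : Fin n) := by
    ext i
    simp only [cyclicInterval, Finset.mem_filter, Finset.mem_univ, true_and, Finset.mem_image,
      Finset.mem_range, Fin.ext_iff, eq_comm]
  rw [h, Finset.card_image_of_injOn, Finset.card_range]
  intro s hs t ht hst
  have hs' := Finset.mem_range.1 hs
  have ht' := Finset.mem_range.1 ht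
  have hst' := Fin.ext_iff.1 hst
  simp only at hst'
  rcases lt_or_ge ((j : ℕ) + s) n with h1 | h1 <;> rcases lt_or_ge ((j : ℕ) + t) n with h2 | h2
  · rw [Nat.mod_eq_of_lt h1, Nat.mod_eq_of_lt h2] at hst'
    omega
  · rw [Nat.mod_eq_of_lt h1, Nat.mod_eq_sub_mod h2, Nat.mod_eq_of_lt (by omega)] at hst'
    omega
  · rw [Nat.mod_eq_of_lt h2, Nat.mod_eq_sub_mod h1, Nat.mod_eq_of_lt (by omega)] at hst'
    omega
  · rw [Nat.mod_eq_sub_mod h1, Nat.mod_eq_of_lt (by omega), Nat.mod_eq_sub_mod h2,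
      Nat.mod_eq_of_lt (by omega)] at hst'
    omega

theorem cyclicInterval_one (j : Fin n) : cyclicInterval 1 j = {j} := by
  ext i
  have hi := i.2
  have hj := j.2
  rw [mem_cyclicInterval (by omega), Finset.mem_singleton, Fin.ext_iff]
  omega

/-- The start `j` is the element of `I_j` whose predecessor is missing: for `i < j`, an interval
`I_i` that contains `j` contains `j - 1` too, whereas `I_j` does not as `k < n`. -/
theorem cyclicInterval_injective (hk : 1 ≤ k) (hkn : k < n) :
    Function.Injective (cyclicInterval k : Fin n → Finset (Fin n)) := by
  have key : ∀ i j : Fin n, i < j → cyclicInterval k i ≠ cyclicInterval k j := by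
    intro i j hij h
    have hi := i.2
    have hj := j.2
    have hij' : (i : ℕ) < j := hij
    have h1 : j ∈ cyclicInterval k i := by
      rw [h, mem_cyclicInterval hkn.le]
      omega
    rw [mem_cyclicInterval hkn.le] at h1
    let p : Fin n := ⟨j - 1, by omega⟩
    have hp : (p : ℕ) = j - 1 := rfl
    have h2 : p ∈ cyclicInterval k i := by
      rw [mem_cyclicInterval hkn.le]
      omega
    rw [h, mem_cyclicInterval hkn.le] at h2
    omega
  intro i j h
  rcases lt_trichotomy i j with hij | hij | hij
  · exact absurd h (key i j hij)
  · exact hij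
  · exact absurd h.symm (key j i hij)

theorem plucker_singleton (C : Matrix (Fin 1) (Fin n) ℝ) (j : Fin n) : plucker C {j} = C 0 j := by
  rw [plucker_of_card _ (Finset.card_singleton j), Matrix.det_fin_one]
  simp

end CyclicIntervals

/-! ### Simple poles along affine hyperplanes -/

section SimplePoles

variable {l N : ℕ}

theorem exists_affine_zero {a : Fin l → ℝ} (ha : a ≠ 0) (b : ℝ) : ∃ x, a ⬝ᵥ x + b = 0 := by
  have h : a ⬝ᵥ a ≠ 0 := fun h => ha (dotProduct_self_eq_zero.1 h)
  refine ⟨(-b / (a ⬝ᵥ a)) • a, ?_⟩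
  rw [dotProduct_smul, smul_eq_mul, div_mul_cancel₀ _ h, neg_add_cancel]

/-- The part of `a'` orthogonal to `a` is a direction of the common hyperplane, hence orthogonal to
`a'` as well, hence zero. A common point then compares the constants. -/
theorem proportional_of_zeros_eq {a a' : Fin l → ℝ} {b b' : ℝ} (ha : a ≠ 0)
    (h : {x | a ⬝ᵥ x + b = 0} = {x | a' ⬝ᵥ x + b' = 0}) :
    ∃ s : ℝ, a' = s • a ∧ b' = s * b := by
  have h0 : a ⬝ᵥ a ≠ 0 := fun h => ha (dotProduct_self_eq_zero.1 h)
  obtain ⟨x, hx⟩ := exists_affine_zero ha b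
  have hx' : a' ⬝ᵥ x + b' = 0 := by
    have : x ∈ {x | a ⬝ᵥ x + b = 0} := hx
    rwa [h] at this
  have horth : ∀ v, a ⬝ᵥ v = 0 → a' ⬝ᵥ v = 0 := fun v hv => by
    have h1 : x + v ∈ {x | a ⬝ᵥ x + b = 0} := by
      rw [Set.mem_ofPred_eq, dotProduct_add, hv, add_zero, hx]
    rw [h, Set.mem_ofPred_eq, dotProduct_add] at h1
    linarith
  let s : ℝ := a ⬝ᵥ a' / (a ⬝ᵥ a)
  have hv : a ⬝ᵥ (a' - s • a) = 0 := by
    rw [dotProduct_sub, dotProduct_smul, smul_eq_mul, div_mul_cancel₀ _ h0, sub_self]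
  have hv' : (a' - s • a) ⬝ᵥ (a' - s • a) = 0 := by
    rw [sub_dotProduct, horth _ hv, smul_dotProduct, hv, smul_zero, sub_zero]
  have hs : a' = s • a := sub_eq_zero.1 (dotProduct_self_eq_zero.1 hv')
  refine ⟨s, hs, ?_⟩
  rw [hs, smul_dotProduct, smul_eq_mul] at hx'
  linear_combination hx' - s * hx

theorem hasSimplePolesOn_of_formula {η : (Fin l → ℝ) → Forms (Fin l → ℝ)}
    {L : Fin N → (Fin l → ℝ) → ℝ} {a : Fin N → Fin l → ℝ} {b : Fin N → ℝ}
    (hL : ∀ i x, L i x = a i ⬝ᵥ x + b i) (ha : ∀ i, a i ≠ 0)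
    (hdist : ∀ i j, i ≠ j → {x | L i x = 0} ≠ {x | L j x = 0}) {c : ℝ} (hc : c ≠ 0)
    (hη : ∀ x, (∀ i, L i x ≠ 0) → η x = (c / ∏ i, L i x) • coordVolume l) :
    HasSimplePolesOn η L where
  hyperplane i := ⟨a i, b i, ha i, hL i⟩
  distinct := hdist
  poles := by
    have han : ∀ i x, AnalyticAt ℝ (L i) x := fun i x => by
      have h1 : L i = fun x => ∑ j, a i j * x j + b i := funext fun x => hL i x
      rw [h1]
      refine AnalyticAt.add ?_ analyticAt_const
      refine Finset.analyticAt_fun_sum _ fun j _ => ?_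
      exact analyticAt_const.mul ((ContinuousLinearMap.proj (R := ℝ) j).analyticAt x)
    refine ⟨fun x => c / ∏ i, L i x, fun x hx => ⟨hη x hx, ?_⟩, fun i x _ hj => ?_⟩
    · refine analyticAt_const.div (Finset.analyticAt_fun_prod _ fun i _ => han i x) ?_
      exact Finset.prod_ne_zero_iff.2 fun i _ => hx i
    · have hne : ∏ j ∈ Finset.univ.erase i, L j x ≠ 0 :=
        Finset.prod_ne_zero_iff.2 fun j hj' => hj j (Finset.ne_of_mem_erase hj')
      refine ⟨fun y => c / ∏ j ∈ Finset.univ.erase i, L j y,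
        analyticAt_const.div (Finset.analyticAt_fun_prod _ fun j _ => han j x) hne,
        div_ne_zero hc hne, Filter.Eventually.of_forall fun y _ => ?_⟩
      show c / ∏ i, L i y = c / (∏ j ∈ Finset.univ.erase i, L j y) / L i y
      rw [← Finset.mul_prod_erase Finset.univ (fun j => L j y) (Finset.mem_univ i), div_div, mul_comm]

end SimplePoles

/-! ### Cyclic polytopes -/

section CyclicPolytopes

variable {m l : ℕ} {Z : Matrix (Fin (1 + m)) (Fin (1 + m + l)) ℝ}
  {Y : Matrix (Fin 1) (Fin (1 + m)) ℝ} {A : Matrix (Fin l ⊕ Fin 1) (Fin (1 + m + l)) ℝ}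

/-- The linear part of the chart `x ↦ (x, 1) A`. -/
def polytopeChartLinear (A : Matrix (Fin l ⊕ Fin 1) (Fin (1 + m + l)) ℝ) :
    (Fin l → ℝ) →ₗ[ℝ] Matrix (Fin 1) (Fin (1 + m + l)) ℝ where
  toFun x := (Matrix.of fun _ => x) * A.submatrix Sum.inl id
  map_add' x y := Matrix.add_mul (Matrix.of fun _ => x) (Matrix.of fun _ => y) _
  map_smul' r x := Matrix.smul_mul r (Matrix.of fun _ => x) _

theorem polytopeChartLinear_apply (A : Matrix (Fin l ⊕ Fin 1) (Fin (1 + m + l)) ℝ)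
    (x : Fin l → ℝ) (α : Fin 1) (i : Fin (1 + m + l)) :
    polytopeChartLinear A x α i = ∑ j, x j * A (Sum.inl j) i := rfl

theorem polytopeChart_eq (A : Matrix (Fin l ⊕ Fin 1) (Fin (1 + m + l)) ℝ) (x : Fin l → ℝ) :
    polytopeChart A x = polytopeChartLinear A x + A.submatrix Sum.inr id := by
  ext α i
  have hα : α = 0 := Subsingleton.elim _ _
  subst hα
  simp [polytopeChart, polytopeChartLinear_apply, lam, Matrix.mul_apply]

theorem polytopeChart_apply (A : Matrix (Fin l ⊕ Fin 1) (Fin (1 + m + l)) ℝ) (x : Fin l → ℝ)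
    (i : Fin (1 + m + l)) : polytopeChart A x 0 i = lam x ⬝ᵥ A.col i := rfl

theorem plucker_polytopeChart (A : Matrix (Fin l ⊕ Fin 1) (Fin (1 + m + l)) ℝ) (x : Fin l → ℝ)
    (i : Fin (1 + m + l)) :
    plucker (polytopeChart A x) (cyclicInterval 1 i) = lam x ⬝ᵥ A.col i := by
  rw [cyclicInterval_one, plucker_singleton, polytopeChart_apply]

theorem lam_dotProduct (A : Matrix (Fin l ⊕ Fin 1) (Fin (1 + m + l)) ℝ) (x : Fin l → ℝ)
    (i : Fin (1 + m + l)) :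
    lam x ⬝ᵥ A.col i = (fun j => A (Sum.inl j) i) ⬝ᵥ x + A (Sum.inr 0) i := by
  simp [lam, dotProduct, mul_comm]

theorem polytopeChart_mul_transpose (hA : IsFiberFrame Z Y A) (x : Fin l → ℝ) :
    polytopeChart A x * Zᵀ = Y := by
  rw [polytopeChart_eq, Matrix.add_mul, hA.lift, polytopeChartLinear]
  show (Matrix.of fun _ => x) * A.submatrix Sum.inl id * Zᵀ + Y = Y
  rw [Matrix.mul_assoc, hA.kernel, Matrix.mul_zero, zero_add]

theorem polytopeChart_bijOn (hZ : (leadingBlock Z).det ≠ 0) (hY : LinearIndependent ℝ Y.row)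
    (hA : IsFiberFrame Z Y A) :
    Set.BijOn (fun x => rowSpan (polytopeChart A x)) Set.univ (fiber 1 m Z (rowSpan Y)) := by
  have h0 : Set.BijOn (fun x : Fin l → ℝ => (Matrix.of fun _ => x : Matrix (Fin 1) (Fin l) ℝ))
      Set.univ Set.univ := by
    refine ⟨fun _ _ => trivial, fun x _ y _ h => congrFun h 0, fun X _ => ⟨X 0, trivial, ?_⟩⟩
    ext α j
    rw [Subsingleton.elim α 0]
    rfl
  refine ((bijOn_rowSpan_fiber Z hY).comp ((hA.bijective_chart hZ).comp h0)).congr fun x _ => ?_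
  simp only [Function.comp_apply]
  rw [polytopeChart_eq]
  rfl

/-- The last `l` entries of `λA` depend on `λ₁, …, λ_l` through the matrix `trailingMinor A`, whose
determinant therefore enters the constant. -/
theorem pullback_polytopeChart (hZ : (leadingBlock Z).det ≠ 0) (hY : LinearIndependent ℝ Y.row)
    (hA : IsFiberFrame Z Y A)
    {ω : Matrix (Fin 1) (Fin (1 + m + l)) ℝ → Forms (Matrix (Fin 1) (Fin (1 + m + l)) ℝ)}
    (hω : IsFiberFactor Z ω) (x : Fin l → ℝ) (hx : ∀ i, lam x ⬝ᵥ A.col i ≠ 0) :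
    pullback (polytopeChart A) ω x =
      ((-1) ^ (l * m) / (leadingBlock Z).det * (trailingMinor A).det / ∏ i, lam x ⬝ᵥ A.col i) •
        coordVolume l := by
  have hchart : polytopeChart A =
      fun x => polytopeChartLinear A x + A.submatrix Sum.inr id := funext (polytopeChart_eq A)
  have hC : polytopeChart A x ∈ regularLocus Z :=
    ⟨fun j => by rw [plucker_polytopeChart]; exact hx j,
      by rwa [polytopeChart_mul_transpose hA]⟩
  have hD : ∀ v, polytopeChartLinear A v * Zᵀ = 0 := fun v => by
    show (Matrix.of fun _ => v) * A.submatrix Sum.inl id * Zᵀ = 0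
    rw [Matrix.mul_assoc, hA.kernel, Matrix.mul_zero]
  rw [hchart, pullback_affine, ← polytopeChart_eq,
    map_fiberFactor_eq hZ hω hC (one_mul l).symm _ hD, map_fiberForm _ _ hD]
  simp only [plucker_polytopeChart]
  have hvol : (List.ofFn fun α : Fin 1 => wedge (List.ofFn fun j : Fin l =>
      coord (Fin.natAdd (1 + m) j) ∘ₗ rowMap α ∘ₗ polytopeChartLinear A)).prod =
      (trailingMinor A).det • coordVolume l := by
    rw [List.ofFn_succ, List.ofFn_zero, List.prod_cons, List.prod_nil, mul_one,
      ← Matrix.det_transpose, coordVolume_eq_wedge, ← wedge_matrix_smul]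
    congr 2
    funext j
    apply LinearMap.ext
    intro v
    simp [polytopeChartLinear_apply, trailingMinor, mul_comm]
  rw [hvol, smul_smul, fiberConst, rowConst]
  congr 1
  simp only [pow_one, Nat.choose_succ_self, zero_mul, pow_zero, mul_one]
  rw [div_eq_mul_inv _ (∏ i, lam x ⬝ᵥ A.col i), mul_right_comm]

theorem exists_chart_direction (hZ : (leadingBlock Z).det ≠ 0) (hA : IsFiberFrame Z Y A)
    {u : Fin (1 + m + l) → ℝ} (hu : Z *ᵥ u = 0) :
    ∃ v : Fin l → ℝ, ∀ i, (fun j => A (Sum.inl j) i) ⬝ᵥ v = u i := by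
  obtain ⟨v, rfl⟩ := hA.exists_of_mem_kernel hZ hu
  exact ⟨v, fun i => by simp [Matrix.vecMul, dotProduct, mul_comm]⟩

/-- Some relation between `m + 2` columns of `Z` involves column `i`, so the `i`-th coordinate is
not zero on `ker Z`. -/
theorem frame_col_ne_zero (hTP : TotallyPositive Z) (hA : IsFiberFrame Z Y A) (hl : 1 ≤ l)
    (i : Fin (1 + m + l)) : (fun j => A (Sum.inl j) i) ≠ 0 := by
  intro h0
  obtain ⟨S, hS1, -, hS2⟩ := Finset.exists_subsuperset_card_eq
    (Finset.subset_univ ({i} : Finset (Fin (1 + m + l)))) (n := 1 + m + 1) (by simp)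
    (by rw [Finset.card_univ, Fintype.card_fin]; omega)
  obtain ⟨u, hu1, -, hu3⟩ := hTP.exists_kernel_vector hS2
  obtain ⟨v, hv⟩ := exists_chart_direction hTP.det_leading_ne_zero hA hu1
  refine hu3 i (hS1 (Finset.mem_singleton_self i)) ?_
  rw [← hv, h0, zero_dotProduct]

theorem polytope_hyperplanes_distinct (hTP : TotallyPositive Z) (hY : LinearIndependent ℝ Y.row)
    (hA : IsFiberFrame Z Y A) (h : 2 ≤ l ∨ (l = 1 ∧ IsGenericPoint Z Y))
    {i j : Fin (1 + m + l)} (hij : i ≠ j) :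
    {x | lam x ⬝ᵥ A.col i = 0} ≠ {x | lam x ⬝ᵥ A.col j = 0} := by
  intro heq
  have hl : 1 ≤ l := by omega
  obtain ⟨x, hx⟩ := exists_affine_zero (frame_col_ne_zero hTP hA hl i) (A (Sum.inr 0) i)
  rw [← lam_dotProduct] at hx
  have hx' : lam x ⬝ᵥ A.col j = 0 := by
    have : x ∈ {x | lam x ⬝ᵥ A.col i = 0} := hx
    rwa [heq] at this
  rcases h with h | ⟨rfl, h⟩
  -- For `l ≥ 2` there are `m + 2` columns that include `j` and avoid `i`. Their relation is a
  -- direction along the hyperplane of `i` that leaves the hyperplane of `j`.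
  · obtain ⟨S, hS1, hS2, hS3⟩ := Finset.exists_subsuperset_card_eq
      (show ({j} : Finset (Fin (1 + m + l))) ⊆ Finset.univ.erase i by
        simpa using hij.symm) (n := 1 + m + 1) (by simp)
      (by rw [Finset.card_erase_of_mem (Finset.mem_univ i), Finset.card_univ, Fintype.card_fin]
          omega)
    obtain ⟨u, hu1, hu2, hu3⟩ := hTP.exists_kernel_vector hS3
    obtain ⟨v, hv⟩ := exists_chart_direction hTP.det_leading_ne_zero hA hu1
    have h1 : x + v ∈ {x | lam x ⬝ᵥ A.col i = 0} := by
      rw [Set.mem_ofPred_eq, lam_dotProduct, dotProduct_add, hv,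
        hu2 i fun hi => Finset.notMem_erase i _ (hS2 hi), add_zero, ← lam_dotProduct, hx]
    rw [heq, Set.mem_ofPred_eq, lam_dotProduct, dotProduct_add, hv, add_right_comm,
      ← lam_dotProduct, hx', zero_add] at h1
    exact hu3 j (hS1 (Finset.mem_singleton_self j)) h1
  -- At a common zero, `λA` is supported on the `m` columns of `J`, so the row of `Y` lies in their
  -- span.
  · let J : Finset (Fin (1 + m + 1)) := {i, j}ᶜ
    have hJ : J.card = m := by
      rw [Finset.card_compl, Fintype.card_fin, Finset.card_pair hij]
      omega
    have h1 : Z *ᵥ polytopeChart A x 0 = Y 0 := by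
      rw [mulVec_row, polytopeChart_mul_transpose hA]
    have h2 : Y 0 ∈ Submodule.span ℝ (Z.col '' (J : Set (Fin (1 + m + 1)))) := by
      rw [← h1]
      refine mulVec_mem_span_col Z fun t ht => ?_
      rw [polytopeChart_apply]
      simp only [J, Finset.mem_compl, not_not, Finset.mem_insert, Finset.mem_singleton] at ht
      rcases ht with rfl | rfl
      · exact hx
      · exact hx'
    exact hY.ne_zero 0 (Submodule.disjoint_def.1 (h J hJ) _ (Submodule.subset_span ⟨0, rfl⟩) h2)

/-! ### The formula for cyclic polytopes and its normalisation. -/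

theorem polytopeFiberFormula_of_frame (hTP : TotallyPositive Z) (hY : LinearIndependent ℝ Y.row)
    (hA : IsFiberFrame Z Y A) :
    PolytopeFiberFormula Z Y A
      ((-1) ^ (l * m) / (leadingBlock Z).det * (trailingMinor A).det) where
  frame := hA
  coordinates := polytopeChart_bijOn hTP.det_leading_ne_zero hY hA
  formula _ hω x hx := pullback_polytopeChart hTP.det_leading_ne_zero hY hA hω x hx
  simplePoles h ω hω := by
    have hl : 1 ≤ l := by omega
    refine hasSimplePolesOn_of_formula (fun i x => lam_dotProduct A x i)
      (frame_col_ne_zero hTP hA hl)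
      (fun i j hij => polytope_hyperplanes_distinct hTP hY hA h hij) ?_
      (pullback_polytopeChart hTP.det_leading_ne_zero hY hA hω)
    exact mul_ne_zero (div_ne_zero (pow_ne_zero _ (by norm_num)) hTP.det_leading_ne_zero)
      (hA.det_trailingMinor_ne_zero hTP.det_leading_ne_zero)

theorem polytopeFiberFormula_fiberMatrix (hTP : TotallyPositive Z)
    (hY : LinearIndependent ℝ Y.row) :
    PolytopeFiberFormula Z Y (fiberMatrix Z Y) ((-1) ^ (l * m) / (leadingBlock Z).det) := by
  have h := polytopeFiberFormula_of_frame hTP hY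
    (isFiberFrame_scaledFrame hTP.det_leading_ne_zero hY (r := 1) fun _ => one_ne_zero)
  rwa [trailingMinor_scaledFrame, Matrix.det_diagonal, scaledFrame_one,
    show ∏ i : Fin l, (1 : Fin l → ℝ) i = 1 from Finset.prod_eq_one fun _ _ => rfl, mul_one] at h

theorem exists_polytopeFiberFormula_one (hTP : TotallyPositive Z)
    (hY : LinearIndependent ℝ Y.row) (hl : 1 ≤ l) : ∃ A, PolytopeFiberFormula Z Y A 1 := by
  have hc : ((-1) ^ (l * m) / (leadingBlock Z).det : ℝ) ≠ 0 :=
    div_ne_zero (pow_ne_zero _ (by norm_num)) hTP.det_leading_ne_zero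
  let j₀ : Fin l := ⟨0, hl⟩
  -- Scaling a single kernel row by the inverse of the constant multiplies the determinant of
  -- `trailingMinor` by just that.
  let r : Fin l → ℝ := Function.update 1 j₀ ((-1) ^ (l * m) / (leadingBlock Z).det)⁻¹
  have hr : ∀ j, r j ≠ 0 := fun j => by
    by_cases h : j = j₀
    · rw [h]
      simpa [r] using inv_ne_zero hc
    · simp [r, h]
  have h := polytopeFiberFormula_of_frame hTP hY
    (isFiberFrame_scaledFrame hTP.det_leading_ne_zero hY hr)
  rw [trailingMinor_scaledFrame, Matrix.det_diagonal,
    Finset.prod_update_of_mem (Finset.mem_univ j₀),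
    show ∏ i ∈ Finset.univ \ {j₀}, (1 : Fin l → ℝ) i = 1 from Finset.prod_eq_one fun _ _ => rfl,
    mul_one, mul_inv_cancel₀ hc] at h
  exact ⟨_, h⟩

end CyclicPolytopes

/-! ### Conjugates to polytopes -/

section Conjugates

variable {m l : ℕ} {Z : Matrix (Fin (l + m)) (Fin (l + m + 1)) ℝ}
  {Y : Matrix (Fin l) (Fin (l + m)) ℝ} {A : Matrix (Fin 1 ⊕ Fin l) (Fin (l + m + 1)) ℝ}

/-- The column with entries `-y`. -/
def negCol (y : Fin l → ℝ) : Matrix (Fin l) (Fin 1) ℝ := Matrix.of fun a _ => -y a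

/-- The linear part of the chart `y ↦ (-y | 1) A`. -/
def conjugateChartLinear (A : Matrix (Fin 1 ⊕ Fin l) (Fin (l + m + 1)) ℝ) :
    (Fin l → ℝ) →ₗ[ℝ] Matrix (Fin l) (Fin (l + m + 1)) ℝ where
  toFun y := negCol y * A.submatrix Sum.inl id
  map_add' x y := by
    rw [← Matrix.add_mul]
    congr 1
    ext a b
    simp [negCol, add_comm]
  map_smul' r y := by
    rw [RingHom.id_apply, ← Matrix.smul_mul]
    congr 1
    ext a b
    simp [negCol]

theorem conjugateChartLinear_eq (A : Matrix (Fin 1 ⊕ Fin l) (Fin (l + m + 1)) ℝ)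
    (y : Fin l → ℝ) : conjugateChartLinear A y = negCol y * A.submatrix Sum.inl id := rfl

theorem conjugateChartLinear_apply (A : Matrix (Fin 1 ⊕ Fin l) (Fin (l + m + 1)) ℝ)
    (y : Fin l → ℝ) (a : Fin l) (i : Fin (l + m + 1)) :
    conjugateChartLinear A y a i = -y a * A (Sum.inl 0) i := by
  rw [conjugateChartLinear_eq, Matrix.mul_apply, Fin.sum_univ_one]
  rfl

theorem conjugateChart_eq (A : Matrix (Fin 1 ⊕ Fin l) (Fin (l + m + 1)) ℝ) (y : Fin l → ℝ) :
    conjugateChart A y = conjugateChartLinear A y + A.submatrix Sum.inr id := by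
  ext a i
  rw [Matrix.add_apply, conjugateChartLinear_apply]
  simp [conjugateChart, dualLam, Matrix.mul_apply, Matrix.one_apply]

theorem conjugateChart_mul_transpose (hA : IsFiberFrame Z Y A) (y : Fin l → ℝ) :
    conjugateChart A y * Zᵀ = Y := by
  rw [conjugateChart_eq, Matrix.add_mul, hA.lift, conjugateChartLinear_eq, Matrix.mul_assoc, hA.kernel, Matrix.mul_zero, zero_add]

theorem conjugateChart_bijOn_matrices (hZ : (leadingBlock Z).det ≠ 0)
    (hA : IsFiberFrame Z Y A) :
    Set.BijOn (conjugateChart A) Set.univ {C | C * Zᵀ = Y} := by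
  have h0 : Set.BijOn (negCol (l := l)) Set.univ Set.univ := by
    refine ⟨fun _ _ => trivial, fun x _ y _ h => funext fun a => ?_,
      fun X _ => ⟨fun a => -X a 0, trivial, ?_⟩⟩
    · exact neg_injective (congrFun (congrFun h a) 0)
    · ext a j
      rw [Subsingleton.elim j 0]
      simp [negCol]
  refine ((hA.bijective_chart hZ).comp h0).congr fun y _ => ?_
  rw [conjugateChart_eq]
  rfl

theorem conjugateChart_bijOn (hZ : (leadingBlock Z).det ≠ 0) (hY : LinearIndependent ℝ Y.row)
    (hA : IsFiberFrame Z Y A) :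
    Set.BijOn (fun y => rowSpan (conjugateChart A y)) Set.univ (fiber l m Z (rowSpan Y)) :=
  (bijOn_rowSpan_fiber Z hY).comp (conjugateChart_bijOn_matrices hZ hA)

theorem dotProduct_normalVector (A : Matrix (Fin 1 ⊕ Fin l) (Fin (l + m + 1)) ℝ)
    {I : Finset (Fin (l + m + 1))} (hI : I.card = l) (v : Fin 1 ⊕ Fin l → ℝ) :
    v ⬝ᵥ normalVector A I = (Matrix.fromCols (Matrix.of fun s (_ : Fin 1) => v s)
      (A.submatrix id (I.orderEmbOfFin hI))).det := by
  let M : Matrix (Fin 1 ⊕ Fin l) (Fin 1 ⊕ Fin l) ℝ :=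
    Matrix.fromCols 0 (A.submatrix id (I.orderEmbOfFin hI))
  have h : ∀ w : Fin 1 ⊕ Fin l → ℝ, (Matrix.fromCols (Matrix.of fun s (_ : Fin 1) => w s)
      (A.submatrix id (I.orderEmbOfFin hI))).det = M.cramer w (Sum.inl 0) := fun w => by
    rw [Matrix.cramer_apply]
    congr 1
    ext s t
    rcases t with t | t
    · rw [Subsingleton.elim t 0]
      simp
    · simp [M]
  have hv : v = ∑ r, v r • fun s => if s = r then (1 : ℝ) else 0 := by
    ext s
    simp
  rw [h, hv, map_sum, Finset.sum_apply]
  rw [← hv]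
  refine Finset.sum_congr rfl fun r _ => ?_
  rw [map_smul, Pi.smul_apply, smul_eq_mul, ← h, normalVector, dif_pos hI]

/-- Subtracting multiples of the first row from the others in `(λ̄ | A^I)` turns the column `λ̄`
into the first basis vector and leaves the columns `I` of `λA` as the lower right block. -/
theorem lamBar_dotProduct_normalVector (A : Matrix (Fin 1 ⊕ Fin l) (Fin (l + m + 1)) ℝ)
    {I : Finset (Fin (l + m + 1))} (hI : I.card = l) (y : Fin l → ℝ) :
    lamBar y ⬝ᵥ normalVector A I = plucker (conjugateChart A y) I := by
  rw [dotProduct_normalVector A hI, plucker_of_card _ hI]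
  let B : Matrix (Fin 1 ⊕ Fin l) (Fin l) ℝ := A.submatrix id (I.orderEmbOfFin hI)
  let P : Matrix (Fin 1 ⊕ Fin l) (Fin 1 ⊕ Fin l) ℝ :=
    Matrix.fromBlocks 1 0 (Matrix.of fun a _ => -y a) 1
  have hP : P.det = 1 := by simp [P]
  have hmul : P * Matrix.fromCols (Matrix.of fun s (_ : Fin 1) => lamBar y s) B =
      Matrix.fromBlocks 1 (B.submatrix Sum.inl id) 0
        ((conjugateChart A y).submatrix id (I.orderEmbOfFin hI)) := by
    ext s t
    rcases s with s | s <;> rcases t with t | t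
    · rw [Subsingleton.elim s 0, Subsingleton.elim t 0]
      simp [P, Matrix.mul_apply, lamBar]
    · rw [Subsingleton.elim s 0]
      simp [P, Matrix.mul_apply]
    · simp [P, Matrix.mul_apply, lamBar, Matrix.one_apply]
    · simp [P, B, Matrix.mul_apply, conjugateChart, dualLam]
  have hdet := congrArg Matrix.det hmul
  rw [Matrix.det_mul, hP, one_mul, Matrix.det_fromBlocks_zero₂₁, Matrix.det_one, one_mul] at hdet
  exact hdet

theorem normalVector_dotProduct_col (A : Matrix (Fin 1 ⊕ Fin l) (Fin (l + m + 1)) ℝ)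
    {I : Finset (Fin (l + m + 1))} (hI : I.card = l) {j : Fin (l + m + 1)} (hj : j ∈ I) :
    normalVector A I ⬝ᵥ A.col j = 0 := by
  rw [dotProduct_comm, dotProduct_normalVector A hI]
  obtain ⟨t, rfl⟩ : j ∈ Set.range (I.orderEmbOfFin hI) := by rwa [Finset.range_orderEmbOfFin]
  refine Matrix.det_zero_of_column_eq (i := Sum.inl 0) (j := Sum.inr t) (by simp) fun s => ?_
  simp

theorem lamBar_dotProduct (w : Fin 1 ⊕ Fin l → ℝ) (y : Fin l → ℝ) :
    lamBar y ⬝ᵥ w = (w ∘ Sum.inr) ⬝ᵥ y + w (Sum.inl 0) := by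
  simp [lamBar, dotProduct, mul_comm, add_comm]

/-- Each of the `l` rows contributes one one-form, the differential of its last entry, which is
`-λ̄_α` times the last entry of the kernel row plus a constant. -/
theorem pullback_conjugateChart (hZ : (leadingBlock Z).det ≠ 0)
    (hY : LinearIndependent ℝ Y.row) (hA : IsFiberFrame Z Y A)
    {ω : Matrix (Fin l) (Fin (l + m + 1)) ℝ → Forms (Matrix (Fin l) (Fin (l + m + 1)) ℝ)}
    (hω : IsFiberFactor Z ω) (y : Fin l → ℝ)
    (hy : ∀ i, lamBar y ⬝ᵥ normalVector A (cyclicInterval l i) ≠ 0) :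
    pullback (conjugateChart A) ω y =
      (fiberConst Z * (-trailingMinor A 0 0) ^ l /
        ∏ i, lamBar y ⬝ᵥ normalVector A (cyclicInterval l i)) • coordVolume l := by
  have hpl : ∀ i, lamBar y ⬝ᵥ normalVector A (cyclicInterval l i) =
      plucker (conjugateChart A y) (cyclicInterval l i) := fun i =>
    lamBar_dotProduct_normalVector A (card_cyclicInterval (by omega) i) y
  have hchart : conjugateChart A =
      fun y => conjugateChartLinear A y + A.submatrix Sum.inr id := funext (conjugateChart_eq A)
  have hC : conjugateChart A y ∈ regularLocus Z :=
    ⟨fun j => by rw [← hpl]; exact hy j, by rwa [conjugateChart_mul_transpose hA]⟩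
  have hD : ∀ v, conjugateChartLinear A v * Zᵀ = 0 := fun v => by
    rw [conjugateChartLinear_eq, Matrix.mul_assoc, hA.kernel, Matrix.mul_zero]
  rw [hchart, pullback_affine, ← conjugateChart_eq,
    map_fiberFactor_eq hZ hω hC (mul_one l).symm _ hD, map_fiberForm _ _ hD]
  simp only [hpl]
  have hvol : (List.ofFn fun α : Fin l => wedge (List.ofFn fun j : Fin 1 =>
      coord (Fin.natAdd (l + m) j) ∘ₗ rowMap α ∘ₗ conjugateChartLinear A)).prod =
      (-trailingMinor A 0 0) ^ l • coordVolume l := by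
    rw [coordVolume_eq_wedge, wedge, List.map_ofFn, ← prod_ofFn_smul]
    congr 2
    funext α
    rw [List.ofFn_succ, List.ofFn_zero, wedge_cons, wedge_nil, mul_one, Function.comp_apply,
      ← map_smul]
    congr 1
    apply LinearMap.ext
    intro v
    simp [conjugateChartLinear_apply, trailingMinor, mul_comm]
  rw [hvol, smul_smul]
  congr 1
  rw [div_eq_mul_inv, mul_right_comm]

/-! ### Position of the hyperplanes -/

/-- The entries are the signed minors with one column omitted. -/
theorem exists_alternating_kernel_vector (hTP : TotallyPositive Z) :
    ∃ u : Fin (l + m + 1) → ℝ, Z *ᵥ u = 0 ∧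
      ∀ i : Fin (l + m + 1), 0 < (-1) ^ (i : ℕ) * u i := by
  refine ⟨minorVector Z id, mulVec_minorVector Z id, fun i => ?_⟩
  have h := minorVector_apply Z (w := id) Function.injective_id i
  rw [id] at h
  rw [h, ← mul_assoc, ← mul_pow]
  simpa using hTP.det_pos (Fin.strictMono_succAbove i)

theorem frame_kernel_row (hTP : TotallyPositive Z) (hA : IsFiberFrame Z Y A)
    {u : Fin (l + m + 1) → ℝ} (hu : Z *ᵥ u = 0) : ∃ s : ℝ, ∀ i, u i = s * A (Sum.inl 0) i := by
  obtain ⟨x, rfl⟩ := hA.exists_of_mem_kernel hTP.det_leading_ne_zero hu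
  exact ⟨x 0, fun i => by simp [Matrix.vecMul, dotProduct]⟩

theorem frame_kernel_row_ne_zero (hTP : TotallyPositive Z) (hA : IsFiberFrame Z Y A)
    (i : Fin (l + m + 1)) : A (Sum.inl 0) i ≠ 0 := by
  obtain ⟨u, hu, hpos⟩ := exists_alternating_kernel_vector hTP
  obtain ⟨s, hs⟩ := frame_kernel_row hTP hA hu
  intro h
  have := hpos i
  rw [hs, h, mul_zero, mul_zero] at this
  exact lt_irrefl _ this

theorem exists_totallyPositive_lift (hY : LinearIndependent ℝ Y.row)
    (hamp : rowSpan Y ∈ amplituhedron l m Z) :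
    ∃ (C : Matrix (Fin l) (Fin (l + m + 1)) ℝ) (G : Matrix (Fin l) (Fin l) ℝ),
      TotallyPositive C ∧ G.det ≠ 0 ∧ G * C * Zᵀ = Y := by
  obtain ⟨V, ⟨C, hC, rfl⟩, hV⟩ := hamp
  have h1 : ∀ α, ∃ g : Fin l → ℝ, g ᵥ* (C * Zᵀ) = Y α := fun α => by
    have h2 : Y α ∈ (rowSpan C).map Z.mulVecLin := by
      rw [show (rowSpan C).map Z.mulVecLin = rowSpan Y from hV]
      exact Submodule.subset_span ⟨α, rfl⟩
    obtain ⟨v, hv, hvY⟩ := Submodule.mem_map.1 h2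
    obtain ⟨g, rfl⟩ := mem_rowSpan.1 hv
    exact ⟨g, by rw [← mulVec_vecMul]; exact hvY⟩
  choose G hG using h1
  have hG' : Matrix.of G * C * Zᵀ = Y := by
    rw [Matrix.mul_assoc]
    ext α a
    rw [← hG]
    rfl
  refine ⟨C, Matrix.of G, hC, fun hdet => ?_, hG'⟩
  obtain ⟨v, hv, h0⟩ := Matrix.exists_vecMul_eq_zero_iff.2 hdet
  refine hv ((vecMul_eq_zero_iff hY).1 ?_)
  rw [← hG', ← Matrix.vecMul_vecMul, ← Matrix.vecMul_vecMul, h0, Matrix.zero_vecMul,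
    Matrix.zero_vecMul]

/-- The fiber over a point of the amplituhedron contains a totally positive subspace; its minor
`p_I`, a value of this linear form, is not zero. -/
theorem normalVector_ne_zero (hTP : TotallyPositive Z) (hY : LinearIndependent ℝ Y.row)
    (hamp : rowSpan Y ∈ amplituhedron l m Z) (hA : IsFiberFrame Z Y A)
    {I : Finset (Fin (l + m + 1))} (hI : I.card = l) : normalVector A I ≠ 0 := by
  obtain ⟨C, G, hC, hG, hCY⟩ := exists_totallyPositive_lift hY hamp
  obtain ⟨y, -, hy⟩ :=
    (conjugateChart_bijOn_matrices hTP.det_leading_ne_zero hA).surjOn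
      (show G * C ∈ {C | C * Zᵀ = Y} from hCY)
  intro h
  have h1 := lamBar_dotProduct_normalVector A hI y
  rw [h, dotProduct_zero, hy, plucker_mul] at h1
  exact mul_ne_zero hG (hC I hI).ne' h1.symm

/-- Otherwise orthogonality to a column in `I` would force an entry of the kernel row to vanish, but
all of these are nonzero. Hence the equation defines a hyperplane. -/
theorem normalVector_inr_ne_zero (hTP : TotallyPositive Z) (hY : LinearIndependent ℝ Y.row)
    (hamp : rowSpan Y ∈ amplituhedron l m Z) (hA : IsFiberFrame Z Y A) (hl : 1 ≤ l)
    {I : Finset (Fin (l + m + 1))} (hI : I.card = l) : normalVector A I ∘ Sum.inr ≠ 0 := by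
  intro h
  obtain ⟨j, hj⟩ : I.Nonempty := Finset.card_pos.1 (by omega)
  have h1 := normalVector_dotProduct_col A hI hj
  have h2 : ∀ a, normalVector A I (Sum.inr a) = 0 := congrFun h
  have h3 : normalVector A I (Sum.inl 0) * A (Sum.inl 0) j = 0 := by
    simpa [dotProduct, h2] using h1
  refine normalVector_ne_zero hTP hY hamp hA hI (funext fun r => ?_)
  rcases r with r | a
  · rw [Subsingleton.elim r 0]
    exact (mul_eq_zero.1 h3).resolve_right (frame_kernel_row_ne_zero hTP hA j)
  · exact h2 a

/-- If the hyperplanes of `I` and `J` agree, then a vector in `Z⁻¹(Y)`, not in `ker Z`, vanishes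
on `I ∪ J`. -/
theorem exists_vector_of_hyperplanes_eq (hTP : TotallyPositive Z)
    (hY : LinearIndependent ℝ Y.row) (hamp : rowSpan Y ∈ amplituhedron l m Z)
    (hA : IsFiberFrame Z Y A) (hl : 1 ≤ l)
    {I J : Finset (Fin (l + m + 1))} (hI : I.card = l) (hJ : J.card = l)
    (h : {y | lamBar y ⬝ᵥ normalVector A I = 0} = {y | lamBar y ⬝ᵥ normalVector A J = 0}) :
    ∃ (u : Fin (l + m + 1) → ℝ) (c : Fin l → ℝ), c ≠ 0 ∧ Z *ᵥ u = c ᵥ* Y ∧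
      ∀ i ∈ I ∪ J, u i = 0 := by
  have hne := normalVector_inr_ne_zero hTP hY hamp hA hl hI
  simp only [lamBar_dotProduct] at h
  obtain ⟨s, hs1, hs2⟩ := proportional_of_zeros_eq hne h
  have hs : normalVector A J = s • normalVector A I := by
    funext r
    rcases r with r | a
    · rw [Subsingleton.elim r 0]
      exact hs2
    · exact congrFun hs1 a
  have hs0 : s ≠ 0 := fun h0 =>
    normalVector_ne_zero hTP hY hamp hA hJ (by rw [hs, h0, zero_smul])
  -- The normal serves as coefficient vector for the rows of `A`: entry `i` of the combination is
  -- the normal times `Aⁱ`, which vanishes for `i` in `I` and, the normals being proportional, in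
  -- `J`.
  refine ⟨normalVector A I ᵥ* A, normalVector A I ∘ Sum.inr, hne, ?_, fun i hi => ?_⟩
  · have hsum : normalVector A I ᵥ* A =
        (normalVector A I ∘ Sum.inl) ᵥ* A.submatrix Sum.inl id +
        (normalVector A I ∘ Sum.inr) ᵥ* A.submatrix Sum.inr id := by
      ext i
      simp [Matrix.vecMul, dotProduct]
    rw [hsum, Matrix.mulVec_add, mulVec_vecMul, mulVec_vecMul, hA.kernel, hA.lift,
      Matrix.vecMul_zero, zero_add]
  · show normalVector A I ⬝ᵥ A.col i = 0
    rcases Finset.mem_union.1 hi with hi | hi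
    · exact normalVector_dotProduct_col A hI hi
    · have h1 := normalVector_dotProduct_col A hJ hi
      rw [hs, smul_dotProduct, smul_eq_mul] at h1
      exact (mul_eq_zero.1 h1).resolve_left hs0

/-- For even `m`, the union of two cyclic intervals of length `l ≥ 2` contains an increasing
sequence of `l + 1` elements with alternating parities. -/
theorem exists_alternating_sequence (hl : 2 ≤ l) (hm : Even m) {i j : Fin (l + m + 1)}
    (hij : i ≠ j) :
    ∃ w : Fin (l + 1) → Fin (l + m + 1), StrictMono w ∧
      (∀ r, w r ∈ cyclicInterval l i ∪ cyclicInterval l j) ∧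
      ∃ e : ℕ, ∀ r, ((w r : ℕ) + r + e) % 2 = 0 := by
  wlog hlt : i < j generalizing i j
  · obtain ⟨w, h1, h2, h3⟩ := this hij.symm (lt_of_le_of_ne (not_lt.1 hlt) hij.symm)
    exact ⟨w, h1, fun r => by rw [Finset.union_comm]; exact h2 r, h3⟩
  obtain ⟨p, hp⟩ := hm
  have hi := i.2
  have hj := j.2
  have hlt' : (i : ℕ) < j := hlt
  have hmem : ∀ s t : Fin (l + m + 1), s ∈ cyclicInterval l t ↔
      ((t : ℕ) ≤ s ∧ (s : ℕ) < t + l) ∨ (s : ℕ) + (l + m + 1) < t + l := fun s t =>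
    mem_cyclicInterval (by omega)
  suffices h : ∃ (f : ℕ → ℕ) (e : ℕ), ∀ r ≤ l, f r < l + m + 1 ∧ (r < l → f r < f (r + 1)) ∧
      ((((i : ℕ) ≤ f r ∧ f r < i + l) ∨ f r + (l + m + 1) < i + l) ∨
        (((j : ℕ) ≤ f r ∧ f r < j + l) ∨ f r + (l + m + 1) < j + l)) ∧
      (f r + r + e) % 2 = 0 by
    obtain ⟨f, e, hf⟩ := h
    refine ⟨fun r => ⟨f r, (hf r (by omega)).1⟩, ?_, fun r => ?_, e, fun r => ?_⟩
    · rw [Fin.strictMono_iff_lt_succ]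
      intro r
      exact (hf r (by omega)).2.1 r.2
    · rw [Finset.mem_union, hmem, hmem]
      exact (hf r (by omega)).2.2.1
    · exact (hf r (by omega)).2.2.2
  -- If `I_i` does not wrap around, its `l` consecutive elements alternate in parity; one more
  -- element `s` of `I_j`, beyond them and with the parity of `i + l`, completes the sequence.
  have after : ∀ s : ℕ, (i : ℕ) + l ≤ l + m + 1 → (i : ℕ) + l ≤ s → s < l + m + 1 →
      (((j : ℕ) ≤ s ∧ s < j + l) ∨ s + (l + m + 1) < j + l) → (s + i + l) % 2 = 0 →
      ∃ (f : ℕ → ℕ) (e : ℕ), ∀ r ≤ l, f r < l + m + 1 ∧ (r < l → f r < f (r + 1)) ∧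
      ((((i : ℕ) ≤ f r ∧ f r < i + l) ∨ f r + (l + m + 1) < i + l) ∨
        (((j : ℕ) ≤ f r ∧ f r < j + l) ∨ f r + (l + m + 1) < j + l)) ∧
      (f r + r + e) % 2 = 0 := by
    intro s h0 h1 h2 h3 h4
    refine ⟨fun r => if r < l then i + r else s, i, fun r hr => ?_⟩
    dsimp only
    refine ⟨?_, ?_, ?_, ?_⟩ <;> split_ifs <;> omega
  -- The same with `s` in front of `I_i`, of the parity opposite to `i`.
  have before : ∀ s : ℕ, (i : ℕ) + l ≤ l + m + 1 → s < i →
      (((j : ℕ) ≤ s ∧ s < j + l) ∨ s + (l + m + 1) < j + l) → (s + i + 1) % 2 = 0 →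
      ∃ (f : ℕ → ℕ) (e : ℕ), ∀ r ≤ l, f r < l + m + 1 ∧ (r < l → f r < f (r + 1)) ∧
      ((((i : ℕ) ≤ f r ∧ f r < i + l) ∨ f r + (l + m + 1) < i + l) ∨
        (((j : ℕ) ≤ f r ∧ f r < j + l) ∨ f r + (l + m + 1) < j + l)) ∧
      (f r + r + e) % 2 = 0 := by
    intro s h0 h1 h3 h4
    refine ⟨fun r => if r = 0 then s else i + r - 1, s, fun r hr => ?_⟩
    dsimp only
    refine ⟨?_, ?_, ?_, ?_⟩
    · split_ifs <;> omega
    · intro hrl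
      rw [if_neg (Nat.succ_ne_zero r)]
      split_ifs <;> omega
    · split_ifs <;> omega
    · split_ifs <;> omega
  -- If `I_j` does not wrap, either `i + l` belongs to it, or one of `j`, `j + 1` has the right
  -- parity; the latter uses `l ≥ 2`.
  rcases le_or_gt ((j : ℕ) + l) (l + m + 1) with hwj | hwj
  · rcases le_or_gt (j : ℕ) (i + l) with h1 | h1
    · exact after (i + l) (by omega) le_rfl (by omega) (by omega) (by omega)
    · rcases Nat.mod_two_eq_zero_or_one (j + i + l) with h2 | h2
      · exact after j (by omega) (by omega) (by omega) (by omega) h2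
      · exact after (j + 1) (by omega) (by omega) (by omega) (by omega) (by omega)
  -- Now `I_j` wraps and contains both `l + m` and `0`. As `m` is even, the first fits for even `i`
  -- and the second for odd `i`.
  rcases le_or_gt ((i : ℕ) + l) (l + m + 1) with hwi | hwi
  · rcases Nat.mod_two_eq_zero_or_one i with h1 | h1
    · exact after (l + m) (by omega) (by omega) (by omega) (by omega) (by omega)
    · exact before 0 (by omega) (by omega) (by omega) (by omega)
  -- Both intervals wrap: the initial piece of `I_i`, extended by one element of `I_j`, is followed
  -- by a final piece of `I_i`. The jump by the even number `m` preserves parity.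
  · refine ⟨fun r => if r + (l + m + 1) ≤ i + l then r else r + m, 0, fun r hr => ?_⟩
    dsimp only
    refine ⟨?_, ?_, ?_, ?_⟩ <;> split_ifs <;> omega

/-- On `l + 1` columns, a vector of the row span is orthogonal to the maximal minors taken with
alternating signs. If its own signs alternated too, the sum would be positive. -/
theorem not_alternating_of_totallyPositive {n : ℕ} {C : Matrix (Fin l) (Fin n) ℝ}
    (hC : TotallyPositive C) (t : Fin l → ℝ) {w : Fin (l + 1) → Fin n} (hw : StrictMono w) :
    ¬ ∀ r : Fin (l + 1), 0 < (-1) ^ (r : ℕ) * (t ᵥ* C) (w r) := by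
  intro h
  have h1 : ∑ r : Fin (l + 1), (C.submatrix id (w ∘ r.succAbove)).det *
      ((-1) ^ (r : ℕ) * (t ᵥ* C) (w r)) = 0 := by
    have h2 : ∀ r : Fin (l + 1), (C.submatrix id (w ∘ r.succAbove)).det *
        ((-1) ^ (r : ℕ) * (t ᵥ* C) (w r)) = ∑ a, t a * ((-1) ^ (r : ℕ) *
          ((C.submatrix id w).submatrix id r.succAbove).det * (C.submatrix id w) a r) :=
      fun r => by
        rw [Matrix.submatrix_submatrix, Matrix.vecMul, dotProduct, Finset.mul_sum,
          Finset.mul_sum]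
        refine Finset.sum_congr rfl fun a _ => ?_
        simp only [Function.comp_id, Matrix.submatrix_apply, id]
        ring
    simp only [h2]
    rw [Finset.sum_comm]
    simp only [← Finset.mul_sum, sum_minors_mul, mul_zero, Finset.sum_const_zero]
  refine (Finset.sum_pos (fun r _ => mul_pos ?_ (h r)) ⟨0, Finset.mem_univ _⟩).ne' h1
  exact hC.det_pos (hw.comp (Fin.strictMono_succAbove r))

theorem totallyPositive_vecMul_eq_zero {n : ℕ} {C : Matrix (Fin l) (Fin n) ℝ}
    (hC : TotallyPositive C) {t : Fin l → ℝ} {I : Finset (Fin n)} (hI : I.card = l)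
    (h : ∀ i ∈ I, (t ᵥ* C) i = 0) : t = 0 := by
  have h1 := (hC I hI).ne'
  rw [plucker_of_card _ hI] at h1
  exact Matrix.eq_zero_of_vecMul_eq_zero h1
    (funext fun r => h _ (Finset.orderEmbOfFin_mem I hI r))

theorem conjugate_hyperplanes_distinct_of_even (hTP : TotallyPositive Z)
    (hY : LinearIndependent ℝ Y.row) (hamp : rowSpan Y ∈ amplituhedron l m Z)
    (hA : IsFiberFrame Z Y A) (hl : 2 ≤ l) (hm : Even m) {i j : Fin (l + m + 1)} (hij : i ≠ j) :
    {y | lamBar y ⬝ᵥ normalVector A (cyclicInterval l i) = 0} ≠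
      {y | lamBar y ⬝ᵥ normalVector A (cyclicInterval l j) = 0} := by
  intro heq
  have hcard : ∀ i, (cyclicInterval l i : Finset (Fin (l + m + 1))).card = l :=
    card_cyclicInterval (by omega)
  obtain ⟨u, c, hc, hu, hu0⟩ := exists_vector_of_hyperplanes_eq hTP hY hamp hA (by omega)
    (hcard i) (hcard j) heq
  obtain ⟨C, G, hC, hG, hCY⟩ := exists_totallyPositive_lift hY hamp
  obtain ⟨κ, hκ, hκpos⟩ := exists_alternating_kernel_vector hTP
  let t : Fin l → ℝ := c ᵥ* G
  have ht : t ≠ 0 := fun h => hc (Matrix.eq_zero_of_vecMul_eq_zero hG h)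
  have hker : Z *ᵥ (t ᵥ* C - u) = 0 := by
    rw [Matrix.mulVec_sub, hu, mulVec_vecMul, ← hCY, Matrix.mul_assoc, ← Matrix.vecMul_vecMul c,
      sub_self]
  obtain ⟨s₁, hs₁⟩ := frame_kernel_row hTP hA hker
  obtain ⟨s₂, hs₂⟩ := frame_kernel_row hTP hA hκ
  have hs₂0 : s₂ ≠ 0 := fun h => by
    have := hκpos 0
    rw [hs₂, h, zero_mul, mul_zero] at this
    exact lt_irrefl _ this
  have hprop : ∀ r ∈ cyclicInterval l i ∪ cyclicInterval l j,
      (t ᵥ* C) r = s₁ / s₂ * κ r := fun r hr => by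
    have h1 := hs₁ r
    rw [Pi.sub_apply, hu0 r hr, sub_zero] at h1
    rw [h1, hs₂]
    field_simp
  -- Otherwise `tC` would vanish on the `l` columns of `I_i`, whose minor is positive.
  have hs₁0 : s₁ ≠ 0 := fun h => ht (totallyPositive_vecMul_eq_zero hC (hcard i) fun r hr => by
    rw [hprop r (Finset.mem_union_left _ hr), h, zero_div, zero_mul])
  obtain ⟨w, hw, hwmem, e, he⟩ := exists_alternating_sequence hl hm hij
  -- The scalar turns `tC` into `(-1)^e κ` on the union; along `w` the sign of `κ` is `(-1)^{r+e}`.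
  refine not_alternating_of_totallyPositive hC ((s₂ / s₁ * (-1) ^ e) • t) hw fun r => ?_
  rw [Matrix.smul_vecMul, Pi.smul_apply, hprop _ (hwmem r), smul_eq_mul]
  have h1 : (-1 : ℝ) ^ ((w r : ℕ)) = (-1) ^ (r : ℕ) * (-1) ^ e := by
    have h2 : Even ((w r : ℕ) + (r + e)) := Nat.even_iff.2 (by rw [← add_assoc]; exact he r)
    rw [← pow_add]
    rcases Nat.even_or_odd (w r : ℕ) with h3 | h3
    · rw [h3.neg_one_pow, ((Nat.even_add.1 h2).1 h3).neg_one_pow]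
    · rw [h3.neg_one_pow, Odd.neg_one_pow]
      rw [← Nat.not_even_iff_odd] at h3 ⊢
      exact fun h4 => h3 ((Nat.even_add.1 h2).2 h4)
  have h2 := hκpos (w r)
  rw [h1] at h2
  convert h2 using 1
  field_simp

theorem conjugate_hyperplanes_distinct_of_generic (hTP : TotallyPositive Z)
    (hY : LinearIndependent ℝ Y.row) (hamp : rowSpan Y ∈ amplituhedron l m Z)
    (hA : IsFiberFrame Z Y A) (hl : 1 ≤ l) (hgen : IsGenericPoint Z Y) {i j : Fin (l + m + 1)}
    (hij : i ≠ j) :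
    {y | lamBar y ⬝ᵥ normalVector A (cyclicInterval l i) = 0} ≠
      {y | lamBar y ⬝ᵥ normalVector A (cyclicInterval l j) = 0} := by
  intro heq
  have hcard : ∀ i, (cyclicInterval l i : Finset (Fin (l + m + 1))).card = l :=
    card_cyclicInterval (by omega)
  obtain ⟨u, c, hc, hu, hu0⟩ := exists_vector_of_hyperplanes_eq hTP hY hamp hA hl
    (hcard i) (hcard j) heq
  have hlt : l < (cyclicInterval l i ∪ cyclicInterval l j).card := by
    refine (hcard i).symm.trans_lt
      (Finset.card_lt_card (Finset.ssubset_iff_subset_ne.2 ⟨Finset.subset_union_left, fun h => ?_⟩))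
    · have h1 : cyclicInterval l j ⊆ cyclicInterval l i :=
        h.symm ▸ Finset.subset_union_right
      exact hij (cyclicInterval_injective hl (by omega)
        (Finset.eq_of_subset_of_card_le h1 (by rw [hcard, hcard])).symm)
  -- Distinct intervals have a union of at least `l + 1` elements; the complement of `l + 1` of them
  -- consists of `m` columns, which carry `u`.
  obtain ⟨S, hS1, hS2⟩ := Finset.exists_subset_card_eq (Nat.succ_le_of_lt hlt)
  have h1 : c ᵥ* Y ∈ Submodule.span ℝ (Z.col '' ((Sᶜ : Finset _) : Set (Fin (l + m + 1)))) := by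
    rw [← hu]
    exact mulVec_mem_span_col Z fun r hr => hu0 r (hS1 (by simpa using hr))
  have h2 := Submodule.disjoint_def.1 (hgen Sᶜ (by
    rw [Finset.card_compl, Fintype.card_fin, hS2]
    omega)) _ (mem_rowSpan.2 ⟨c, rfl⟩) h1
  exact hc ((vecMul_eq_zero_iff hY).1 h2)

/-! ### The formula for conjugates and its normalisation. -/

theorem fiberConst_ne_zero (hTP : TotallyPositive Z) : fiberConst Z ≠ 0 :=
  mul_ne_zero (pow_ne_zero _ (div_ne_zero (pow_ne_zero _ (by norm_num))
    hTP.det_leading_ne_zero)) (pow_ne_zero _ (by norm_num))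

theorem conjugateFiberFormula_of_frame (hl : 1 ≤ l) (hTP : TotallyPositive Z)
    (hY : LinearIndependent ℝ Y.row) (hamp : rowSpan Y ∈ amplituhedron l m Z)
    (hA : IsFiberFrame Z Y A) :
    ConjugateFiberFormula Z Y A (fiberConst Z * (-trailingMinor A 0 0) ^ l) where
  frame := hA
  normal i := ⟨normalVector_ne_zero hTP hY hamp hA (card_cyclicInterval (by omega) i),
    fun _ hj => normalVector_dotProduct_col A (card_cyclicInterval (by omega) i) hj⟩
  coordinates := conjugateChart_bijOn hTP.det_leading_ne_zero hY hA
  formula _ hω y hy := pullback_conjugateChart hTP.det_leading_ne_zero hY hA hω y hy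
  simplePoles h ω hω := by
    refine hasSimplePolesOn_of_formula
      (fun i y => lamBar_dotProduct (normalVector A (cyclicInterval l i)) y)
      (fun i => normalVector_inr_ne_zero hTP hY hamp hA hl (card_cyclicInterval (by omega) i))
      (fun i j hij => ?_)
      (mul_ne_zero (fiberConst_ne_zero hTP)
        (pow_ne_zero _ (neg_ne_zero.2 (frame_kernel_row_ne_zero hTP hA _))))
      (pullback_conjugateChart hTP.det_leading_ne_zero hY hA hω)
    rcases h with ⟨h1, h2⟩ | h
    · exact conjugate_hyperplanes_distinct_of_even hTP hY hamp hA h1 h2 hij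
    · exact conjugate_hyperplanes_distinct_of_generic hTP hY hamp hA hl h hij

theorem conjugateFiberFormula_fiberMatrix (hl : 1 ≤ l) (hTP : TotallyPositive Z)
    (hY : LinearIndependent ℝ Y.row) (hamp : rowSpan Y ∈ amplituhedron l m Z) :
    ConjugateFiberFormula Z Y (fiberMatrix Z Y)
      ((-1) ^ (l + m * (l + 1).choose 2) / (leadingBlock Z).det ^ l) := by
  have h := conjugateFiberFormula_of_frame hl hTP hY hamp
    (isFiberFrame_scaledFrame hTP.det_leading_ne_zero hY (r := 1) fun _ => one_ne_zero)
  -- The rows give `ml` signs, their regrouping `m (l.choose 2)` and the coordinates `-λ̄` another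
  -- `l`; the first two add up to `m ((l + 1).choose 2)`.
  have hconst : fiberConst Z * (-trailingMinor (scaledFrame Z Y 1) 0 0) ^ l =
      (-1) ^ (l + m * (l + 1).choose 2) / (leadingBlock Z).det ^ l := by
    rw [trailingMinor_scaledFrame, Matrix.diagonal_apply_eq, Pi.one_apply, fiberConst, rowConst,
      div_pow, div_mul_eq_mul_div, div_mul_eq_mul_div, ← pow_mul, ← pow_add, ← pow_add,
      Nat.choose_succ_succ' l 1, Nat.choose_one_right]
    congr 2
    ring
  rwa [hconst, scaledFrame_one] at h

theorem exists_conjugateFiberFormula_one (hl : 1 ≤ l) (hm : Even m) (hTP : TotallyPositive Z)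
    (hY : LinearIndependent ℝ Y.row) (hamp : rowSpan Y ∈ amplituhedron l m Z) :
    ∃ A, ConjugateFiberFormula Z Y A 1 := by
  have hdet : (leadingBlock Z).det ≠ 0 := hTP.det_leading_ne_zero
  -- Scaling the kernel row by `-det z̃` cancels both `(det z̃)^{-l}` and `(-1)^l`; the other signs
  -- are trivial for even `m`.
  have h := conjugateFiberFormula_of_frame hl hTP hY hamp
    (isFiberFrame_scaledFrame hdet hY (r := fun _ => -(leadingBlock Z).det)
      fun _ => neg_ne_zero.2 hdet)
  have hconst : fiberConst Z *
      (-trailingMinor (scaledFrame Z Y fun _ => -(leadingBlock Z).det) 0 0) ^ l = 1 := by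
    rw [trailingMinor_scaledFrame, Matrix.diagonal_apply_eq, neg_neg, fiberConst, rowConst,
      one_mul, hm.neg_one_pow, (hm.mul_left _).neg_one_pow, mul_one, ← mul_pow,
      one_div_mul_cancel hdet, one_pow]
  rw [hconst] at h
  exact ⟨_, h⟩

end Conjugates

end Amplituhedron

end

open Amplituhedron in
theorem mainTheorem11 :
    (∀ (m l : ℕ) (Z : Matrix (Fin (1 + m)) (Fin (1 + m + l)) ℝ)
      (Y : Matrix (Fin 1) (Fin (1 + m)) ℝ),
      TotallyPositive Z → LinearIndependent ℝ Y.row → rowSpan Y ∈ amplituhedron 1 m Z →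
      (∃ ω, IsFiberFactor Z ω ∧ IsRegularRational Z ω) ∧
      PolytopeFiberFormula Z Y (fiberMatrix Z Y) ((-1) ^ (l * m) / (leadingBlock Z).det) ∧
      (1 ≤ l → ∃ A, PolytopeFiberFormula Z Y A 1)) ∧
    (∀ (m l : ℕ) (Z : Matrix (Fin (l + m)) (Fin (l + m + 1)) ℝ)
      (Y : Matrix (Fin l) (Fin (l + m)) ℝ),
      1 ≤ l →
      TotallyPositive Z → LinearIndependent ℝ Y.row → rowSpan Y ∈ amplituhedron l m Z →
      (∃ ω, IsFiberFactor Z ω ∧ IsRegularRational Z ω) ∧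
      ConjugateFiberFormula Z Y (fiberMatrix Z Y)
        ((-1) ^ (l + m * (l + 1).choose 2) / (leadingBlock Z).det ^ l) ∧
      (Even m → ∃ A, ConjugateFiberFormula Z Y A 1)) := by
  refine ⟨fun m l Z Y hTP hY _ => ⟨⟨fiberForm Z, isFiberFactor_fiberForm hTP.det_leading_ne_zero,
      isRegularRational_fiberForm Z⟩, polytopeFiberFormula_fiberMatrix hTP hY,
      exists_polytopeFiberFormula_one hTP hY⟩,
    fun m l Z Y hl hTP hY hamp => ⟨⟨fiberForm Z,
      isFiberFactor_fiberForm hTP.det_leading_ne_zero, isRegularRational_fiberForm Z⟩,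
      conjugateFiberFormula_fiberMatrix hl hTP hY hamp,
      fun hm => exists_conjugateFiberFormula_one hl hm hTP hY hamp⟩⟩
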